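/- **Setting.** Let $d\in\mathbb N$, $T>0$, $q\in(1,\infty)$. Let $\mathcal P_1(\mathbb R^d)$ be the set of Borel probability measures on $\mathbb R^d$ with finite first moment, with the Kantorovich–Rubinstein distance $d_1$, and let $\Gamma=C([0,T];\mathbb R^d)$ with the uniform topology. Assume: (i) $\ell:\mathbb R^d\to\mathbb R$ is continuous and, for some constants $\underline\ell,\overline\ell,C_\ell>0$, $\ \underline\ell|\alpha|^q-C_\ell\le \ell(\alpha)\le\overline\ell|\alpha|^q+C_\ell$ for all $\alpha\in\mathbb R^d$; (ii) $f,g:\mathbb R^d\times\mathcal P_1(\mathbb R^d)\to\mathbb R$ are continuous and, for $h=f,g$, $h(\cdot,\mu)$ is $C^1$ for every $\mu$, and $h$ and $D_xh$ are bounded on $\mathbb R^d\times\mathcal P_1(\mathbb R^d)$; (iii) $m_0$ is a Borel probability measure on $\mathbb R^d$ with compact support. Let $N^s_n,N^t_n$ be positive integers with $N^s_n,N^t_n\to\infty$, let $\epsilon_n>0$ with $\epsilon_n\to0$, and set $\Delta x_n=1/N^s_n$, $\Delta t_n=T/N^t_n$, $$\mathcal S_n=\{i\,\Delta x_n: i\in\mathbb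 Z^d,\ |i|_\infty\le (N^s_n)^2\},\qquad \mathcal T_n=\{t_k=k\Delta t_n: 0\le k\le N^t_n\}.$$ Let $\mathcal P(\mathcal S_n)$ be the set of probability vectors on $\mathcal S_n$, where $p\in\mathcal P(\mathcal S_n)$ is identified with $\sum_x p(x)\delta_x\in\mathcal P_1(\mathbb R^d)$, and let $\mathcal E_n(p)=\sum_{x}p(x)\log p(x)$ (with $0\log0=0$). For every $n$ let $U_n:\mathcal S_n\times\mathcal T_n\to\mathbb R$ and $M_n:\mathcal T_n\to\mathcal P(\mathcal S_n)$ solve the finite mean field game $$U_n(x,t_k)=\min_{p\in\mathcal P(\mathcal S_n)}\Big\{\sum_{y\in\mathcal S_n}p(y)\Big[\Delta t_n\,\ell\Big(\frac{y-x}{\Delta t_n}\Big)+U_n(y,t_{k+1})\Big]+\epsilon_n\mathcal E_n(p)\Big\}+\Delta t_n f(x,M_n(t_k)),$$ $$M_n(y,t_{k+1})=\sum_{x\in\mathcal S_n}\hat P_n(x,y,t_k)M_n(x,t_k)\qquad(0\le k<N^t_n),$$ $$M_n(x,0)=m_0\big(\{x':|x'-x|_\infty\le\Delta x_n/2\}\big),\qquad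 U_n(x,T)=g(x,M_n(T)),$$ where $\hat P_n(x,\cdot,t_k)\in\mathcal P(\mathcal S_n)$ is the minimizer in the first equation. Let $\xi_n\in\mathcal P(\Gamma)$ be the law of the curve that is affine on each $[t_k,t_{k+1}]$ and whose values at $t_0,t_1,\dots$ form the Markov chain with initial law $M_n(\cdot,0)$ and transition kernel $\hat P_n$. **Statement.** Assume that $N^t_n/N^s_n\to0$ and $\epsilon_n=o\big(1/(N^t_n\log N^s_n)\big)$ as $n\to\infty$. Let $\xi^*\in\mathcal P(\Gamma)$ be the narrow limit of a subsequence of $(\xi_n)$, still indexed by $n$ below, and let $m(t)=e_t\sharp\xi^*$ be the law of $\gamma(t)$ under $\xi^*$. Then $m\in C([0,T];\mathcal P_1(\mathbb R^d))$. The formula $$u(x,t)=\inf\Big\{\int_t^T[\ell(\dot\gamma(s))+f(\gamma(s),m(s))]\,ds+g(\gamma(T),m(T)):\ \gamma\in W^{1,q}([0,T];\mathbb R^d),\ \gamma(t)=x\Big\}$$ defines a finite function on $\mathbb R^d\times[0,T]$, which is the unique continuous viscosity solution on $\mathbb R^d\times[0,T]$ of $$-\partial_tu+H(\nabla u)=f(x,m(t))\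 \text{ in }\mathbb R^d\times(0,T),\qquad u(\cdot,T)=g(\cdot,m(T)),$$ with $H(z)=\sup_{z'\in\mathbb R^d}\{-z\cdot z'-\ell(z')\}$. Moreover, for all $(x,t)\in\mathbb R^d\times[0,T]$, $$\limsup_{\substack{n\to\infty\\ \mathcal S_n\ni y\to x\\ \mathcal T_n\ni s\to t}}U_n(y,s)=\liminf_{\substack{n\to\infty\\ \mathcal S_n\ni y\to x\\ \mathcal T_n\ni s\to t}}U_n(y,s)=u(x,t),$$ and, for every compact set $Q\subseteq\mathbb R^d$, $$\sup_{(x,t)\in(\mathcal S_n\cap Q)\times\mathcal T_n}|U_n(x,t)-u(x,t)|\to0\quad\text{as }n\to\infty.$$ -/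

import Mathlib

open MeasureTheory Filter Topology Asymptotics

noncomputable section

namespace MFG

/-- The state space `ℝ^d` with its Euclidean norm. -/
abbrev E (d : ℕ) : Type := EuclideanSpace ℝ (Fin d)

/-! ### The space of probability measures with finite first moment -/

/-- The Borel probability measures on `ℝ^d` with finite first moment. -/
def P1 (d : ℕ) : Type :=
  {μ : ProbabilityMeasure (E d) // Integrable (fun x : E d => ‖x‖) (μ : Measure (E d))}

/-- The underlying measure of an element of `P1 d`. -/
def P1.toMeasure {d : ℕ} (μ : P1 d) : Measure (E d) := (μ.1 : Measure (E d))

/-- The Kantorovich-Rubinstein distance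
`d₁(μ, ν) = sup { ∫ ψ dμ - ∫ ψ dν : ψ is 1-Lipschitz }`. The set of 1-Lipschitz functions is
symmetric, so that the absolute value does not change the supremum; every such `ψ` is integrable
with respect to measures in `P1 d`. -/
def d1 {d : ℕ} (μ ν : P1 d) : ENNReal :=
  ⨆ ψ : {ψ : E d → ℝ // LipschitzWith 1 ψ},
    ENNReal.ofReal |(∫ x, ψ.1 x ∂μ.toMeasure) - ∫ x, ψ.1 x ∂ν.toMeasure|

/-- `P1 d` carries the distance `d₁` and the topology induced by it. -/
instance instPseudoEMetricSpaceP1 (d : ℕ) : PseudoEMetricSpace (P1 d) where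
  edist := d1
  edist_self μ := by simp [d1]
  edist_comm μ ν := by simp only [d1, abs_sub_comm]
  edist_triangle μ ν ρ := by
    refine iSup_le fun ψ => ?_
    refine le_trans ?_ (add_le_add (le_iSup (fun ψ : {ψ : E d → ℝ // LipschitzWith 1 ψ} =>
      ENNReal.ofReal |(∫ x, ψ.1 x ∂μ.toMeasure) - ∫ x, ψ.1 x ∂ν.toMeasure|) ψ)
      (le_iSup (fun ψ : {ψ : E d → ℝ // LipschitzWith 1 ψ} =>
      ENNReal.ofReal |(∫ x, ψ.1 x ∂ν.toMeasure) - ∫ x, ψ.1 x ∂ρ.toMeasure|) ψ))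
    rw [← ENNReal.ofReal_add (abs_nonneg _) (abs_nonneg _)]
    exact ENNReal.ofReal_le_ofReal (abs_sub_le _ _ _)

/-- For a finite set `S ⊆ ℝ^d`, a probability vector `p` on `S` is identified with the measure
`∑ x ∈ S, p(x) δ_x`. -/
def simplexToP1 {d : ℕ} {S : Finset (E d)} (p : stdSimplex ℝ S) : P1 d :=
  ⟨⟨∑ x : S, ENNReal.ofReal (p.1 x) • Measure.dirac (x : E d), by
      constructor
      simp only [Measure.coe_finsetSum, Finset.sum_apply, Measure.smul_apply, measure_univ,
        smul_eq_mul, mul_one]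
      rw [← ENNReal.ofReal_sum_of_nonneg (fun x _ => p.2.1 x), p.2.2, ENNReal.ofReal_one]⟩, by
    refine (integrable_finsetSum_measure (μ := fun x : S =>
      ENNReal.ofReal (p.1 x) • Measure.dirac (x : E d))).2 fun x _ => ?_
    exact Integrable.smul_measure (integrable_dirac (by simp)) ENNReal.ofReal_ne_top⟩

/-! ### Assumptions on the data -/

/-- The running cost `ℓ` is continuous and grows like `|α|^q`. -/
structure IsKineticCost {d : ℕ} (q : ℝ) (ℓ : E d → ℝ) : Prop where
  continuous : Continuous ℓ
  growth : ∃ a b C : ℝ, 0 < a ∧ 0 < b ∧ 0 < C ∧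
    ∀ α : E d, a * ‖α‖ ^ q - C ≤ ℓ α ∧ ℓ α ≤ b * ‖α‖ ^ q + C

/-- The coupling `h` is continuous on `ℝ^d × P1`, of class `C¹` in `x`, and `h` and `D_x h` are
bounded uniformly in both variables. -/
structure IsCoupling {d : ℕ} (h : E d → P1 d → ℝ) : Prop where
  continuous : Continuous fun z : E d × P1 d => h z.1 z.2
  contDiff : ∀ μ : P1 d, ContDiff ℝ 1 fun x : E d => h x μ
  bounded : ∃ C : ℝ, 0 < C ∧ ∀ (x : E d) (μ : P1 d),
    |h x μ| ≤ C ∧ ‖fderiv ℝ (fun y : E d => h y μ) x‖ ≤ C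

/-! ### Grids and the finite mean field game -/

/-- The space grid `{ i / N : i ∈ ℤ^d, |i|_∞ ≤ N² }`. -/
def grid (d N : ℕ) : Finset (E d) := by
  classical
  exact (Fintype.piFinset fun _ : Fin d => Finset.Icc (-((N : ℤ) ^ 2)) ((N : ℤ) ^ 2)).image
    fun i => WithLp.toLp 2 fun j => (i j : ℝ) * (1 / (N : ℝ))

/-- The time step `T / N`. -/
def timeStep (T : ℝ) (N : ℕ) : ℝ := T / (N : ℝ)

/-- The grid time `t_k = k T / N`. -/
def gridTime (T : ℝ) (N : ℕ) (k : Fin (N + 1)) : ℝ := ((k : ℕ) : ℝ) * timeStep T N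

/-- The cell `{ x' : |x' - x|_∞ ≤ Δx / 2 }` with `Δx = 1 / N`. -/
def cell {d : ℕ} (N : ℕ) (x : E d) : Set (E d) :=
  {x' | ∀ j : Fin d, |x' j - x j| ≤ 1 / (N : ℝ) / 2}

/-- The entropy `∑ p(x) log p(x)` (here `Real.log 0 = 0`, so that `0 log 0 = 0`). -/
def entropy {d : ℕ} {S : Finset (E d)} (p : stdSimplex ℝ S) : ℝ :=
  ∑ x : S, p.1 x * Real.log (p.1 x)

/-- The functional
`p ↦ ∑ y, p(y) [Δt ℓ((y - x) / Δt) + V(y)] + ε ∑ y, p(y) log p(y)`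
of the one-step problem at `x`, with value function `V` at the next time. -/
def oneStepCost {d : ℕ} {S : Finset (E d)} (ℓ : E d → ℝ) (Δt ε : ℝ) (V : S → ℝ) (x : S)
    (p : stdSimplex ℝ S) : ℝ :=
  (∑ y : S, p.1 y * (Δt * ℓ (Δt⁻¹ • ((y : E d) - (x : E d))) + V y)) + ε * entropy p

/-- `(U, M)` solves the finite mean field game with parameters `Ns`, `Nt`, `ε`, and `P` is the
associated optimal transition kernel: `U x k = U(x, t_k)`, `M k = M(·, t_k)`,
`P x k = P(x, ·, t_k)`. -/
structure IsFiniteMFGSolution {d : ℕ} (T : ℝ) (ℓ : E d → ℝ) (f g : E d → P1 d → ℝ)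
    (m₀ : ProbabilityMeasure (E d)) (Ns Nt : ℕ) (ε : ℝ)
    (U : grid d Ns → Fin (Nt + 1) → ℝ)
    (M : Fin (Nt + 1) → stdSimplex ℝ (grid d Ns))
    (P : grid d Ns → Fin Nt → stdSimplex ℝ (grid d Ns)) : Prop where
  /-- `P(x, ·, t_k)` minimizes the one-step cost (the minimizer is unique for `ε > 0`). -/
  kernel_isMin : ∀ (x : grid d Ns) (k : Fin Nt) (p : stdSimplex ℝ (grid d Ns)),
    oneStepCost ℓ (timeStep T Nt) ε (fun y => U y k.succ) x (P x k) ≤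
      oneStepCost ℓ (timeStep T Nt) ε (fun y => U y k.succ) x p
  /-- `U(x, t_k)` is the minimum of the one-step cost plus `Δt f(x, M(t_k))`. -/
  value_eq : ∀ (x : grid d Ns) (k : Fin Nt),
    U x k.castSucc =
      oneStepCost ℓ (timeStep T Nt) ε (fun y => U y k.succ) x (P x k) +
        timeStep T Nt * f x (simplexToP1 (M k.castSucc))
  /-- Evolution of the distribution of the agents. -/
  distribution_eq : ∀ (y : grid d Ns) (k : Fin Nt),
    (M k.succ).1 y = ∑ x : grid d Ns, (P x k).1 y * (M k.castSucc).1 x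
  initial_eq : ∀ x : grid d Ns, (M 0).1 x = (m₀ : Measure (E d)).real (cell Ns (x : E d))
  terminal_eq : ∀ x : grid d Ns, U x (Fin.last Nt) = g x (simplexToP1 (M (Fin.last Nt)))

/-! ### Measures on the space of curves -/

/-- The space `Γ = C([0,T]; ℝ^d)` with the topology of uniform convergence. -/
abbrev Curve (d : ℕ) (T : ℝ) : Type := C(Set.Icc (0 : ℝ) T, E d)

instance instMeasurableSpaceCurve (d : ℕ) (T : ℝ) : MeasurableSpace (Curve d T) := borel _

instance instBorelSpaceCurve (d : ℕ) (T : ℝ) : BorelSpace (Curve d T) := ⟨rfl⟩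

/-- The continuous curve which takes the value `ω k` at `t_k = k T / N` and is affine on each
`[t_k, t_{k+1}]`, written in the basis of hat functions `t ↦ max 0 (1 - |t / Δt - k|)`. -/
def interpolate {d : ℕ} (T : ℝ) (N : ℕ) (ω : Fin (N + 1) → E d) : Curve d T where
  toFun t := ∑ k : Fin (N + 1), max 0 (1 - |(t : ℝ) / timeStep T N - ((k : ℕ) : ℝ)|) • ω k
  continuous_toFun := by fun_prop

/-- The probability that the Markov chain with initial law `p₀` and transition kernel `P` follows
the path `ω`. -/
def pathWeight {d : ℕ} {S : Finset (E d)} {N : ℕ} (p₀ : stdSimplex ℝ S)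
    (P : S → Fin N → stdSimplex ℝ S) (ω : Fin (N + 1) → S) : ℝ :=
  p₀.1 (ω 0) * ∏ k : Fin N, (P (ω k.castSucc) k).1 (ω k.succ)

theorem pathWeight_nonneg {d : ℕ} {S : Finset (E d)} {N : ℕ} (p₀ : stdSimplex ℝ S)
    (P : S → Fin N → stdSimplex ℝ S) (ω : Fin (N + 1) → S) : 0 ≤ pathWeight p₀ P ω :=
  mul_nonneg (p₀.2.1 _) (Finset.prod_nonneg fun k _ => (P (ω k.castSucc) k).2.1 _)

theorem sum_pathWeight {d : ℕ} {S : Finset (E d)} {N : ℕ} (p₀ : stdSimplex ℝ S)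
    (P : S → Fin N → stdSimplex ℝ S) : ∑ ω : Fin (N + 1) → S, pathWeight p₀ P ω = 1 := by
  induction N with
  | zero =>
    rw [← (Equiv.funUnique (Fin 1) S).symm.sum_comp]
    simpa [pathWeight] using p₀.2.2
  | succ N ih =>
    rw [← (Fin.snocEquiv fun _ : Fin (N + 2) => (S : Type)).sum_comp, Fintype.sum_prod_type_right,
      ← ih (fun x k => P x k.castSucc)]
    refine Finset.sum_congr rfl fun ω _ => ?_
    have key : ∀ y : S, pathWeight p₀ P ((Fin.snocEquiv fun _ : Fin (N + 2) => (S : Type)) (y, ω)) =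
        pathWeight p₀ (fun x k => P x k.castSucc) ω * (P (ω (Fin.last N)) (Fin.last N)).1 y := by
      intro y
      have h0 : (Fin.snoc ω y : Fin (N + 2) → S) 0 = ω 0 :=
        Fin.snoc_castSucc (α := fun _ => (S : Type)) y ω 0
      simp only [pathWeight, Fin.snocEquiv, Equiv.coe_fn_mk, Fin.prod_univ_castSucc,
        Fin.succ_last, Fin.snoc_last, Fin.snoc_castSucc, Fin.succ_castSucc, h0]
      ring
    simp only [key, ← Finset.mul_sum]
    rw [(P (ω (Fin.last N)) (Fin.last N)).2.2, mul_one]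

/-- The law on `Γ` of the piecewise affine interpolation of the Markov chain with initial law
`p₀` and transition kernel `P`. -/
def pathLaw {d : ℕ} {S : Finset (E d)} {N : ℕ} (T : ℝ) (p₀ : stdSimplex ℝ S)
    (P : S → Fin N → stdSimplex ℝ S) : ProbabilityMeasure (Curve d T) :=
  ⟨∑ ω : Fin (N + 1) → S, ENNReal.ofReal (pathWeight p₀ P ω) •
      Measure.dirac (interpolate T N fun k => (ω k : E d)), by
    constructor
    simp only [Measure.coe_finsetSum, Finset.sum_apply, Measure.smul_apply, measure_univ,
      smul_eq_mul, mul_one]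
    rw [← ENNReal.ofReal_sum_of_nonneg (fun ω _ => pathWeight_nonneg p₀ P ω), sum_pathWeight,
      ENNReal.ofReal_one]⟩

/-! ### The relaxed limits of the discrete value functions -/

/-- The filter `n → ∞`, `S_n ∋ y → x`, `T_n ∋ s → t` on the set of all `(n, y, k)` with `y` in the
`n`-th space grid and `s = t_k` in the `n`-th time grid. -/
def gridFilter {d : ℕ} (T : ℝ) (Ns Nt : ℕ → ℕ) (x : E d) (t : ℝ) :
    Filter (Σ n : ℕ, grid d (Ns n) × Fin (Nt n + 1)) :=
  comap (fun z => (z.1, ((z.2.1 : E d), gridTime T (Nt z.1) z.2.2))) (atTop ×ˢ 𝓝 (x, t))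

/-- The upper relaxed limit `U^*(x,t)`, as an extended real number. -/
def upperLimit {d : ℕ} (T : ℝ) (Ns Nt : ℕ → ℕ)
    (U : ∀ n, grid d (Ns n) → Fin (Nt n + 1) → ℝ) (x : E d) (t : ℝ) : EReal :=
  limsup (fun z : Σ n : ℕ, grid d (Ns n) × Fin (Nt n + 1) => ((U z.1 z.2.1 z.2.2 : ℝ) : EReal))
    (gridFilter T Ns Nt x t)

/-- The lower relaxed limit `U_*(x,t)`, as an extended real number. -/
def lowerLimit {d : ℕ} (T : ℝ) (Ns Nt : ℕ → ℕ)
    (U : ∀ n, grid d (Ns n) → Fin (Nt n + 1) → ℝ) (x : E d) (t : ℝ) : EReal :=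
  liminf (fun z : Σ n : ℕ, grid d (Ns n) × Fin (Nt n + 1) => ((U z.1 z.2.1 z.2.2 : ℝ) : EReal))
    (gridFilter T Ns Nt x t)

/-! ### The Hamilton-Jacobi-Bellman equation -/

/-- The Hamiltonian `H(z) = sup_{z'} { - z · z' - ℓ(z') }`. -/
def hamiltonian {d : ℕ} (ℓ : E d → ℝ) (z : E d) : ℝ :=
  ⨆ z' : E d, (-(inner ℝ z z') - ℓ z')

/-- `u` is a viscosity subsolution of `-∂ₜ u + H(∇u) = F(x,t)` in `ℝ^d × (0,T)`. -/
def IsViscositySubsolution {d : ℕ} (T : ℝ) (H : E d → ℝ) (F : E d → ℝ → ℝ)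
    (u : E d → ℝ → ℝ) : Prop :=
  ∀ φ : E d → ℝ → ℝ, ContDiff ℝ 1 (fun z : E d × ℝ => φ z.1 z.2) →
    ∀ (x : E d) (t : ℝ), t ∈ Set.Ioo 0 T →
      IsLocalMax (fun z : E d × ℝ => u z.1 z.2 - φ z.1 z.2) (x, t) →
        -(deriv (fun s => φ x s) t) + H (gradient (fun y => φ y t) x) ≤ F x t

/-- `u` is a viscosity supersolution of `-∂ₜ u + H(∇u) = F(x,t)` in `ℝ^d × (0,T)`. -/
def IsViscositySupersolution {d : ℕ} (T : ℝ) (H : E d → ℝ) (F : E d → ℝ → ℝ)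
    (u : E d → ℝ → ℝ) : Prop :=
  ∀ φ : E d → ℝ → ℝ, ContDiff ℝ 1 (fun z : E d × ℝ => φ z.1 z.2) →
    ∀ (x : E d) (t : ℝ), t ∈ Set.Ioo 0 T →
      IsLocalMin (fun z : E d × ℝ => u z.1 z.2 - φ z.1 z.2) (x, t) →
        F x t ≤ -(deriv (fun s => φ x s) t) + H (gradient (fun y => φ y t) x)

/-- `u` is a continuous viscosity solution on `ℝ^d × [0,T]` of `-∂ₜ u + H(∇u) = f(x, m(t))` in
`ℝ^d × (0,T)` with `u(·,T) = g(·, m(T))`. -/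
structure IsContinuousViscositySolution {d : ℕ} (T : ℝ) (ℓ : E d → ℝ) (f g : E d → P1 d → ℝ)
    (m : ℝ → P1 d) (u : E d → ℝ → ℝ) : Prop where
  continuousOn : ContinuousOn (fun z : E d × ℝ => u z.1 z.2) (Set.univ ×ˢ Set.Icc 0 T)
  subsolution : IsViscositySubsolution T (hamiltonian ℓ) (fun x t => f x (m t)) u
  supersolution : IsViscositySupersolution T (hamiltonian ℓ) (fun x t => f x (m t)) u
  terminal : ∀ x : E d, u x T = g x (m T)

/-- `γ ∈ W^{1,q}([0,T]; ℝ^d)` with derivative `v`: `v ∈ L^q` and `γ` is its absolutely continuous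
primitive. -/
def IsSobolevCurve {d : ℕ} (T q : ℝ) (γ v : ℝ → E d) : Prop :=
  MemLp v (ENNReal.ofReal q) (volume.restrict (Set.Icc 0 T)) ∧
    ∀ s ∈ Set.Icc (0 : ℝ) T, γ s = γ 0 + ∫ r in (0 : ℝ)..s, v r

/-- The set of all costs
`∫_t^T [ℓ(γ'(s)) + f(γ(s), m(s))] ds + g(γ(T), m(T))` with `γ ∈ W^{1,q}([0,T]; ℝ^d)`, `γ(t) = x`. -/
def controlCosts {d : ℕ} (T q : ℝ) (ℓ : E d → ℝ) (f g : E d → P1 d → ℝ) (m : ℝ → P1 d)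
    (x : E d) (t : ℝ) : Set ℝ :=
  {c | ∃ γ v : ℝ → E d, IsSobolevCurve T q γ v ∧ γ t = x ∧
    c = (∫ s in t..T, (ℓ (v s) + f (γ s) (m s))) + g (γ T) (m T)}

end MFG

end

/-! Everything is organised around one inequality on straight segments: S(y,s) ≤ (s'-s)(ℓ(z)+c) +
S(y+(s'-s)z, s') whenever the potential is at most c along the segment (`IsLineSubsolution`). It
needs no regularity of S, survives convex combinations and small averaging, and fits the finite
game, whose steps are segments. The value function satisfies it by dynamic programming, a continuous
viscosity subsolution by a penalised maximum along the moving line, and the upper relaxed limit of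
the discrete values by following rounded lines on the grid.

Continuous problem. The value function over a class of velocities is bounded and Lipschitz, because
ℓ is superlinear, and is a viscosity solution. A line subsolution can be mollified into a strict C¹
subsolution and used as a test function, so comparison with a viscosity supersolution W needs no
doubling of variables, only order on the lateral and terminal boundary
(`IsLineSubsolution.le_supersolution`). Uniqueness without growth assumptions follows
(`eq_valueFunction`). An arbitrary solution w is bounded above, because the segment with velocity 0
reaches the terminal datum, and w ≤ u after mixing in a subsolution that tends to -∞. Conversely,
segments issued from (0,0) show that w is bounded below by a multiple of -(1+|y|^q) for times s ≥ σ
> 0; comparison with an auxiliary control problem with strongly decreasing terminal cost then works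
on short time intervals, is iterated down to σ, and σ → 0 by continuity. Uniqueness also shows that
piecewise constant and L^q velocities have the same value function.

Compactness. The entropy of a probability vector on S_n lies between -log|S_n| and 0, so over all
time steps it contributes at most N^t ε log|S_n|, which tends to 0. Hence the U_n are uniformly
bounded, and the expected kinetic cost in one step is at most the decrease of the average value, up
to small errors. Since ℓ is superlinear with arbitrary slope, this makes the M_n equicontinuous in
time for d₁ and uniformly integrable, so M_n converges to m uniformly on the grid times
(`IsGameSequence.exists_limit_flow`).

Convergence. From below, the line subsolution u, penalised at infinity, is an approximate discrete
subsolution, and backward induction gives U_n ≥ u - η on compact sets. From above, the upper relaxed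
limit is a line subsolution with terminal values at most g, hence lies below the cost of every
piecewise constant velocity, and therefore below u. The assumption N^t/N^s → 0 enters exactly here:
it makes the speed of a rounded line close to the speed of the line. A compactness argument turns
both bounds into locally uniform convergence. -/

namespace MFG

/-! ### Running costs and the Hamiltonian -/

/-- The running cost `ℓ` is continuous and superlinear; the potential `F` is continuous, bounded by
`C` and `C`-Lipschitz in the space variable. -/
structure IsControlData {d : ℕ} (ℓ : E d → ℝ) (F : E d → ℝ → ℝ) (C : ℝ) : Prop where
  continuous_cost : Continuous ℓ
  superlinear : ∀ L : ℝ, ∃ K : ℝ, ∀ z, L * ‖z‖ - K ≤ ℓ z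
  continuous_potential : Continuous fun z : E d × ℝ => F z.1 z.2
  bound : ∀ x t, |F x t| ≤ C
  lipschitz : ∀ x y t, |F x t - F y t| ≤ C * ‖x - y‖

section Hamiltonian

variable {d : ℕ} {ℓ : E d → ℝ} {F : E d → ℝ → ℝ} {C : ℝ}

theorem IsControlData.nonneg (h : IsControlData ℓ F C) : 0 ≤ C :=
  (abs_nonneg _).trans (h.bound 0 0)

theorem bddAbove_hamiltonian (hℓ : ∀ L : ℝ, ∃ K : ℝ, ∀ z, L * ‖z‖ - K ≤ ℓ z) (p : E d) :
    BddAbove (Set.range fun z : E d => -(inner ℝ p z) - ℓ z) := by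
  obtain ⟨K, hK⟩ := hℓ ‖p‖
  refine ⟨K, ?_⟩
  rintro _ ⟨z, rfl⟩
  have h1 := hK z
  have h2 := abs_real_inner_le_norm p z
  have h3 := neg_abs_le (inner ℝ p z)
  simp only
  linarith

theorem hasDerivAt_line {Φ : E d × ℝ → ℝ} {x : E d} {t : ℝ} (hΦ : DifferentiableAt ℝ Φ (x, t))
    (z : E d) : HasDerivAt (fun h : ℝ => Φ (x + h • z, t + h)) (fderiv ℝ Φ (x, t) (z, 1)) 0 := by
  have h1 : HasDerivAt (fun h : ℝ => (x + h • z, t + h)) (z, (1 : ℝ)) 0 := by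
    refine HasDerivAt.prodMk ?_ ?_
    · simpa using ((hasDerivAt_id (0 : ℝ)).smul_const z).const_add x
    · simpa using (hasDerivAt_id (0 : ℝ)).const_add t
  have h2 : HasFDerivAt Φ (fderiv ℝ Φ (x, t)) ((fun h : ℝ => (x + h • z, t + h)) 0) := by
    simpa using hΦ.hasFDerivAt
  exact h2.comp_hasDerivAt 0 h1

/-- Through this identity the supremum that defines the Hamiltonian becomes a supremum over the
space-time directions `(z, 1)`, and viscosity inequalities become statements about derivatives along
straight lines. -/
theorem deriv_add_inner_gradient {φ : E d → ℝ → ℝ} {x : E d} {t : ℝ}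
    (hφ : DifferentiableAt ℝ (fun z : E d × ℝ => φ z.1 z.2) (x, t)) (z : E d) :
    deriv (fun s => φ x s) t + inner ℝ (gradient (fun y => φ y t) x) z =
      fderiv ℝ (fun z : E d × ℝ => φ z.1 z.2) (x, t) (z, 1) := by
  have h1 : HasDerivAt (fun s => φ x s)
      (fderiv ℝ (fun z : E d × ℝ => φ z.1 z.2) (x, t) (0, 1)) t := by
    have := HasFDerivAt.comp_hasDerivAt t (f := fun s : ℝ => (x, s)) (by exact hφ.hasFDerivAt)
      ((hasDerivAt_const t x).prodMk (hasDerivAt_id t))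
    exact this
  have h2 : HasFDerivAt (fun y => φ y t)
      ((fderiv ℝ (fun z : E d × ℝ => φ z.1 z.2) (x, t)).comp
        (ContinuousLinearMap.inl ℝ (E d) ℝ)) x := by
    have := HasFDerivAt.comp x (f := fun y : E d => (y, t)) (by exact hφ.hasFDerivAt)
      (hasFDerivAt_prodMk_left x t)
    exact this
  rw [h1.deriv, gradient, InnerProductSpace.toDual_symm_apply, h2.fderiv]
  rw [ContinuousLinearMap.comp_apply, ← map_add]
  simp

theorem neg_deriv_add_hamiltonian_le {φ : E d → ℝ → ℝ} {x : E d} {t c : ℝ}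
    (hφ : DifferentiableAt ℝ (fun z : E d × ℝ => φ z.1 z.2) (x, t))
    (h : ∀ z, -(fderiv ℝ (fun z : E d × ℝ => φ z.1 z.2) (x, t) (z, 1)) - ℓ z ≤ c) :
    -(deriv (fun s => φ x s) t) + hamiltonian ℓ (gradient (fun y => φ y t) x) ≤ c := by
  have : hamiltonian ℓ (gradient (fun y => φ y t) x) ≤ c + deriv (fun s => φ x s) t := by
    refine ciSup_le fun z => ?_
    have := h z
    rw [← deriv_add_inner_gradient hφ z] at this
    linarith
  linarith

theorem le_neg_deriv_add_hamiltonian (hℓ : ∀ L : ℝ, ∃ K : ℝ, ∀ z, L * ‖z‖ - K ≤ ℓ z)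
    {φ : E d → ℝ → ℝ} {x : E d} {t : ℝ}
    (hφ : DifferentiableAt ℝ (fun z : E d × ℝ => φ z.1 z.2) (x, t)) (z : E d) :
    -(fderiv ℝ (fun z : E d × ℝ => φ z.1 z.2) (x, t) (z, 1)) - ℓ z ≤
      -(deriv (fun s => φ x s) t) + hamiltonian ℓ (gradient (fun y => φ y t) x) := by
  have h1 : -(inner ℝ (gradient (fun y => φ y t) x) z) - ℓ z ≤
      hamiltonian ℓ (gradient (fun y => φ y t) x) := le_ciSup (bddAbove_hamiltonian hℓ _) z
  rw [← deriv_add_inner_gradient hφ z]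
  linarith

theorem le_of_hasDerivAt_of_eventually_right {g : ℝ → ℝ} {g' k : ℝ} (hg : HasDerivAt g g' 0)
    (h : ∀ᶠ r in 𝓝[>] (0 : ℝ), k * r ≤ g r - g 0) : k ≤ g' := by
  refine ge_of_tendsto hg.tendsto_slope_zero_right ?_
  filter_upwards [h, self_mem_nhdsWithin] with r hr hr0
  have hr0 : 0 < r := hr0
  rw [zero_add, smul_eq_mul, inv_mul_eq_div, le_div_iff₀ hr0]
  exact hr

end Hamiltonian

/-! ### Subsolutions along lines -/

/-- The function `S` satisfies the easy half of the dynamic programming principle along straight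
lines, on the time interval `[a, b]`. -/
def IsLineSubsolution {d : ℕ} (ℓ : E d → ℝ) (F : E d → ℝ → ℝ) (a b : ℝ) (S : E d → ℝ → ℝ) : Prop :=
  ∀ s s' : ℝ, a ≤ s → s ≤ s' → s' ≤ b → ∀ (y z : E d) (c : ℝ),
    (∀ r ∈ Set.Icc s s', F (y + (r - s) • z) r ≤ c) →
      S y s ≤ (s' - s) * (ℓ z + c) + S (y + (s' - s) • z) s'

section LineSub

variable {d : ℕ} {ℓ : E d → ℝ} {F : E d → ℝ → ℝ} {C : ℝ}

theorem IsLineSubsolution.mono {a b a' b' : ℝ} {S : E d → ℝ → ℝ}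
    (h : IsLineSubsolution ℓ F a b S) (ha : a ≤ a') (hb : b' ≤ b) :
    IsLineSubsolution ℓ F a' b' S :=
  fun s s' h1 h2 h3 => h s s' (ha.trans h1) h2 (h3.trans hb)

/-- The running term is the same for both functions, so weights with sum 1 reproduce it. This is
what allows a subsolution to be penalised at infinity. -/
theorem IsLineSubsolution.convexCombination {a b θ : ℝ} {S S' : E d → ℝ → ℝ}
    (h : IsLineSubsolution ℓ F a b S) (h' : IsLineSubsolution ℓ F a b S') (h0 : 0 ≤ θ)
    (h1 : θ ≤ 1) :
    IsLineSubsolution ℓ F a b fun x t => (1 - θ) * S x t + θ * S' x t := by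
  intro s s' hs hss hs' y z c hc
  have e1 := mul_le_mul_of_nonneg_left (h s s' hs hss hs' y z c hc) (sub_nonneg.2 h1)
  have e2 := mul_le_mul_of_nonneg_left (h' s s' hs hss hs' y z c hc) h0
  simp only
  nlinarith

/-- If a test function touches from above at `(x, t)`, the line inequality passes to it along each
forward line, and the right difference quotient bounds its derivative in the direction `(z, 1)`. The
velocity `z` is arbitrary, so the supremum is bounded. -/
theorem IsLineSubsolution.isViscositySubsolution {T : ℝ} {S : E d → ℝ → ℝ}
    (hF : Continuous fun z : E d × ℝ => F z.1 z.2) (h : IsLineSubsolution ℓ F 0 T S) :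
    IsViscositySubsolution T (hamiltonian ℓ) F S := by
  intro φ hφ x t ht hmax
  have hd : DifferentiableAt ℝ (fun z : E d × ℝ => φ z.1 z.2) (x, t) :=
    (hφ.differentiable one_ne_zero) _
  refine neg_deriv_add_hamiltonian_le hd fun z => le_of_forall_pos_le_add fun η hη => ?_
  have hline : Continuous fun r : ℝ => ((x + r • z, t + r) : E d × ℝ) := by fun_prop
  have hl0 : Tendsto (fun r : ℝ => ((x + r • z, t + r) : E d × ℝ)) (𝓝 0) (𝓝 (x, t)) := by
    simpa using hline.tendsto 0
  have hFc : ∀ᶠ r in 𝓝 (0 : ℝ), F (x + r • z) (t + r) < F x t + η := by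
    have : Tendsto (fun r : ℝ => F (x + r • z) (t + r)) (𝓝 0) (𝓝 (F x t)) :=
      (hF.tendsto (x, t)).comp hl0
    exact this.eventually (gt_mem_nhds (by linarith))
  obtain ⟨δ, hδ, hFδ⟩ := Metric.eventually_nhds_iff.1 hFc
  have key : -(ℓ z + (F x t + η)) ≤ fderiv ℝ (fun z : E d × ℝ => φ z.1 z.2) (x, t) (z, 1) := by
    refine le_of_hasDerivAt_of_eventually_right (hasDerivAt_line hd z) ?_
    have e1 : ∀ᶠ r in 𝓝[>] (0 : ℝ), r < δ ∧ r < T - t := by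
      refine Filter.Eventually.filter_mono nhdsWithin_le_nhds ?_
      exact (gt_mem_nhds hδ).and (gt_mem_nhds (by linarith [ht.2]))
    have e2 := (hl0.eventually hmax).filter_mono (nhdsWithin_le_nhds (s := Set.Ioi (0 : ℝ)))
    filter_upwards [e1, e2, self_mem_nhdsWithin] with r hr hr2 hr0
    have hr0 : 0 < r := hr0
    have := h t (t + r) ht.1.le (by linarith) (by linarith) x z (F x t + η) (by
      intro r' hr'
      have := hFδ (y := r' - t) (by
        rw [Real.dist_eq, sub_zero, abs_of_nonneg (by linarith [hr'.1])]; linarith [hr'.2])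
      simpa using this.le)
    simp only [add_sub_cancel_left] at this
    simp only [zero_smul, add_zero] at hr2 ⊢
    linarith
  linarith

end LineSub

/-! ### From viscosity subsolutions to the line inequality -/

section SubLine

variable {d : ℕ} {ℓ : E d → ℝ} {F : E d → ℝ → ℝ} {C : ℝ}

/-- Provides a time barrier that has size `K` on the initial face and is negligible after time `τ`.
Being decreasing in time, it enters the differential inequalities with a favourable sign. -/
theorem exists_mul_exp_neg_lt (K : ℝ) {τ e : ℝ} (hτ : 0 < τ) (he : 0 < e) :
    ∃ N : ℝ, 0 < N ∧ K * Real.exp (-(N * τ)) < e := by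
  have h : Tendsto (fun N : ℝ => K * Real.exp (-(N * τ))) atTop (𝓝 (K * 0)) :=
    (Real.tendsto_exp_neg_atTop_nhds_zero.comp (tendsto_id.atTop_mul_const hτ)).const_mul K
  rw [mul_zero] at h
  obtain ⟨N, h1, h2⟩ := ((eventually_gt_atTop 0).and (h.eventually (gt_mem_nhds he))).exists
  exact ⟨N, h1, h2⟩

/-- Suppose that the inequality fails on one segment. In coordinates moving with it, add a drift
that makes the failure strict, a quadratic penalty in the distance to the line and a barrier at the
initial time. The maximum is then interior, and the viscosity inequality there, tested in the
direction `z`, contradicts the bound on `F`. -/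
theorem IsViscositySubsolution.isLineSubsolution (hD : IsControlData ℓ F C) {T : ℝ}
    {w : E d → ℝ → ℝ}
    (hc : ContinuousOn (fun z : E d × ℝ => w z.1 z.2) (Set.univ ×ˢ Set.Icc 0 T))
    (hw : IsViscositySubsolution T (hamiltonian ℓ) F w) : IsLineSubsolution ℓ F 0 T w := by
  intro s s' hs hss hs' y z c hF
  rcases hss.eq_or_lt with rfl | hss
  · simp
  by_contra! hcon
  obtain ⟨G, hG⟩ : ∃ G, G = w y s - ((s' - s) * (ℓ z + c) + w (y + (s' - s) • z) s') := ⟨_, rfl⟩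
  have hG0 : 0 < G := by linarith
  have hτ : 0 < s' - s := sub_pos.2 hss
  -- A quarter of the gap `G` is spread over the time interval as a drift; it is the strict margin
  -- in the final contradiction.
  obtain ⟨c', hc'⟩ : ∃ c', c' = G / 4 / (s' - s) := ⟨_, rfl⟩
  have hc'0 : 0 < c' := by rw [hc']; positivity
  have hc'G : c' * (s' - s) = G / 4 := by rw [hc']; field_simp
  -- the value function in coordinates moving with the line
  let A : E d × ℝ → ℝ := fun p =>
    w (y + (p.2 - s) • z + p.1) p.2 + (ℓ z + c + c') * (p.2 - s)
  have hmap : Set.MapsTo (fun p : E d × ℝ => (y + (p.2 - s) • z + p.1, p.2))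
      (Metric.closedBall 0 1 ×ˢ Set.Icc s s') (Set.univ ×ˢ Set.Icc 0 T) := fun p hp =>
    ⟨trivial, hs.trans hp.2.1, hp.2.2.trans hs'⟩
  have hA : ContinuousOn A (Metric.closedBall 0 1 ×ˢ Set.Icc s s') := by
    refine ContinuousOn.add ?_ (by fun_prop)
    exact hc.comp (f := fun p : E d × ℝ => (y + (p.2 - s) • z + p.1, p.2)) (by fun_prop) hmap
  have hK : IsCompact (Metric.closedBall (0 : E d) 1 ×ˢ Set.Icc s s') :=
    (isCompact_closedBall _ _).prod isCompact_Icc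
  obtain ⟨B, hB⟩ := hK.exists_bound_of_continuousOn hA
  have hB' : ∀ p ∈ Metric.closedBall (0 : E d) 1 ×ˢ Set.Icc s s', -B ≤ A p ∧ A p ≤ B :=
    fun p hp => abs_le.1 (hB p hp)
  have m0 : ((0 : E d), s) ∈ Metric.closedBall (0 : E d) 1 ×ˢ Set.Icc s s' :=
    ⟨by simp, le_rfl, hss.le⟩
  have m1 : ((0 : E d), s') ∈ Metric.closedBall (0 : E d) 1 ×ˢ Set.Icc s s' :=
    ⟨by simp, hss.le, le_rfl⟩
  have hA0 : A (0, s) = w y s := by simp [A]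
  have hA1 : A (0, s') = w y s - 3 * G / 4 := by
    simp only [A, add_zero]; nlinarith
  have hB0 : 0 ≤ B := by have := hB' _ m0; linarith
  -- a time near `s`
  obtain ⟨r1, hr1s, hr1s', hr1⟩ : ∃ r1, s < r1 ∧ r1 < s' ∧ w y s - G / 4 < A (0, r1) := by
    have h1 : ContinuousOn (fun r : ℝ => A (0, r)) (Set.Icc s s') :=
      hA.comp (f := fun r : ℝ => ((0 : E d), r)) (by fun_prop) fun r hr => ⟨by simp, hr⟩
    have h2 : Tendsto (fun r : ℝ => A (0, r)) (𝓝[>] s) (𝓝 (A (0, s))) := by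
      have := (h1 s ⟨le_rfl, hss.le⟩).mono Set.Ioo_subset_Icc_self
      rwa [ContinuousWithinAt, nhdsWithin_Ioo_eq_nhdsGT hss] at this
    have h3 := h2.eventually (lt_mem_nhds (show w y s - G / 4 < A (0, s) by rw [hA0]; linarith))
    obtain ⟨r, h4, h5⟩ := (h3.and (Ioo_mem_nhdsGT hss)).exists
    exact ⟨r, h5.1, h5.2, h4⟩
  -- a radius
  obtain ⟨ρ, hρ0, hρ1, hρC, hρ⟩ : ∃ ρ, 0 < ρ ∧ ρ ≤ 1 ∧ C * ρ < c' ∧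
      ∀ e : E d, ‖e‖ ≤ ρ → A (e, s') < w y s - G / 2 := by
    have h1 : ContinuousOn (fun e : E d => A (e, s')) (Metric.closedBall 0 1) :=
      hA.comp (f := fun e : E d => (e, s')) (by fun_prop) fun e he => ⟨he, hss.le, le_rfl⟩
    have h2 : ContinuousAt (fun e : E d => A (e, s')) 0 :=
      h1.continuousAt (Metric.closedBall_mem_nhds _ one_pos)
    have h3 : ∀ᶠ e in 𝓝 (0 : E d), A (e, s') < w y s - G / 2 :=
      h2.eventually (gt_mem_nhds (show A (0, s') < _ by rw [hA1]; linarith))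
    obtain ⟨δ, hδ, h4⟩ := Metric.eventually_nhds_iff.1 h3
    refine ⟨min (min 1 (δ / 2)) (c' / (C + 1)), ?_, ?_, ?_, ?_⟩
    · have := hD.nonneg; positivity
    · exact (min_le_left _ _).trans (min_le_left _ _)
    · have h5 := hD.nonneg
      calc C * min (min 1 (δ / 2)) (c' / (C + 1)) ≤ C * (c' / (C + 1)) :=
            mul_le_mul_of_nonneg_left (min_le_right _ _) h5
        _ < c' := by
            rw [mul_div_assoc', div_lt_iff₀ (by linarith)]; nlinarith
    · intro e he
      refine h4 ?_
      rw [dist_zero_right]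
      have := he.trans ((min_le_left _ _).trans (min_le_right _ _))
      linarith
  -- At distance `ρ` the penalty exceeds the oscillation `2 * B` of `A`, which confines the maximum
  -- to the ball of radius `ρ`.
  obtain ⟨k, hk⟩ : ∃ k, k = (2 * B + G + 1) / ρ ^ 2 := ⟨_, rfl⟩
  have hk0 : 0 ≤ k := by rw [hk]; positivity
  have hkρ : k * ρ ^ 2 = 2 * B + G + 1 := by rw [hk]; field_simp
  obtain ⟨N, hN0, hN⟩ := exists_mul_exp_neg_lt (2 * B + G + 1) (sub_pos.2 hr1s)
    (show 0 < G / 8 by positivity)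
  -- At `r = s` the barrier exceeds the oscillation of `A`, while at `r1` it is below `G / 8`; so
  -- the maximum avoids the initial face, where no viscosity inequality is available.
  let p : ℝ → ℝ := fun r => (2 * B + G + 1) * Real.exp (-(N * (r - s)))
  have hp0 : ∀ r, 0 ≤ p r := fun r => by positivity
  have hps : p s = 2 * B + G + 1 := by simp [p]
  obtain ⟨⟨e0, r0⟩, hmem, hmax⟩ := hK.exists_isMaxOn ⟨_, m0⟩
    (f := fun q : E d × ℝ => A q - p q.2 - k * ‖q.1‖ ^ 2)
    ((hA.sub (by fun_prop)).sub (by fun_prop))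
  have hval : w y s - 3 * G / 8 < A (e0, r0) - p r0 - k * ‖e0‖ ^ 2 := by
    have := hmax (show ((0 : E d), r1) ∈ _ from ⟨by simp, hr1s.le, hr1s'.le⟩)
    simp only [Set.mem_ofPred_eq, norm_zero] at this
    have h2 : p r1 < G / 8 := hN
    have h3 : (k * (0 : ℝ) ^ 2) = 0 := by ring
    linarith
  have hws : -B ≤ w y s := hA0 ▸ (hB' _ m0).1
  have hke : 0 ≤ k * ‖e0‖ ^ 2 := by positivity
  have he0 : ‖e0‖ < ρ := by
    by_contra! hge
    have h1 : k * ρ ^ 2 ≤ k * ‖e0‖ ^ 2 := by gcongr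
    have h2 := (hB' _ hmem).2
    have h3 := hp0 r0
    linarith
  have hr0s : s < r0 := by
    rcases hmem.2.1.eq_or_lt with h | h
    · exfalso
      simp only at h
      have h2 := (hB' _ hmem).2
      rw [← h] at hval h2
      linarith
    · exact h
  have hr0s' : r0 < s' := by
    rcases hmem.2.2.eq_or_lt with h | h
    · exfalso
      simp only at h
      have h2 := hρ e0 he0.le
      have h3 := hp0 r0
      rw [h] at hval h3
      linarith
    · exact h
  -- the test function
  let φ : E d → ℝ → ℝ := fun ζ r =>
    -((ℓ z + c + c') * (r - s)) + p r + k * ‖ζ - (y + (r - s) • z)‖ ^ 2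
  have hφ : ContDiff ℝ 1 (fun q : E d × ℝ => φ q.1 q.2) := by
    have : ContDiff ℝ 1 fun q : E d × ℝ => ‖q.1 - (y + (q.2 - s) • z)‖ ^ 2 :=
      ContDiff.norm_sq ℝ (by fun_prop)
    simp only [φ, p]
    fun_prop
  have hloc : IsLocalMax (fun q : E d × ℝ => w q.1 q.2 - φ q.1 q.2)
      (y + (r0 - s) • z + e0, r0) := by
    have hcont : Continuous fun q : E d × ℝ => (q.1 - (y + (q.2 - s) • z), q.2) := by fun_prop
    have hmemn : Metric.closedBall (0 : E d) 1 ×ˢ Set.Icc s s' ∈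
        𝓝 ((y + (r0 - s) • z + e0) - (y + (r0 - s) • z), r0) := by
      refine prod_mem_nhds ?_ (Icc_mem_nhds hr0s hr0s')
      rw [add_sub_cancel_left]
      refine mem_of_superset (Metric.isOpen_ball.mem_nhds ?_) Metric.ball_subset_closedBall
      rw [mem_ball_zero_iff]
      exact he0.trans_le hρ1
    filter_upwards [hcont.continuousAt.preimage_mem_nhds hmemn] with q hq
    have := hmax hq
    simp only [Set.mem_ofPred_eq, A, add_sub_cancel] at this
    simp only [φ, add_sub_cancel_left]
    linarith
  have hd : DifferentiableAt ℝ (fun q : E d × ℝ => φ q.1 q.2) (y + (r0 - s) • z + e0, r0) :=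
    hφ.differentiable one_ne_zero _
  -- Along the direction `(z, 1)` the spatial penalty is constant, so only the drift and the barrier
  -- contribute. The outcome is `c + c' ≤ F ≤ c + C * ρ` at the maximum, which contradicts the
  -- choice of `ρ`.
  have hvisc := hw φ hφ _ r0 ⟨by linarith, by linarith⟩ hloc
  have h1 := le_neg_deriv_add_hamiltonian hD.superlinear hd z
  have h2 : fderiv ℝ (fun q : E d × ℝ => φ q.1 q.2) (y + (r0 - s) • z + e0, r0) (z, 1) =
      -(ℓ z + c + c') + -(N * p r0) := by
    refine (hasDerivAt_line hd z).unique ?_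
    have e1 : (fun h : ℝ => φ (y + (r0 - s) • z + e0 + h • z) (r0 + h)) =
        fun h : ℝ => -((ℓ z + c + c') * (r0 + h - s)) + p (r0 + h) + k * ‖e0‖ ^ 2 := by
      funext h
      simp only [φ]
      congr 4
      module
    simp only [e1]
    refine HasDerivAt.add_const _ (HasDerivAt.add ?_ ?_)
    · have := ((((hasDerivAt_id (0 : ℝ)).const_add r0).sub_const s).const_mul (ℓ z + c + c')).fun_neg
      simpa using this
    · have := ((((((hasDerivAt_id (0 : ℝ)).const_add r0).sub_const s).const_mul N).fun_neg).exp).const_mul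
        (2 * B + G + 1)
      refine this.congr_deriv ?_
      simp only [p, id_eq]
      ring_nf
  have h3 := hF r0 ⟨hr0s.le, hr0s'.le⟩
  have h4 := hD.lipschitz (y + (r0 - s) • z + e0) (y + (r0 - s) • z) r0
  rw [add_sub_cancel_left] at h4
  have h5 := (abs_le.1 h4).2
  have h6 : C * ‖e0‖ ≤ C * ρ := mul_le_mul_of_nonneg_left he0.le hD.nonneg
  have h7 := mul_nonneg hN0.le (hp0 r0)
  rw [h2] at h1
  linarith

end SubLine

/-! ### Smoothing by local averages -/

section Mollification

open scoped Convolution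

/-- Local averages of a continuous function: a `C¹` function which is uniformly close to it on a
compact set and inherits its one-sided increment bounds. -/
theorem exists_contDiff_average {V : Type*} [NormedAddCommGroup V] [NormedSpace ℝ V]
    [FiniteDimensional ℝ V] [MeasurableSpace V] [BorelSpace V] {μ : Measure V}
    [μ.IsAddHaarMeasure] {S : V → ℝ} (hS : Continuous S) {K : Set V} (hK : IsCompact K) {e ρ : ℝ}
    (he : 0 < e) (hρ : 0 < ρ) :
    ∃ S' : V → ℝ, ContDiff ℝ 1 S' ∧ (∀ q ∈ K, |S' q - S q| ≤ e) ∧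
      ∀ (q q' : V) (k : ℝ), (∀ ζ, ‖ζ‖ < ρ → S (q - ζ) ≤ k + S (q' - ζ)) → S' q ≤ k + S' q' := by
  obtain ⟨δ, hδ, hSδ⟩ : ∃ δ > 0, ∀ q ∈ K, ∀ q', dist q' q < δ → dist (S q') (S q) ≤ e := by
    have h1 := hK.uniformContinuousAt_of_continuousAt S (fun q _ => hS.continuousAt)
      (Metric.dist_mem_uniformity he)
    obtain ⟨δ, hδ, h2⟩ := Metric.mem_uniformity_dist.1 h1
    refine ⟨δ, hδ, fun q hq q' hqq' => ?_⟩
    have : dist (S q) (S q') < e := h2 (by rwa [dist_comm]) hq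
    rw [dist_comm]
    exact this.le
  -- A support of radius at most `δ` gives closeness on `K`; radius at most `ρ` ensures that only
  -- the shifts covered by the increment hypothesis are averaged.
  let φ : ContDiffBump (0 : V) :=
    ⟨min δ ρ / 2, min δ ρ, by positivity, half_lt_self (by positivity)⟩
  have hint : ∀ q, Integrable (fun ζ => φ.normed μ ζ * S (q - ζ)) μ := fun q => by
    refine Continuous.integrable_of_hasCompactSupport ?_ ?_
    · exact φ.continuous_normed.mul (hS.comp (by fun_prop))
    · exact φ.hasCompactSupport_normed.mul_right
  have hconv : ∀ q, (φ.normed μ ⋆[ContinuousLinearMap.lsmul ℝ ℝ, μ] S) q =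
      ∫ ζ, φ.normed μ ζ * S (q - ζ) ∂μ := fun q => rfl
  refine ⟨φ.normed μ ⋆[ContinuousLinearMap.lsmul ℝ ℝ, μ] S, ?_, fun q hq => ?_, ?_⟩
  · exact φ.hasCompactSupport_normed.contDiff_convolution_left (n := 1) _ φ.contDiff_normed
      hS.locallyIntegrable
  · rw [← Real.dist_eq]
    refine φ.dist_normed_convolution_le hS.aestronglyMeasurable fun q' hq' => ?_
    exact hSδ q hq q' ((Metric.mem_ball.1 hq').trans_le (min_le_left _ _))
  · intro q q' k h
    rw [hconv, hconv]
    have h1 : k = ∫ ζ, φ.normed μ ζ * k ∂μ := by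
      rw [integral_mul_const, φ.integral_normed, one_mul]
    have h2 : Integrable (fun ζ => φ.normed μ ζ * k) μ := φ.integrable_normed.mul_const k
    rw [h1, ← integral_add h2 (hint q')]
    refine integral_mono (hint q) (h2.add (hint q')) fun ζ => ?_
    simp only
    rw [← mul_add]
    by_cases hζ : ‖ζ‖ < ρ
    · exact mul_le_mul_of_nonneg_left (h ζ hζ) (φ.nonneg_normed ζ)
    · have : φ.normed μ ζ = 0 := by
        rw [← Function.notMem_support, φ.support_normed_eq, mem_ball_zero_iff]
        exact fun h => hζ (h.trans_le (min_le_right _ _))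
      simp [this]

end Mollification

/-! ### Comparison of line subsolutions with viscosity supersolutions -/

section Comparison

variable {d : ℕ} {ℓ : E d → ℝ} {F : E d → ℝ → ℝ} {C : ℝ}

/-- The mollified `S` still satisfies the line inequality near the region of interest, up to an
error `c / 2`, and a drift `c` more than compensates it. The result is a C¹ strict subsolution, an
admissible test function at a minimum of the difference with `W`; no doubling of variables is
needed. -/
theorem IsLineSubsolution.le_supersolution_of_mem_Ioo (hD : IsControlData ℓ F C) {T t0 t1 : ℝ}
    (h0 : 0 ≤ t0) (h1 : t1 ≤ T) {S W : E d → ℝ → ℝ}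
    (hSc : ContinuousOn (fun z : E d × ℝ => S z.1 z.2) (Set.univ ×ˢ Set.Icc t0 t1))
    (hWc : ContinuousOn (fun z : E d × ℝ => W z.1 z.2) (Set.univ ×ˢ Set.Icc t0 t1))
    (hS : IsLineSubsolution ℓ F t0 t1 S)
    (hW : IsViscositySupersolution T (hamiltonian ℓ) F W)
    (hT : ∀ x, S x t1 ≤ W x t1) {R : ℝ}
    (hR : ∀ x, ‖x‖ = R → ∀ t ∈ Set.Icc t0 t1, S x t ≤ W x t) {x : E d} (hxR : ‖x‖ < R) {t : ℝ}
    (ht : t ∈ Set.Ioo t0 t1) : S x t ≤ W x t := by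
  by_contra! hcon
  have h01 : t0 < t1 := ht.1.trans ht.2
  obtain ⟨G, hG⟩ : ∃ G, G = S x t - W x t := ⟨_, rfl⟩
  have hG0 : 0 < G := by linarith
  obtain ⟨c, hc⟩ : ∃ c, c = G / 8 / (t1 - t0) := ⟨_, rfl⟩
  have hτ : 0 < t1 - t0 := sub_pos.2 h01
  have hc0 : 0 < c := by rw [hc]; positivity
  have hcG : c * (t1 - t0) = G / 8 := by rw [hc]; field_simp
  have hK : IsCompact (Metric.closedBall (0 : E d) R ×ˢ Set.Icc t0 t1) :=
    (isCompact_closedBall _ _).prod isCompact_Icc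
  have hKu : Metric.closedBall (0 : E d) R ×ˢ Set.Icc t0 t1 ⊆ Set.univ ×ˢ Set.Icc t0 t1 :=
    Set.prod_mono (Set.subset_univ _) le_rfl
  have hxK : (x, t) ∈ Metric.closedBall (0 : E d) R ×ˢ Set.Icc t0 t1 :=
    ⟨by simpa using hxR.le, ht.1.le, ht.2.le⟩
  have hdc := (hWc.sub hSc).mono hKu
  obtain ⟨B, hB⟩ := hK.exists_bound_of_continuousOn hdc
  have hB0 : 0 ≤ B := (norm_nonneg _).trans (hB _ hxK)
  -- No order is assumed at time `t0`. The barrier, equal to the bound `B` there and small at `t`,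
  -- keeps the minimum off that face.
  obtain ⟨N, hN0, hN⟩ := exists_mul_exp_neg_lt B (sub_pos.2 ht.1) (show 0 < G / 8 by positivity)
  let p : ℝ → ℝ := fun r => B * Real.exp (-(N * (r - t0)))
  have hp0 : ∀ r, 0 ≤ p r := fun r => by positivity
  let f : E d × ℝ → ℝ := fun q => W q.1 q.2 - S q.1 q.2 + c * (t1 - q.2) + p q.2
  have hf : ContinuousOn f (Metric.closedBall (0 : E d) R ×ˢ Set.Icc t0 t1) :=
    (hdc.add (by fun_prop)).add (by fun_prop)
  have hfx : f (x, t) ≤ -(3 * G / 4) := by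
    have e1 : p t < G / 8 := hN
    have e2 : c * (t1 - t) ≤ c * (t1 - t0) := by
      have := ht.1; gcongr
    simp only [f]
    linarith
  -- the region where `f` is negative
  let K' := (Metric.closedBall (0 : E d) R ×ˢ Set.Icc t0 t1) ∩ f ⁻¹' Set.Iic (-(G / 2))
  have hK' : IsCompact K' :=
    hK.of_isClosed_subset (hf.preimage_isClosed_of_isClosed hK.isClosed isClosed_Iic)
      Set.inter_subset_left
  have hK'i : K' ⊆ Metric.ball (0 : E d) R ×ˢ Set.Ioo t0 t1 := by
    rintro ⟨y, s⟩ ⟨⟨hy, hs⟩, hfy⟩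
    have hfy : W y s - S y s + c * (t1 - s) + p s ≤ -(G / 2) := hfy
    have e1 := hp0 s
    have e2 : 0 ≤ c * (t1 - s) := mul_nonneg hc0.le (sub_nonneg.2 hs.2)
    simp only at hy hs
    refine ⟨?_, ?_, ?_⟩
    · by_contra hcy
      have := hR y (le_antisymm (by simpa using hy) (by simpa using hcy)) s hs
      linarith
    · refine hs.1.lt_of_ne ?_
      rintro rfl
      have e3 := hB (y, t0) ⟨hy, hs⟩
      have e4 : p t0 = B := by simp [p]
      have e5 := (abs_le.1 e3).1
      simp only [Pi.sub_apply] at e5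
      linarith
    · refine hs.2.lt_of_ne ?_
      rintro rfl
      have := hT y
      linarith
  -- `K'` is a compact subset of the open cylinder. This leaves room for the averaging radius and
  -- for short segments, on which `F` varies by at most `c / 2`.
  obtain ⟨ρ0, hρ0, hρK⟩ := hK'.exists_thickening_subset_open
    (Metric.isOpen_ball.prod isOpen_Ioo) hK'i
  obtain ⟨ρ1, hρ1, hFρ⟩ : ∃ δ > 0, ∀ q ∈ K', ∀ q' : E d × ℝ, dist q q' < δ →
      F q'.1 q'.2 ≤ F q.1 q.2 + c / 2 := by
    have e1 := hK'.uniformContinuousAt_of_continuousAt (fun q : E d × ℝ => F q.1 q.2)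
      (fun q _ => hD.continuous_potential.continuousAt) (Metric.dist_mem_uniformity (half_pos hc0))
    obtain ⟨δ, hδ, e2⟩ := Metric.mem_uniformity_dist.1 e1
    refine ⟨δ, hδ, fun q hq q' hqq' => ?_⟩
    have e3 : |F q.1 q.2 - F q'.1 q'.2| < c / 2 := e2 hqq' hq
    linarith [(abs_lt.1 e3).1]
  let ρ := min ρ0 ρ1 / 2
  have hρ : 0 < ρ := by positivity
  -- extend and mollify
  have hext : Continuous fun q : E d × ℝ => S q.1 (Set.projIcc t0 t1 h01.le q.2) := by
    rw [← continuousOn_univ]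
    refine hSc.comp (f := fun q : E d × ℝ => (q.1, (Set.projIcc t0 t1 h01.le q.2 : ℝ))) ?_ ?_
    · exact (continuous_fst.prodMk (continuous_subtype_val.comp
        (continuous_projIcc.comp continuous_snd))).continuousOn
    · exact fun q _ => ⟨trivial, Subtype.coe_prop _⟩
  obtain ⟨S', hS'c, hS'K, hS'⟩ := exists_contDiff_average
    (μ := (volume : Measure (E d)).prod (volume : Measure ℝ)) hext hK
    (show 0 < G / 16 by positivity) hρ
  have hS'S : ∀ q ∈ Metric.closedBall (0 : E d) R ×ˢ Set.Icc t0 t1,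
      |S' q - S q.1 q.2| ≤ G / 16 := fun q hq => by
    have := hS'K q hq
    rwa [Set.projIcc_of_mem h01.le hq.2] at this
  let φ : E d → ℝ → ℝ := fun y s => S' (y, s) - c * (t1 - s) - p s
  have hφ : ContDiff ℝ 1 fun q : E d × ℝ => φ q.1 q.2 := by
    simp only [φ, p]
    fun_prop
  obtain ⟨⟨y, s⟩, hmem, hmin⟩ := hK.exists_isMinOn ⟨_, hxK⟩
    (f := fun q : E d × ℝ => W q.1 q.2 - φ q.1 q.2)
    ((hWc.mono hKu).sub hφ.continuous.continuousOn)
  -- Mollification costs `G / 16` at each of the two points, whereas `f (x, t)` lies below the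
  -- threshold `-(G / 2)` by `G / 4`.
  have hyK' : (y, s) ∈ K' := by
    refine ⟨hmem, ?_⟩
    have e1 := hmin hxK
    simp only [Set.mem_ofPred_eq, φ] at e1
    have e2 := (abs_le.1 (hS'S _ hmem)).2
    have e3 := (abs_le.1 (hS'S _ hxK)).1
    simp only [f] at hfx
    change W y s - S y s + c * (t1 - s) + p s ≤ -(G / 2)
    simp only at e2 e3
    linarith
  have hys := hK'i hyK'
  have hloc : IsLocalMin (fun q : E d × ℝ => W q.1 q.2 - φ q.1 q.2) (y, s) := by
    have : Metric.ball (0 : E d) R ×ˢ Set.Ioo t0 t1 ∈ 𝓝 (y, s) :=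
      (Metric.isOpen_ball.prod isOpen_Ioo).mem_nhds hys
    filter_upwards [this] with q hq
    exact hmin ⟨Metric.ball_subset_closedBall hq.1, Set.Ioo_subset_Icc_self hq.2⟩
  have hs : t0 < s ∧ s < t1 := hys.2
  have hvisc := hW φ hφ y s ⟨by linarith, by linarith⟩ hloc
  have hd : DifferentiableAt ℝ (fun q : E d × ℝ => φ q.1 q.2) (y, s) :=
    hφ.differentiable one_ne_zero _
  -- The test function satisfies the subsolution inequality with margin `c / 2`, which is
  -- incompatible with the supersolution inequality at the same point.
  have hle := neg_deriv_add_hamiltonian_le (ℓ := ℓ) hd (c := F y s - c / 2) fun z => by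
    have hder := hasDerivAt_line hd z
    have key : c / 2 - (ℓ z + F y s) ≤ fderiv ℝ (fun q : E d × ℝ => φ q.1 q.2) (y, s) (z, 1) := by
      refine le_of_hasDerivAt_of_eventually_right hder ?_
      have e1 : ∀ᶠ r in 𝓝[>] (0 : ℝ), r < ρ ∧ r * ‖z‖ < ρ := by
        refine Filter.Eventually.filter_mono nhdsWithin_le_nhds ?_
        refine (gt_mem_nhds hρ).and ?_
        have : Tendsto (fun r : ℝ => r * ‖z‖) (𝓝 0) (𝓝 (0 * ‖z‖)) :=
          tendsto_id.mul_const _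
        rw [zero_mul] at this
        exact this.eventually (gt_mem_nhds hρ)
      filter_upwards [e1, self_mem_nhdsWithin] with r hr hr0
      have hr0 : 0 < r := hr0
      have e2 := hS' (y, s) (y + r • z, s + r) (r * (ℓ z + (F y s + c / 2))) ?_
      · have e3 : p (s + r) ≤ p s := by
          simp only [p]
          gcongr
          nlinarith
        simp only [φ, zero_smul, add_zero]
        linarith
      · rintro ⟨a, b⟩ hab
        have ha : ‖a‖ < ρ := (norm_fst_le (a, b)).trans_lt hab
        have hb : |b| < ρ := (norm_snd_le (a, b)).trans_lt hab
        have hbb := abs_lt.1 hb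
        have hnear : ∀ r' ∈ Set.Icc 0 r, dist (y, s) (y - a + r' • z, s - b + r') < 2 * ρ := by
          intro r' hr'
          rw [Prod.dist_eq, max_lt_iff]
          constructor
          · rw [dist_eq_norm, show y - (y - a + r' • z) = a - r' • z by abel]
            refine (norm_sub_le _ _).trans_lt ?_
            rw [norm_smul, Real.norm_of_nonneg hr'.1]
            have := mul_le_mul_of_nonneg_right hr'.2 (norm_nonneg z)
            linarith [hr.2]
          · rw [Real.dist_eq, abs_lt]
            constructor <;> linarith [hr'.1, hr'.2, hr.1, hbb.1, hbb.2]
        have hin : ∀ r' ∈ Set.Icc 0 r, s - b + r' ∈ Set.Ioo t0 t1 := by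
          intro r' hr'
          have : (y - a + r' • z, s - b + r') ∈ Metric.thickening ρ0 K' := by
            refine Metric.mem_thickening_iff.2 ⟨_, hyK', ?_⟩
            rw [dist_comm]
            refine (hnear r' hr').trans_le ?_
            simp only [ρ]
            linarith [min_le_left ρ0 ρ1]
          exact (hρK this).2
        have i0 := hin 0 ⟨le_rfl, hr0.le⟩
        have i1 := hin r ⟨hr0.le, le_rfl⟩
        rw [add_zero] at i0
        have := hS (s - b) (s - b + r) i0.1.le (by linarith) i1.2.le (y - a) z (F y s + c / 2) ?_
        · simp only [Prod.mk_sub_mk]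
          rw [Set.projIcc_of_mem h01.le ⟨i0.1.le, i0.2.le⟩, show s + r - b = s - b + r by ring,
            Set.projIcc_of_mem h01.le ⟨i1.1.le, i1.2.le⟩,
            show y + r • z - a = y - a + r • z by abel]
          simpa using this
        · intro r' hr'
          refine hFρ (y, s) hyK' (y - a + (r' - (s - b)) • z, r') ?_
          have := hnear (r' - (s - b)) ⟨by linarith [hr'.1], by linarith [hr'.2]⟩
          rw [add_sub_cancel] at this
          refine this.trans_le ?_
          simp only [ρ]
          linarith [min_le_right ρ0 ρ1]
    linarith
  linarith

/-- Comparison of a subsolution along lines with a viscosity supersolution. -/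
theorem IsLineSubsolution.le_supersolution (hD : IsControlData ℓ F C) {T t0 t1 : ℝ}
    (h0 : 0 ≤ t0) (h01 : t0 < t1) (h1 : t1 ≤ T) {S W : E d → ℝ → ℝ}
    (hSc : ContinuousOn (fun z : E d × ℝ => S z.1 z.2) (Set.univ ×ˢ Set.Icc t0 t1))
    (hWc : ContinuousOn (fun z : E d × ℝ => W z.1 z.2) (Set.univ ×ˢ Set.Icc t0 t1))
    (hS : IsLineSubsolution ℓ F t0 t1 S)
    (hW : IsViscositySupersolution T (hamiltonian ℓ) F W)
    (hT : ∀ x, S x t1 ≤ W x t1) {R : ℝ}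
    (hR : ∀ x, ‖x‖ = R → ∀ t ∈ Set.Icc t0 t1, S x t ≤ W x t) {x : E d} (hxR : ‖x‖ < R) {t : ℝ}
    (ht : t ∈ Set.Icc t0 t1) : S x t ≤ W x t := by
  have hx : ∀ {f : E d → ℝ → ℝ},
      ContinuousOn (fun z : E d × ℝ => f z.1 z.2) (Set.univ ×ˢ Set.Icc t0 t1) →
      ContinuousOn (fun s => f x s) (Set.Icc t0 t1) := fun hf =>
    hf.comp (f := fun s : ℝ => (x, s)) (by fun_prop) fun s hs => ⟨trivial, hs⟩
  have hcl : closure (Set.Ioo t0 t1) = Set.Icc t0 t1 := closure_Ioo h01.ne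
  exact le_on_closure (fun s hs => hS.le_supersolution_of_mem_Ioo hD h0 h1 hSc hWc hW hT hR hxR hs)
    (hcl.symm ▸ hx hSc) (hcl.symm ▸ hx hWc) (hcl.symm ▸ ht)

end Comparison

/-! ### Value functions of optimal control problems -/

/-- A class of admissible velocities on `[0, T]`: it contains the constants and is stable under
concatenation, and velocities have integrable cost. -/
structure IsControlClass {d : ℕ} (T : ℝ) (ℓ : E d → ℝ) (V : Set (ℝ → E d)) : Prop where
  integrable : ∀ v ∈ V, IntegrableOn v (Set.Icc 0 T) volume
  integrable_cost : ∀ v ∈ V, IntegrableOn (fun s => ℓ (v s)) (Set.Icc 0 T) volume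
  const_mem : ∀ z : E d, (fun _ => z) ∈ V
  glue_mem : ∀ v ∈ V, ∀ w ∈ V, ∀ τ : ℝ, (fun s => if s ≤ τ then v s else w s) ∈ V

/-- The curve with velocity `v` which is at `x` at time `t`. -/
noncomputable def trajectory {d : ℕ} (x : E d) (t : ℝ) (v : ℝ → E d) (s : ℝ) : E d :=
  x + ∫ r in t..s, v r

/-- The running cost on `[t, t']` of the curve with velocity `v` which is at `x` at time `t`. -/
noncomputable def runningCost {d : ℕ} (ℓ : E d → ℝ) (F : E d → ℝ → ℝ) (x : E d) (t : ℝ)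
    (v : ℝ → E d) (t' : ℝ) : ℝ :=
  ∫ s in t..t', (ℓ (v s) + F (trajectory x t v s) s)

/-- The value function of the control problem with terminal cost `G` at time `T`. -/
noncomputable def valueFunction {d : ℕ} (V : Set (ℝ → E d)) (ℓ : E d → ℝ) (F : E d → ℝ → ℝ)
    (G : E d → ℝ) (T : ℝ) (x : E d) (t : ℝ) : ℝ :=
  ⨅ v : V, (runningCost ℓ F x t v T + G (trajectory x t v T))

section Control

variable {d : ℕ} {ℓ : E d → ℝ} {F : E d → ℝ → ℝ} {C T : ℝ} {V : Set (ℝ → E d)}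

theorem IsControlClass.mono (hV : IsControlClass T ℓ V) {T' : ℝ} (h : T' ≤ T) :
    IsControlClass T' ℓ V where
  integrable v hv := (hV.integrable v hv).mono_set (Set.Icc_subset_Icc_right h)
  integrable_cost v hv := (hV.integrable_cost v hv).mono_set (Set.Icc_subset_Icc_right h)
  const_mem := hV.const_mem
  glue_mem := hV.glue_mem

theorem IsControlClass.intervalIntegrable (hV : IsControlClass T ℓ V) {v : ℝ → E d} (hv : v ∈ V)
    {a b : ℝ} (ha : a ∈ Set.Icc 0 T) (hb : b ∈ Set.Icc 0 T) : IntervalIntegrable v volume a b :=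
  ((hV.integrable v hv).mono_set (Set.uIcc_subset_Icc ha hb)).intervalIntegrable

theorem IsControlClass.intervalIntegrable_cost (hV : IsControlClass T ℓ V) {v : ℝ → E d}
    (hv : v ∈ V) {a b : ℝ} (ha : a ∈ Set.Icc 0 T) (hb : b ∈ Set.Icc 0 T) :
    IntervalIntegrable (fun s => ℓ (v s)) volume a b :=
  ((hV.integrable_cost v hv).mono_set (Set.uIcc_subset_Icc ha hb)).intervalIntegrable

@[simp]
theorem trajectory_self (x : E d) (t : ℝ) (v : ℝ → E d) : trajectory x t v t = x := by
  simp [trajectory]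

theorem trajectory_const (x z : E d) (t s : ℝ) :
    trajectory x t (fun _ => z) s = x + (s - t) • z := by
  simp [trajectory]

theorem trajectory_translate (x y : E d) (t : ℝ) (v : ℝ → E d) (s : ℝ) :
    trajectory y t v s = trajectory x t v s + (y - x) := by
  simp only [trajectory]; abel

theorem trajectory_congr {x : E d} {t s : ℝ} {v w : ℝ → E d} (hts : t ≤ s)
    (h : ∀ r ∈ Set.Ioc t s, v r = w r) : trajectory x t v s = trajectory x t w s := by
  simp only [trajectory]
  rw [intervalIntegral.integral_of_le hts, intervalIntegral.integral_of_le hts,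
    setIntegral_congr_fun measurableSet_Ioc h]

theorem runningCost_congr {x : E d} {t s : ℝ} {v w : ℝ → E d} (hts : t ≤ s)
    (h : ∀ r ∈ Set.Ioc t s, v r = w r) : runningCost ℓ F x t v s = runningCost ℓ F x t w s := by
  simp only [runningCost]
  rw [intervalIntegral.integral_of_le hts, intervalIntegral.integral_of_le hts]
  refine setIntegral_congr_fun measurableSet_Ioc fun r hr => ?_
  rw [h r hr, trajectory_congr hr.1.le fun r' hr' => h r' ⟨hr'.1, hr'.2.trans hr.2⟩]

theorem IsControlClass.continuousOn_trajectory (hV : IsControlClass T ℓ V) {v : ℝ → E d}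
    (hv : v ∈ V) (x : E d) {t : ℝ} (ht : t ∈ Set.Icc 0 T) :
    ContinuousOn (trajectory x t v) (Set.Icc 0 T) := by
  have h0 : (0 : ℝ) ≤ T := ht.1.trans ht.2
  have := intervalIntegral.continuousOn_primitive_interval' (μ := volume) (a := t)
    (hV.intervalIntegrable hv (a := 0) (b := T) ⟨le_rfl, h0⟩ ⟨h0, le_rfl⟩)
    (by rwa [Set.uIcc_of_le h0])
  rw [Set.uIcc_of_le h0] at this
  exact continuousOn_const.add this

theorem trajectory_trajectory (hV : IsControlClass T ℓ V) {v : ℝ → E d} (hv : v ∈ V) (x : E d)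
    {t s r : ℝ} (ht : t ∈ Set.Icc 0 T) (hs : s ∈ Set.Icc 0 T) (hr : r ∈ Set.Icc 0 T) :
    trajectory (trajectory x t v s) s v r = trajectory x t v r := by
  simp only [trajectory]
  rw [add_assoc, intervalIntegral.integral_add_adjacent_intervals
    (hV.intervalIntegrable hv ht hs) (hV.intervalIntegrable hv hs hr)]

theorem intervalIntegrable_potential (hD : IsControlData ℓ F C) (hV : IsControlClass T ℓ V)
    {v : ℝ → E d} (hv : v ∈ V) (x : E d) {t a b : ℝ} (ht : t ∈ Set.Icc 0 T)
    (ha : a ∈ Set.Icc 0 T) (hb : b ∈ Set.Icc 0 T) :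
    IntervalIntegrable (fun s => F (trajectory x t v s) s) volume a b := by
  refine ContinuousOn.intervalIntegrable ?_
  have h1 := (hV.continuousOn_trajectory hv x ht).mono (Set.uIcc_subset_Icc ha hb)
  exact hD.continuous_potential.comp_continuousOn
    (f := fun s => (trajectory x t v s, s)) (h1.prodMk continuousOn_id)

theorem intervalIntegrable_running (hD : IsControlData ℓ F C) (hV : IsControlClass T ℓ V)
    {v : ℝ → E d} (hv : v ∈ V) (x : E d) {t a b : ℝ} (ht : t ∈ Set.Icc 0 T)
    (ha : a ∈ Set.Icc 0 T) (hb : b ∈ Set.Icc 0 T) :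
    IntervalIntegrable (fun s => ℓ (v s) + F (trajectory x t v s) s) volume a b :=
  (hV.intervalIntegrable_cost hv ha hb).add (intervalIntegrable_potential hD hV hv x ht ha hb)

theorem runningCost_add (hD : IsControlData ℓ F C) (hV : IsControlClass T ℓ V)
    {v : ℝ → E d} (hv : v ∈ V) (x : E d) {t s r : ℝ} (ht : t ∈ Set.Icc 0 T)
    (hs : s ∈ Set.Icc 0 T) (hr : r ∈ Set.Icc 0 T) :
    runningCost ℓ F x t v r =
      runningCost ℓ F x t v s + runningCost ℓ F (trajectory x t v s) s v r := by
  have h1 : runningCost ℓ F (trajectory x t v s) s v r =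
      ∫ r' in s..r, (ℓ (v r') + F (trajectory x t v r') r') := by
    refine intervalIntegral.integral_congr fun r' hr' => ?_
    rw [trajectory_trajectory hV hv x ht hs (Set.uIcc_subset_Icc hs hr hr')]
  rw [h1]
  exact (intervalIntegral.integral_add_adjacent_intervals
    (intervalIntegrable_running hD hV hv x ht ht hs)
    (intervalIntegrable_running hD hV hv x ht hs hr)).symm

theorem norm_trajectory_sub_le (v : ℝ → E d) (x : E d) {t s : ℝ} (hts : t ≤ s) :
    ‖trajectory x t v s - x‖ ≤ ∫ r in t..s, ‖v r‖ := by
  simp only [trajectory, add_sub_cancel_left]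
  exact intervalIntegral.norm_integral_le_integral_norm hts

/-- Superlinearity of the cost, along curves. -/
theorem le_runningCost (hD : IsControlData ℓ F C) (hV : IsControlClass T ℓ V)
    {v : ℝ → E d} (hv : v ∈ V) (x : E d) {t s L K : ℝ} (ht : t ∈ Set.Icc 0 T)
    (hs : s ∈ Set.Icc 0 T) (hts : t ≤ s) (hL : 0 ≤ L) (hK : ∀ z, L * ‖z‖ - K ≤ ℓ z) :
    L * ‖trajectory x t v s - x‖ - (K + C) * (s - t) ≤ runningCost ℓ F x t v s := by
  have h1 := norm_trajectory_sub_le v x hts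
  have h2 : ∫ r in t..s, (L * ‖v r‖ - (K + C)) ≤ runningCost ℓ F x t v s := by
    refine intervalIntegral.integral_mono_on hts ?_ (intervalIntegrable_running hD hV hv x ht ht hs)
      fun r _ => ?_
    · exact ((hV.intervalIntegrable hv ht hs).norm.const_mul L).sub intervalIntegrable_const
    · have e1 := hK (v r)
      have e2 := (abs_le.1 (hD.bound (trajectory x t v r) r)).1
      linarith
  rw [intervalIntegral.integral_sub ((hV.intervalIntegrable hv ht hs).norm.const_mul L)
    intervalIntegrable_const, intervalIntegral.integral_const_mul, intervalIntegral.integral_const,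
    smul_eq_mul] at h2
  nlinarith [mul_le_mul_of_nonneg_left h1 hL]

theorem runningCost_translate_le (hD : IsControlData ℓ F C) (hV : IsControlClass T ℓ V)
    {v : ℝ → E d} (hv : v ∈ V) (x y : E d) {t s : ℝ} (ht : t ∈ Set.Icc 0 T)
    (hs : s ∈ Set.Icc 0 T) (hts : t ≤ s) :
    runningCost ℓ F x t v s ≤ runningCost ℓ F y t v s + C * ‖x - y‖ * (s - t) := by
  have h1 : runningCost ℓ F x t v s ≤
      ∫ r in t..s, ((ℓ (v r) + F (trajectory y t v r) r) + C * ‖x - y‖) := by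
    refine intervalIntegral.integral_mono_on hts (intervalIntegrable_running hD hV hv x ht ht hs)
      ((intervalIntegrable_running hD hV hv y ht ht hs).add intervalIntegrable_const) fun r _ => ?_
    have e1 := hD.lipschitz (trajectory x t v r) (trajectory y t v r) r
    rw [trajectory_translate y x, add_sub_cancel_left] at e1
    rw [trajectory_translate y x]
    linarith [(abs_le.1 e1).2]
  rw [intervalIntegral.integral_add (intervalIntegrable_running hD hV hv y ht ht hs)
    intervalIntegrable_const, intervalIntegral.integral_const, smul_eq_mul] at h1
  unfold runningCost at h1 ⊢
  linarith

variable {G : E d → ℝ} {Lg : ℝ}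

/-- A displacement changes the terminal cost by at most `Lg` times its length, and superlinearity
with slope `Lg` charges at least that much in the running cost. -/
theorem le_cost (hD : IsControlData ℓ F C) (hV : IsControlClass T ℓ V)
    (hG : ∀ x y, |G x - G y| ≤ Lg * ‖x - y‖) (hLg : 0 ≤ Lg) {K : ℝ}
    (hK : ∀ z, Lg * ‖z‖ - K ≤ ℓ z) (x : E d) {t : ℝ} (ht : t ∈ Set.Icc 0 T)
    {v : ℝ → E d} (hv : v ∈ V) :
    G x - (K + C) * (T - t) ≤ runningCost ℓ F x t v T + G (trajectory x t v T) := by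
  have h1 := le_runningCost hD hV hv x ht ⟨ht.1.trans ht.2, le_rfl⟩ ht.2 hLg hK
  have h2 := (abs_le.1 (hG (trajectory x t v T) x)).1
  linarith

theorem bddBelow_cost (hD : IsControlData ℓ F C) (hV : IsControlClass T ℓ V)
    (hG : ∀ x y, |G x - G y| ≤ Lg * ‖x - y‖) (hLg : 0 ≤ Lg) (x : E d) {t : ℝ}
    (ht : t ∈ Set.Icc 0 T) :
    BddBelow (Set.range fun v : V => runningCost ℓ F x t v T + G (trajectory x t v T)) := by
  obtain ⟨K, hK⟩ := hD.superlinear Lg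
  refine ⟨G x - (K + C) * (T - t), ?_⟩
  rintro _ ⟨⟨v, hv⟩, rfl⟩
  exact le_cost hD hV hG hLg hK x ht hv

theorem valueFunction_le_cost (hD : IsControlData ℓ F C) (hV : IsControlClass T ℓ V)
    (hG : ∀ x y, |G x - G y| ≤ Lg * ‖x - y‖) (hLg : 0 ≤ Lg) (x : E d) {t : ℝ}
    (ht : t ∈ Set.Icc 0 T) {v : ℝ → E d} (hv : v ∈ V) :
    valueFunction V ℓ F G T x t ≤ runningCost ℓ F x t v T + G (trajectory x t v T) :=
  ciInf_le (bddBelow_cost hD hV hG hLg x ht) ⟨v, hv⟩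

theorem IsControlClass.nonempty (hV : IsControlClass T ℓ V) : Nonempty V :=
  ⟨⟨_, hV.const_mem 0⟩⟩

theorem le_valueFunction (hV : IsControlClass T ℓ V) {x : E d} {t c : ℝ}
    (h : ∀ v ∈ V, c ≤ runningCost ℓ F x t v T + G (trajectory x t v T)) :
    c ≤ valueFunction V ℓ F G T x t :=
  have := hV.nonempty
  le_ciInf fun v => h v.1 v.2

theorem exists_cost_lt (hV : IsControlClass T ℓ V) (x : E d) (t : ℝ) {η : ℝ} (hη : 0 < η) :
    ∃ v ∈ V, runningCost ℓ F x t v T + G (trajectory x t v T) <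
      valueFunction V ℓ F G T x t + η := by
  have := hV.nonempty
  obtain ⟨⟨v, hv⟩, h⟩ := exists_lt_of_ciInf_lt (lt_add_of_pos_right
    (⨅ v : V, (runningCost ℓ F x t v T + G (trajectory x t v T))) hη)
  exact ⟨v, hv, h⟩

theorem valueFunction_terminal (hV : IsControlClass T ℓ V) (x : E d) :
    valueFunction V ℓ F G T x T = G x := by
  have := hV.nonempty
  simp [valueFunction, runningCost]

theorem isGLB_valueFunction (hD : IsControlData ℓ F C) (hV : IsControlClass T ℓ V)
    (hG : ∀ x y, |G x - G y| ≤ Lg * ‖x - y‖) (hLg : 0 ≤ Lg) (x : E d) {t : ℝ}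
    (ht : t ∈ Set.Icc 0 T) :
    IsGLB {c | ∃ v ∈ V, c = runningCost ℓ F x t v T + G (trajectory x t v T)}
      (valueFunction V ℓ F G T x t) := by
  constructor
  · rintro _ ⟨v, hv, rfl⟩
    exact valueFunction_le_cost hD hV hG hLg x ht hv
  · intro c hc
    exact le_valueFunction hV fun v hv => hc ⟨v, hv, rfl⟩

/-- The easy half of the dynamic programming principle. -/
theorem valueFunction_le_add (hD : IsControlData ℓ F C) (hV : IsControlClass T ℓ V)
    (hG : ∀ x y, |G x - G y| ≤ Lg * ‖x - y‖) (hLg : 0 ≤ Lg) (x : E d) {t s : ℝ}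
    (ht : t ∈ Set.Icc 0 T) (hs : s ∈ Set.Icc 0 T) (hts : t ≤ s) {v : ℝ → E d} (hv : v ∈ V) :
    valueFunction V ℓ F G T x t ≤
      runningCost ℓ F x t v s + valueFunction V ℓ F G T (trajectory x t v s) s := by
  have hT : T ∈ Set.Icc 0 T := ⟨ht.1.trans ht.2, le_rfl⟩
  rw [← sub_le_iff_le_add']
  refine le_valueFunction hV fun w hw => ?_
  rw [sub_le_iff_le_add']
  have hg := hV.glue_mem v hv w hw s
  refine (valueFunction_le_cost hD hV hG hLg x ht hg).trans_eq ?_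
  have e1 : ∀ r ∈ Set.Ioc t s, (if r ≤ s then v r else w r) = v r := fun r hr => if_pos hr.2
  have e2 : ∀ r ∈ Set.Ioc s T, (if r ≤ s then v r else w r) = w r :=
    fun r hr => if_neg (not_le.2 hr.1)
  rw [runningCost_add hD hV hg x ht hs hT, ← trajectory_trajectory hV hg x ht hs hT,
    runningCost_congr hts e1, trajectory_congr hts e1, runningCost_congr hs.2 e2,
    trajectory_congr hs.2 e2, add_assoc]

/-- Almost optimal velocities are almost optimal up to any intermediate time. -/
theorem add_le_of_cost_le (hD : IsControlData ℓ F C) (hV : IsControlClass T ℓ V)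
    (hG : ∀ x y, |G x - G y| ≤ Lg * ‖x - y‖) (hLg : 0 ≤ Lg) (x : E d) {t s c : ℝ}
    (ht : t ∈ Set.Icc 0 T) (hs : s ∈ Set.Icc 0 T) {v : ℝ → E d} (hv : v ∈ V)
    (h : runningCost ℓ F x t v T + G (trajectory x t v T) ≤ c) :
    runningCost ℓ F x t v s + valueFunction V ℓ F G T (trajectory x t v s) s ≤ c := by
  have hT : T ∈ Set.Icc 0 T := ⟨ht.1.trans ht.2, le_rfl⟩
  have h1 := valueFunction_le_cost hD hV hG hLg (trajectory x t v s) hs hv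
  rw [trajectory_trajectory hV hv x ht hs hT] at h1
  rw [runningCost_add hD hV hv x ht hs hT] at h
  linarith

/-- Dynamic programming with a constant velocity, the potential being replaced by its upper bound.
-/
theorem valueFunction_isLineSubsolution (hD : IsControlData ℓ F C) (hV : IsControlClass T ℓ V)
    (hG : ∀ x y, |G x - G y| ≤ Lg * ‖x - y‖) (hLg : 0 ≤ Lg) :
    IsLineSubsolution ℓ F 0 T (valueFunction V ℓ F G T) := by
  intro s s' hs hss hs' y z c hc
  have m1 : s ∈ Set.Icc 0 T := ⟨hs, hss.trans hs'⟩
  have m2 : s' ∈ Set.Icc 0 T := ⟨hs.trans hss, hs'⟩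
  have h1 := valueFunction_le_add hD hV hG hLg y m1 m2 hss (hV.const_mem z)
  have h2 : runningCost ℓ F y s (fun _ => z) s' ≤ ∫ _ in s..s', (ℓ z + c) := by
    refine intervalIntegral.integral_mono_on hss
      (intervalIntegrable_running hD hV (hV.const_mem z) y m1 m1 m2) intervalIntegrable_const
      fun r hr => ?_
    rw [trajectory_const]
    linarith [hc r hr]
  rw [intervalIntegral.integral_const, smul_eq_mul] at h2
  rw [trajectory_const] at h1
  linarith

/-- The same velocity is used from both starting points. The trajectories differ by a fixed
translation, so only the Lipschitz constants of `F` and `G` matter. -/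
theorem abs_valueFunction_sub_le (hD : IsControlData ℓ F C) (hV : IsControlClass T ℓ V)
    (hG : ∀ x y, |G x - G y| ≤ Lg * ‖x - y‖) (hLg : 0 ≤ Lg) (x y : E d) {t : ℝ}
    (ht : t ∈ Set.Icc 0 T) :
    |valueFunction V ℓ F G T x t - valueFunction V ℓ F G T y t| ≤ (C * T + Lg) * ‖x - y‖ := by
  have hT : T ∈ Set.Icc 0 T := ⟨ht.1.trans ht.2, le_rfl⟩
  have key : ∀ x y : E d, valueFunction V ℓ F G T x t - (C * T + Lg) * ‖x - y‖ ≤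
      valueFunction V ℓ F G T y t := by
    intro x y
    refine le_valueFunction hV fun v hv => ?_
    have h1 := valueFunction_le_cost hD hV hG hLg x ht hv
    have h2 := runningCost_translate_le hD hV hv x y ht hT ht.2
    have h3 := hG (trajectory x t v T) (trajectory y t v T)
    rw [trajectory_translate y x, add_sub_cancel_left] at h3
    rw [trajectory_translate y x] at h1
    have h4 := (abs_le.1 h3).2
    have h5 : 0 ≤ C * ‖x - y‖ * t := mul_nonneg (mul_nonneg hD.nonneg (norm_nonneg _)) ht.1
    linarith
  rw [abs_le]
  have h1 := key x y
  have h2 := key y x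
  rw [norm_sub_rev] at h2
  constructor <;> linarith

theorem valueFunction_le_add_mul (hD : IsControlData ℓ F C) (hV : IsControlClass T ℓ V)
    (hG : ∀ x y, |G x - G y| ≤ Lg * ‖x - y‖) (hLg : 0 ≤ Lg) (x : E d) {t s : ℝ}
    (ht : t ∈ Set.Icc 0 T) (hs : s ∈ Set.Icc 0 T) (hts : t ≤ s) :
    valueFunction V ℓ F G T x t ≤ valueFunction V ℓ F G T x s + (ℓ 0 + C) * (s - t) := by
  have := valueFunction_isLineSubsolution hD hV hG hLg t s ht.1 hts hs.2 x 0 C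
    fun r _ => (abs_le.1 (hD.bound _ _)).2
  rw [smul_zero, add_zero] at this
  linarith

/-- The slope `C * T + Lg` is the spatial Lipschitz constant of the value function, so whatever is
gained by moving before time `s` is paid for in running cost. -/
theorem valueFunction_sub_mul_le (hD : IsControlData ℓ F C) (hV : IsControlClass T ℓ V)
    (hG : ∀ x y, |G x - G y| ≤ Lg * ‖x - y‖) (hLg : 0 ≤ Lg) {K : ℝ}
    (hK : ∀ z, (C * T + Lg) * ‖z‖ - K ≤ ℓ z) (x : E d) {t s : ℝ}
    (ht : t ∈ Set.Icc 0 T) (hs : s ∈ Set.Icc 0 T) (hts : t ≤ s) :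
    valueFunction V ℓ F G T x s - (K + C) * (s - t) ≤ valueFunction V ℓ F G T x t := by
  have hT0 : 0 ≤ T := ht.1.trans ht.2
  refine le_valueFunction hV fun v hv => ?_
  refine le_trans ?_ (add_le_of_cost_le hD hV hG hLg x ht hs hv le_rfl)
  have h1 := le_runningCost hD hV hv x ht hs hts
    (add_nonneg (mul_nonneg hD.nonneg hT0) hLg) hK
  have h2 := (abs_le.1 (abs_valueFunction_sub_le hD hV hG hLg x (trajectory x t v s) hs)).2
  rw [norm_sub_rev] at h2
  linarith

theorem exists_lipschitz_valueFunction (hD : IsControlData ℓ F C) (hV : IsControlClass T ℓ V)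
    (hG : ∀ x y, |G x - G y| ≤ Lg * ‖x - y‖) (hLg : 0 ≤ Lg) :
    ∃ K : ℝ, 0 ≤ K ∧ ∀ x y : E d, ∀ t ∈ Set.Icc 0 T, ∀ s ∈ Set.Icc 0 T,
      |valueFunction V ℓ F G T x t - valueFunction V ℓ F G T y s| ≤
        K * ‖x - y‖ + K * |t - s| := by
  obtain ⟨K, hK⟩ := hD.superlinear (C * T + Lg)
  let M := max (max (ℓ 0 + C) (K + C)) (max (C * T + Lg) 0)
  have hM1 : ℓ 0 + C ≤ M := (le_max_left _ _).trans (le_max_left _ _)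
  have hM2 : K + C ≤ M := (le_max_right _ _).trans (le_max_left _ _)
  have hM3 : C * T + Lg ≤ M := (le_max_left _ _).trans (le_max_right _ _)
  have key : ∀ x : E d, ∀ t ∈ Set.Icc 0 T, ∀ s ∈ Set.Icc 0 T, t ≤ s →
      |valueFunction V ℓ F G T x t - valueFunction V ℓ F G T x s| ≤ M * |t - s| := by
    intro x t ht s hs hts
    have h1 := valueFunction_le_add_mul hD hV hG hLg x ht hs hts
    have h2 := valueFunction_sub_mul_le hD hV hG hLg hK x ht hs hts
    have h3 := mul_le_mul_of_nonneg_right hM1 (sub_nonneg.2 hts)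
    have h4 := mul_le_mul_of_nonneg_right hM2 (sub_nonneg.2 hts)
    rw [abs_sub_comm t s, abs_of_nonneg (sub_nonneg.2 hts), abs_le]
    constructor <;> linarith
  refine ⟨M, (le_max_right _ _).trans (le_max_right _ _), fun x y t ht s hs => ?_⟩
  have h1 := abs_valueFunction_sub_le hD hV hG hLg x y ht
  have h2 := mul_le_mul_of_nonneg_right hM3 (norm_nonneg (x - y))
  have h3 : |valueFunction V ℓ F G T y t - valueFunction V ℓ F G T y s| ≤ M * |t - s| := by
    rcases le_total t s with h | h
    · exact key y t ht s hs h
    · rw [abs_sub_comm, abs_sub_comm t s]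
      exact key y s hs t ht h
  have h4 := abs_sub_le (valueFunction V ℓ F G T x t) (valueFunction V ℓ F G T y t)
    (valueFunction V ℓ F G T y s)
  linarith

theorem continuousOn_valueFunction (hD : IsControlData ℓ F C) (hV : IsControlClass T ℓ V)
    (hG : ∀ x y, |G x - G y| ≤ Lg * ‖x - y‖) (hLg : 0 ≤ Lg) :
    ContinuousOn (fun z : E d × ℝ => valueFunction V ℓ F G T z.1 z.2)
      (Set.univ ×ˢ Set.Icc 0 T) := by
  obtain ⟨K, hK0, hK⟩ := exists_lipschitz_valueFunction hD hV hG hLg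
  have : LipschitzOnWith (Real.toNNReal (2 * K))
      (fun z : E d × ℝ => valueFunction V ℓ F G T z.1 z.2) (Set.univ ×ˢ Set.Icc 0 T) := by
    refine LipschitzOnWith.of_dist_le_mul fun p hp q hq => ?_
    rw [Real.coe_toNNReal _ (by positivity), Real.dist_eq]
    refine (hK p.1 q.1 p.2 hp.2 q.2 hq.2).trans ?_
    have h1 : ‖p.1 - q.1‖ ≤ dist p q := by
      rw [← dist_eq_norm, Prod.dist_eq]; exact le_max_left _ _
    have h2 : |p.2 - q.2| ≤ dist p q := by
      rw [← Real.dist_eq, Prod.dist_eq]; exact le_max_right _ _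
    nlinarith
  exact this.continuousOn

theorem valueFunction_isViscositySubsolution (hD : IsControlData ℓ F C)
    (hV : IsControlClass T ℓ V) (hG : ∀ x y, |G x - G y| ≤ Lg * ‖x - y‖) (hLg : 0 ≤ Lg) :
    IsViscositySubsolution T (hamiltonian ℓ) F (valueFunction V ℓ F G T) :=
  (valueFunction_isLineSubsolution hD hV hG hLg).isViscositySubsolution hD.continuous_potential

end Control

/-! ### The value function is a viscosity supersolution -/

section Supersolution

variable {d : ℕ} {ℓ : E d → ℝ} {F : E d → ℝ → ℝ} {C T : ℝ} {V : Set (ℝ → E d)}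
  {G : E d → ℝ} {Lg : ℝ}

/-- Almost optimal curves move with bounded average speed. -/
theorem exists_speed_bound (hD : IsControlData ℓ F C) (hV : IsControlClass T ℓ V)
    (hG : ∀ x y, |G x - G y| ≤ Lg * ‖x - y‖) (hLg : 0 ≤ Lg) :
    ∃ K : ℝ, 0 ≤ K ∧ ∀ (x : E d), ∀ t ∈ Set.Icc 0 T, ∀ s ∈ Set.Icc 0 T, t ≤ s → ∀ v ∈ V,
      ∀ η : ℝ, runningCost ℓ F x t v T + G (trajectory x t v T) ≤
        valueFunction V ℓ F G T x t + η →
          ‖trajectory x t v s - x‖ ≤ K * (s - t) + η := by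
  obtain ⟨M, hM0, hM⟩ := exists_lipschitz_valueFunction hD hV hG hLg
  obtain ⟨K, hK⟩ := hD.superlinear (M + 1)
  refine ⟨max (K + C + M) 0, le_max_right _ _, fun x t ht s hs hts v hv η h => ?_⟩
  have h1 := add_le_of_cost_le hD hV hG hLg x ht hs hv h
  have h2 := le_runningCost hD hV hv x ht hs hts (by positivity) hK
  have h3 := (abs_le.1 (hM (trajectory x t v s) x s hs t ht)).1
  rw [abs_of_nonneg (sub_nonneg.2 hts)] at h3
  have h4 := mul_le_mul_of_nonneg_right (le_max_left (K + C + M) 0) (sub_nonneg.2 hts)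
  linarith

/-- No minimiser is needed. An almost optimal velocity on `[t, t + h]` keeps the curve within a
multiple of `h` of `x`, so the test function can be expanded to first order at `(x, t)`. The
pointwise bound on `-D (v, 1) - ℓ v` by the Hamiltonian is then integrated along the velocity. -/
theorem valueFunction_isViscositySupersolution (hD : IsControlData ℓ F C)
    (hV : IsControlClass T ℓ V) (hG : ∀ x y, |G x - G y| ≤ Lg * ‖x - y‖) (hLg : 0 ≤ Lg) :
    IsViscositySupersolution T (hamiltonian ℓ) F (valueFunction V ℓ F G T) := by
  intro φ hφ x t ht hmin
  obtain ⟨K, hK0, hK⟩ := exists_speed_bound hD hV hG hLg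
  obtain ⟨H, hH⟩ : ∃ H, H = -(deriv (fun s => φ x s) t) +
    hamiltonian ℓ (gradient (fun y => φ y t) x) := ⟨_, rfl⟩
  rw [← hH]
  have hd : DifferentiableAt ℝ (fun z : E d × ℝ => φ z.1 z.2) (x, t) :=
    hφ.differentiable one_ne_zero _
  obtain ⟨D, hDdef⟩ : ∃ D, D = fderiv ℝ (fun z : E d × ℝ => φ z.1 z.2) (x, t) := ⟨_, rfl⟩
  have hDH : ∀ z, -(D (z, 1)) - ℓ z ≤ H := fun z => by
    rw [hH, hDdef]; exact le_neg_deriv_add_hamiltonian hD.superlinear hd z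
  have htT : t ∈ Set.Icc 0 T := ⟨ht.1.le, ht.2.le⟩
  refine le_of_forall_pos_le_add fun η hη => ?_
  -- The final error is `e` from `F`, `e * (K + 1)` from the expansion and `h ≤ η / 2` from the lack
  -- of optimality, altogether at most `η`.
  obtain ⟨e, he⟩ : ∃ e, e = η / (2 * (K + 3)) := ⟨_, rfl⟩
  have he0 : 0 < e := by rw [he]; positivity
  have heη : e * (K + 3) = η / 2 := by rw [he]; field_simp
  have hlit := hd.hasFDerivAt.isLittleO.def he0
  have hFc : ∀ᶠ q : E d × ℝ in 𝓝 (x, t), F x t - e < F q.1 q.2 :=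
    (hD.continuous_potential.tendsto (x, t)).eventually (lt_mem_nhds (by simp only; linarith))
  obtain ⟨δ, hδ, hball⟩ := Metric.eventually_nhds_iff.1 ((hmin.and hlit).and hFc)
  -- the time increment
  obtain ⟨h, hh0, hhδ, hh1, hhη, hhT⟩ : ∃ h, 0 < h ∧ (K + 1) * h < δ ∧ h ≤ 1 ∧ h ≤ η / 2 ∧
      t + h ≤ T := by
    refine ⟨min (min (δ / (K + 2)) 1) (min (η / 2) (T - t)), ?_, ?_, ?_, ?_, ?_⟩
    · have := sub_pos.2 ht.2; positivity
    · have h1 : min (min (δ / (K + 2)) 1) (min (η / 2) (T - t)) ≤ δ / (K + 2) :=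
        (min_le_left _ _).trans (min_le_left _ _)
      calc (K + 1) * _ ≤ (K + 1) * (δ / (K + 2)) := by gcongr
        _ < δ := by
          rw [mul_div_assoc', div_lt_iff₀ (by positivity)]; nlinarith
    · exact (min_le_left _ _).trans (min_le_right _ _)
    · exact (min_le_right _ _).trans (min_le_left _ _)
    · have : min (min (δ / (K + 2)) 1) (min (η / 2) (T - t)) ≤ T - t :=
        (min_le_right _ _).trans (min_le_right _ _)
      linarith
  have hsT : t + h ∈ Set.Icc 0 T := ⟨by linarith [ht.1], hhT⟩
  have hts : t ≤ t + h := by linarith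
  -- The tolerance `h ^ 2` is of smaller order than the time increment, so it disappears after
  -- division by `h`.
  obtain ⟨v, hv, hvη⟩ := exists_cost_lt (ℓ := ℓ) (F := F) (G := G) hV x t
    (show 0 < h ^ 2 by positivity)
  have hspeed : ∀ s ∈ Set.Icc t (t + h), ‖trajectory x t v s - x‖ ≤ (K + 1) * h := by
    intro s hs
    have h1 := hK x t htT s ⟨htT.1.trans hs.1, hs.2.trans hhT⟩ hs.1 v hv _ hvη.le
    have h2 := mul_le_mul_of_nonneg_left (show s - t ≤ h by linarith [hs.2]) hK0
    nlinarith
  have hnear : ∀ s ∈ Set.Icc t (t + h), dist (trajectory x t v s, s) (x, t) ≤ (K + 1) * h := by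
    intro s hs
    rw [Prod.dist_eq, max_le_iff]
    refine ⟨by rw [dist_eq_norm]; exact hspeed s hs, ?_⟩
    rw [Real.dist_eq, abs_of_nonneg (sub_nonneg.2 hs.1)]
    nlinarith [hs.2]
  have hmem : t + h ∈ Set.Icc t (t + h) := ⟨hts, le_rfl⟩
  obtain ⟨⟨h1, h2⟩, -⟩ := hball ((hnear _ hmem).trans_lt hhδ)
  simp only at h1 h2
  have h3 := add_le_of_cost_le hD hV hG hLg x htT hsT hv hvη.le
  -- first order expansion
  have h4 : D (trajectory x t v (t + h) - x, h) - e * ((K + 1) * h) ≤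
      φ (trajectory x t v (t + h)) (t + h) - φ x t := by
    rw [← hDdef] at h2
    have e1 : ((trajectory x t v (t + h), t + h) : E d × ℝ) - (x, t) =
        (trajectory x t v (t + h) - x, h) := by simp
    rw [← dist_eq_norm (trajectory x t v (t + h), t + h) (x, t), e1] at h2
    have e2 := (abs_le.1 (h2.trans (mul_le_mul_of_nonneg_left (hnear _ hmem) he0.le))).1
    linarith
  have hvi := hV.intervalIntegrable hv htT hsT
  have hDi : IntervalIntegrable (fun s => D (v s, 1)) volume t (t + h) := by
    have e1 : (fun s => D (v s, 1)) =
        fun s => (D.comp (ContinuousLinearMap.inl ℝ (E d) ℝ)) (v s) + D (0, 1) := by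
      funext s
      simp only [ContinuousLinearMap.comp_apply, ContinuousLinearMap.inl_apply]
      rw [← map_add]; simp
    rw [e1]
    refine IntervalIntegrable.add ?_ intervalIntegrable_const
    exact ⟨ContinuousLinearMap.integrable_comp _ hvi.1, ContinuousLinearMap.integrable_comp _ hvi.2⟩
  have h5 : D (trajectory x t v (t + h) - x, h) = ∫ s in t..(t + h), D (v s, 1) := by
    have e1 : (fun s => D (v s, 1)) =
        fun s => (D.comp (ContinuousLinearMap.inl ℝ (E d) ℝ)) (v s) + D (0, 1) := by
      funext s
      simp only [ContinuousLinearMap.comp_apply, ContinuousLinearMap.inl_apply]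
      rw [← map_add]; simp
    rw [e1, intervalIntegral.integral_add
      ⟨ContinuousLinearMap.integrable_comp _ hvi.1, ContinuousLinearMap.integrable_comp _ hvi.2⟩
      intervalIntegrable_const, ContinuousLinearMap.intervalIntegral_comp_comm _ hvi,
      intervalIntegral.integral_const, add_sub_cancel_left, ← map_smul]
    simp only [ContinuousLinearMap.comp_apply, ContinuousLinearMap.inl_apply]
    rw [← map_add]
    simp [trajectory]
  have h6 : h * (F x t - e - H) ≤
      runningCost ℓ F x t v (t + h) + D (trajectory x t v (t + h) - x, h) := by
    rw [h5]
    unfold runningCost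
    rw [← intervalIntegral.integral_add (intervalIntegrable_running hD hV hv x htT htT hsT) hDi]
    have e1 : h * (F x t - e - H) = ∫ _ in t..(t + h), (F x t - e - H) := by
      rw [intervalIntegral.integral_const, smul_eq_mul, add_sub_cancel_left]
    rw [e1]
    refine intervalIntegral.integral_mono_on hts intervalIntegrable_const
      ((intervalIntegrable_running hD hV hv x htT htT hsT).add hDi) fun s hs => ?_
    have e2 := (hball ((hnear s hs).trans_lt hhδ)).2
    have e3 := hDH (v s)
    simp only at e2
    linarith
  have h7 : h * (F x t - e - H) ≤ h * (h + e * (K + 1)) := by nlinarith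
  have h8 := le_of_mul_le_mul_left h7 hh0
  nlinarith

end Supersolution

/-! ### Uniqueness of continuous viscosity solutions -/

section Uniqueness

variable {d : ℕ} {ℓ : E d → ℝ} {F : E d → ℝ → ℝ} {C T : ℝ} {V : Set (ℝ → E d)}
  {G : E d → ℝ} {Lg : ℝ}

/-- An explicit subsolution along lines which tends to `-∞` at infinity. -/
theorem isLineSubsolution_neg_norm (hbound : ∀ x t, |F x t| ≤ C) {K : ℝ}
    (hK : ∀ z, 1 * ‖z‖ - K ≤ ℓ z) (B a b : ℝ) :
    IsLineSubsolution ℓ F a b fun x t => -‖x‖ - (K + C) * (b - t) - B := by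
  intro s s' hs hss hs' y z c hc
  have h1 := hc s ⟨le_rfl, hss⟩
  have h2 := (abs_le.1 (hbound (y + (s - s) • z) s)).1
  have h3 := norm_add_le y ((s' - s) • z)
  rw [norm_smul, Real.norm_of_nonneg (sub_nonneg.2 hss)] at h3
  have h4 := mul_le_mul_of_nonneg_left (hK z) (sub_nonneg.2 hss)
  have h5 := mul_le_mul_of_nonneg_left (h2.trans h1) (sub_nonneg.2 hss)
  simp only
  linarith

/-- Standing still until the terminal time: the segment with velocity 0. -/
theorem IsLineSubsolution.le_terminal_add (hbound : ∀ x t, |F x t| ≤ C) {S : E d → ℝ → ℝ}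
    {a b : ℝ} (hS : IsLineSubsolution ℓ F a b S) (x : E d) {t : ℝ} (ht : t ∈ Set.Icc a b) :
    S x t ≤ S x b + (b - a) * |ℓ 0 + C| := by
  have h1 := hS t b ht.1 ht.2 le_rfl x 0 C fun r _ => (abs_le.1 (hbound _ _)).2
  rw [smul_zero, add_zero] at h1
  have h2 : (b - t) * (ℓ 0 + C) ≤ (b - a) * |ℓ 0 + C| :=
    (mul_le_mul_of_nonneg_left (le_abs_self _) (sub_nonneg.2 ht.2)).trans
      (mul_le_mul_of_nonneg_right (by linarith [ht.1]) (abs_nonneg _))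
  linarith

/-- Comparison on the whole space, for a supersolution which is bounded below. -/
theorem IsLineSubsolution.le_of_bdd (hD : IsControlData ℓ F C) (hT : 0 < T)
    {S W : E d → ℝ → ℝ}
    (hSc : ContinuousOn (fun z : E d × ℝ => S z.1 z.2) (Set.univ ×ˢ Set.Icc 0 T))
    (hWc : ContinuousOn (fun z : E d × ℝ => W z.1 z.2) (Set.univ ×ˢ Set.Icc 0 T))
    (hS : IsLineSubsolution ℓ F 0 T S)
    (hW : IsViscositySupersolution T (hamiltonian ℓ) F W)
    (hSW : ∀ x, S x T ≤ W x T) {B : ℝ} (hB0 : 0 ≤ B)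
    (hSB : ∀ x, ∀ t ∈ Set.Icc 0 T, S x t ≤ B)
    (hWB : ∀ x, ∀ t ∈ Set.Icc 0 T, -B ≤ W x t) (x : E d) {t : ℝ} (ht : t ∈ Set.Icc 0 T) :
    S x t ≤ W x t := by
  obtain ⟨K', hK'⟩ := hD.superlinear 1
  obtain ⟨K, hK0, hK⟩ : ∃ K : ℝ, 0 ≤ K ∧ ∀ z, 1 * ‖z‖ - K ≤ ℓ z :=
    ⟨max K' 0, le_max_right _ _, fun z => by linarith [hK' z, le_max_left K' 0]⟩
  let b : E d → ℝ → ℝ := fun x t => -‖x‖ - (K + C) * (T - t) - B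
  have hb : ∀ x, ∀ t ∈ Set.Icc 0 T, b x t ≤ -‖x‖ - B := fun x t ht => by
    have := mul_nonneg (add_nonneg hK0 hD.nonneg) (sub_nonneg.2 ht.2)
    simp only [b]; linarith
  have hbc : Continuous fun z : E d × ℝ => b z.1 z.2 := by
    simp only [b]; fun_prop
  -- The weight `θ` on `b` pushes the combination below `-B` on the sphere of radius `max (2 * B /
  -- θ) (‖x‖ + 1)`, so lateral order holds there; afterwards `θ` tends to 0.
  have key : ∀ θ ∈ Set.Ioo (0 : ℝ) 1, (1 - θ) * S x t + θ * b x t ≤ W x t := by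
    intro θ hθ
    have hθ1 : 0 < 1 - θ := sub_pos.2 hθ.2
    have hS' := hS.convexCombination (isLineSubsolution_neg_norm hD.bound hK B 0 T) hθ.1.le hθ.2.le
    have hc' : ContinuousOn (fun z : E d × ℝ => (1 - θ) * S z.1 z.2 + θ * b z.1 z.2)
        (Set.univ ×ˢ Set.Icc 0 T) :=
      (hSc.const_smul (1 - θ)).add (hbc.continuousOn.const_smul θ)
    refine hS'.le_supersolution hD le_rfl hT le_rfl hc' hWc hW (fun y => ?_)
      (R := max (2 * B / θ) (‖x‖ + 1)) (fun y hy s hs => ?_)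
      ((lt_add_one _).trans_le (le_max_right _ _)) ht
    · have hTm : T ∈ Set.Icc 0 T := ⟨hT.le, le_rfl⟩
      have h1 := mul_le_mul_of_nonneg_left (hb y T hTm) hθ.1.le
      have h2 := mul_le_mul_of_nonneg_left (hSW y) hθ1.le
      have h3 := mul_le_mul_of_nonneg_left (hWB y T hTm) hθ.1.le
      have h4 := mul_nonneg hθ.1.le (norm_nonneg y)
      simp only [b] at h1
      linarith
    · have h1 := mul_le_mul_of_nonneg_left (hb y s hs) hθ.1.le
      have h2 := mul_le_mul_of_nonneg_left (hSB y s hs) hθ1.le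
      have h3 := hWB y s hs
      have h4 : 2 * B ≤ θ * ‖y‖ := by
        have : 2 * B / θ ≤ ‖y‖ := hy ▸ le_max_left _ _
        rwa [div_le_iff₀' hθ.1] at this
      have h5 := mul_nonneg hθ.1.le hB0
      simp only [b] at h1
      linarith
  have hlim : Tendsto (fun θ : ℝ => (1 - θ) * S x t + θ * b x t) (𝓝[>] 0) (𝓝 (S x t)) := by
    have : Continuous fun θ : ℝ => (1 - θ) * S x t + θ * b x t := by fun_prop
    have h := (this.tendsto 0).mono_left (nhdsWithin_le_nhds (s := Set.Ioi 0))
    simpa using h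
  refine le_of_tendsto hlim ?_
  filter_upwards [Ioo_mem_nhdsGT one_pos] with θ hθ using key θ hθ

theorem exists_bound_valueFunction (hD : IsControlData ℓ F C) (hV : IsControlClass T ℓ V)
    (hG : ∀ x y, |G x - G y| ≤ Lg * ‖x - y‖) (hLg : 0 ≤ Lg) {B : ℝ} (hGB : ∀ x, |G x| ≤ B) :
    ∃ B' : ℝ, 0 ≤ B' ∧ ∀ x, ∀ t ∈ Set.Icc 0 T, |valueFunction V ℓ F G T x t| ≤ B' := by
  obtain ⟨K, hK0, hK⟩ := exists_lipschitz_valueFunction hD hV hG hLg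
  refine ⟨B + K * |T|, by have := (abs_nonneg _).trans (hGB 0); positivity, fun x t ht => ?_⟩
  have h1 := hK x x t ht T ⟨ht.1.trans ht.2, le_rfl⟩
  rw [sub_self, norm_zero, mul_zero, zero_add, valueFunction_terminal hV] at h1
  have h2 : |t - T| ≤ |T| := by
    rw [abs_sub_comm, abs_of_nonneg (sub_nonneg.2 ht.2), abs_of_nonneg (ht.1.trans ht.2)]
    linarith [ht.1]
  have h3 := mul_le_mul_of_nonneg_left h2 hK0
  have h4 := abs_sub_abs_le_abs_sub (valueFunction V ℓ F G T x t) (G x)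
  linarith [hGB x]

/-- `K r ≤ a r ^ q + λ ρ R ^ q` for `K = λ R ^ (q - 1)` and a constant `ρ`. -/
theorem exists_young_const {a q lam : ℝ} (ha : 0 < a) (hq : 1 < q) (hlam : 0 < lam) :
    ∃ ρ : ℝ, 0 < ρ ∧ ∀ R r : ℝ, 0 < R → 0 ≤ r →
      lam * R ^ (q - 1) * r ≤ a * r ^ q + lam * ρ * R ^ q := by
  have hq1 : 0 < q - 1 := sub_pos.2 hq
  refine ⟨(lam / a) ^ (1 / (q - 1)), by positivity, fun R r hR hr => ?_⟩
  set ρ := (lam / a) ^ (1 / (q - 1)) with hρ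
  have hρ0 : 0 < ρ := by positivity
  have hρq : ρ ^ (q - 1) = lam / a := by
    rw [hρ, ← Real.rpow_mul (by positivity), one_div_mul_cancel hq1.ne', Real.rpow_one]
  have hpow : ∀ s : ℝ, 0 < s → s ^ q = s ^ (q - 1) * s := fun s hs => by
    rw [Real.rpow_sub_one hs.ne']; field_simp
  -- The constant `ρ` marks the threshold: above `ρ * R` the term `a * r ^ q` dominates alone, below
  -- it the linear term is at most its value at `ρ * R`.
  rcases le_total (ρ * R) r with h | h
  · have hr0 : 0 < r := (by positivity : 0 < ρ * R).trans_le h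
    have h1 : (ρ * R) ^ (q - 1) ≤ r ^ (q - 1) :=
      Real.rpow_le_rpow (by positivity) h hq1.le
    rw [Real.mul_rpow hρ0.le hR.le, hρq] at h1
    have h2 : lam * R ^ (q - 1) ≤ a * r ^ (q - 1) := by
      have := mul_le_mul_of_nonneg_left h1 ha.le
      rwa [← mul_assoc, mul_div_cancel₀ _ ha.ne'] at this
    have h3 := mul_le_mul_of_nonneg_right h2 hr0.le
    rw [hpow r hr0]
    have : 0 ≤ lam * ρ * R ^ q := by positivity
    linarith
  · have h1 : lam * R ^ (q - 1) * r ≤ lam * R ^ (q - 1) * (ρ * R) := by gcongr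
    have h2 : 0 ≤ a * r ^ q := by positivity
    rw [hpow R hR]
    linarith

/-- On short time intervals, a function which satisfies the dynamic programming inequality from
below and has `q`-growth dominates the value function. -/
theorem exists_step_valueFunction_le {a q C1 : ℝ} (hq : 1 < q) (ha : 0 < a)
    (hgr : ∀ z, a * ‖z‖ ^ q - C1 ≤ ℓ z) (hC1 : 0 ≤ C1)
    (hD : IsControlData ℓ F C) (hV : IsControlClass T ℓ V)
    (hG : ∀ x y, |G x - G y| ≤ Lg * ‖x - y‖) (hLg : 0 ≤ Lg) {B : ℝ} (hGB : ∀ x, |G x| ≤ B)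
    {w : E d → ℝ → ℝ}
    (hwc : ContinuousOn (fun z : E d × ℝ => w z.1 z.2) (Set.univ ×ˢ Set.Icc 0 T))
    (hw : IsViscositySupersolution T (hamiltonian ℓ) F w) {σ A : ℝ} (hσ : 0 ≤ σ) (hA : 0 ≤ A)
    (hwA : ∀ y, ∀ s ∈ Set.Icc σ T, -(A * (1 + ‖y‖ ^ q)) ≤ w y s) :
    ∃ δ : ℝ, 0 < δ ∧ ∀ t1 ∈ Set.Icc σ T, (∀ x, valueFunction V ℓ F G T x t1 ≤ w x t1) →
      ∀ t ∈ Set.Icc σ t1, t1 - δ ≤ t → ∀ x, valueFunction V ℓ F G T x t ≤ w x t := by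
  obtain ⟨Bu, hBu0, hBu⟩ := exists_bound_valueFunction hD hV hG hLg hGB
  -- The term `2 ^ q * A` matches the growth of `w` on the sphere of radius `2 * R`; the extra 1
  -- leaves a surplus `R ^ q` for the constants.
  obtain ⟨lam, hlam⟩ : ∃ lam, lam = 2 ^ q * A + 1 := ⟨_, rfl⟩
  have hlam1 : 1 ≤ lam := by rw [hlam]; have : 0 ≤ 2 ^ q * A := by positivity
                             linarith
  obtain ⟨ρ, hρ0, hρ⟩ := exists_young_const ha hq (zero_lt_one.trans_le hlam1)
  -- With this `δ`, the Young remainder `lam * ρ * R ^ q`, integrated in time, is at most a quarter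
  -- of `lam * R ^ q`. It does not depend on `R`, on `x` or on `t1`, so the step can be iterated.
  refine ⟨min (1 / (4 * ρ)) 1, by positivity, fun t1 ht1 hend t ht htδ x => ?_⟩
  rcases ht.2.eq_or_lt with rfl | htlt
  · exact hend x
  have hδ1 : t1 - t ≤ 1 := by linarith [min_le_right (1 / (4 * ρ)) 1]
  have hδ0 : 0 ≤ t1 - t := by linarith
  have hδρ : (t1 - t) * ρ ≤ 1 / 4 := by
    have h1 : t1 - t ≤ 1 / (4 * ρ) := by linarith [min_le_left (1 / (4 * ρ)) 1]
    calc (t1 - t) * ρ ≤ 1 / (4 * ρ) * ρ := by gcongr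
      _ = 1 / 4 := by field_simp
  have hC0 := hD.nonneg
  obtain ⟨R, hR1, hRx, hRq⟩ : ∃ R : ℝ, 1 ≤ R ∧ 2 * ‖x‖ ≤ R ∧
      Bu + |ℓ 0 + C| + A + 4 * (2 * Bu + C1 + C) ≤ R ^ q := by
    refine ⟨max (max 1 (2 * ‖x‖)) (Bu + |ℓ 0 + C| + A + 4 * (2 * Bu + C1 + C)),
      (le_max_left _ _).trans (le_max_left _ _), (le_max_right _ _).trans (le_max_left _ _), ?_⟩
    refine (le_max_right _ _).trans (Real.self_le_rpow_of_one_le ?_ hq.le)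
    exact (le_max_left _ _).trans (le_max_left _ _)
  have hR0 : 0 < R := zero_lt_one.trans_le hR1
  have hRpow : R ^ q = R ^ (q - 1) * R := by
    rw [Real.rpow_sub_one hR0.ne']; field_simp
  have habs := abs_nonneg (ℓ 0 + C)
  obtain ⟨K, hKdef⟩ : ∃ K, K = lam * R ^ (q - 1) := ⟨_, rfl⟩
  have hK0 : 0 ≤ K := by rw [hKdef]; positivity
  have hKR : K * R = lam * R ^ q := by rw [hKdef, hRpow]; ring
  have hKℓ : ∀ z, K * ‖z‖ - (C1 + lam * ρ * R ^ q) ≤ ℓ z := fun z => by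
    have h1 := hρ R ‖z‖ hR0 (norm_nonneg z)
    have h2 := hgr z
    rw [← hKdef] at h1
    linarith
  have h1T : t1 ∈ Set.Icc 0 T := ⟨hσ.trans ht1.1, ht1.2⟩
  have ht0 : 0 ≤ t := hσ.trans ht.1
  have htT : t ∈ Set.Icc 0 T := ⟨ht0, ht.2.trans ht1.2⟩
  have htt : t ∈ Set.Icc 0 t1 := ⟨ht0, ht.2⟩
  have h11 : t1 ∈ Set.Icc 0 t1 := ⟨h1T.1, le_rfl⟩
  -- the control problem on `[t, t1]` with a strongly decreasing terminal cost
  let GR : E d → ℝ := fun y => valueFunction V ℓ F G T y t1 - K * max (‖y‖ - R) 0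
  have hV1 := hV.mono ht1.2
  have hGR : ∀ y y', |GR y - GR y'| ≤ (C * T + Lg + K) * ‖y - y'‖ := by
    intro y y'
    have h1 := abs_valueFunction_sub_le hD hV hG hLg y y' h1T
    have h2 : |max (‖y‖ - R) 0 - max (‖y'‖ - R) 0| ≤ ‖y - y'‖ := by
      refine (abs_max_sub_max_le_abs _ _ _).trans ?_
      rw [sub_sub_sub_cancel_right]
      exact abs_norm_sub_norm_le y y'
    have h3 : |K * (max (‖y‖ - R) 0 - max (‖y'‖ - R) 0)| ≤ K * ‖y - y'‖ := by
      rw [abs_mul, abs_of_nonneg hK0]; gcongr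
    have h4 : GR y - GR y' = (valueFunction V ℓ F G T y t1 - valueFunction V ℓ F G T y' t1) -
      K * (max (‖y‖ - R) 0 - max (‖y'‖ - R) 0) := by simp only [GR]; ring
    rw [h4]
    refine (abs_sub _ _).trans ?_
    linarith
  have hLGR : 0 ≤ C * T + Lg + K := by
    have := mul_nonneg hC0 (ht0.trans htT.2); positivity
  have hGRle : ∀ y, GR y ≤ valueFunction V ℓ F G T y t1 := fun y => by
    have := mul_nonneg hK0 (le_max_right (‖y‖ - R) 0)
    simp only [GR]; linarith
  have hsub : Set.univ ×ˢ Set.Icc t t1 ⊆ (Set.univ : Set (E d)) ×ˢ Set.Icc 0 t1 :=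
    Set.prod_mono le_rfl (Set.Icc_subset_Icc_left ht0)
  -- Comparison takes place on the ball of radius `2 * R`. On its boundary the terminal cost has
  -- been lowered by `K * R = lam * R ^ q`, which beats the possible decay of `w`.
  have hle : valueFunction V ℓ F GR t1 x t ≤ w x t := by
    refine ((valueFunction_isLineSubsolution hD hV1 hGR hLGR).mono ht0 le_rfl).le_supersolution hD
      ht0 htlt ht1.2 ((continuousOn_valueFunction hD hV1 hGR hLGR).mono hsub)
      (hwc.mono (hsub.trans (Set.prod_mono le_rfl (Set.Icc_subset_Icc_right ht1.2)))) hw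
      (fun y => ?_) (R := 2 * R) (fun y hy s hs => ?_) (by linarith [norm_nonneg x])
      ⟨le_rfl, ht.2⟩
    · rw [valueFunction_terminal hV1]
      exact (hGRle y).trans (hend y)
    · have h1 := (((valueFunction_isLineSubsolution hD hV1 hGR hLGR).mono ht0
        le_rfl).le_terminal_add hD.bound y hs)
      rw [valueFunction_terminal hV1] at h1
      have h2 := (abs_le.1 (hBu y t1 h1T)).2
      have h3 := hwA y s ⟨ht.1.trans hs.1, hs.2.trans ht1.2⟩
      have h4 : GR y = valueFunction V ℓ F G T y t1 - K * R := by
        simp only [GR]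
        rw [hy, max_eq_left (by linarith)]; ring
      rw [hy, Real.mul_rpow zero_le_two hR0.le] at h3
      have h5 : (t1 - t) * |ℓ 0 + C| ≤ 1 * |ℓ 0 + C| := by gcongr
      have h6 : lam * R ^ q = 2 ^ q * A * R ^ q + R ^ q := by rw [hlam]; ring
      rw [h4, hKR, h6] at h1
      nlinarith
  refine le_trans ?_ hle
  refine le_valueFunction hV1 fun v hv => ?_
  -- It remains to see that lowering the terminal cost outside the ball does not lower the infimum.
  -- An endpoint inside the ball falls under dynamic programming for the original problem. For an
  -- endpoint outside, the travel cost `K * ‖y - x‖` outweighs the reduction `K * (‖y‖ - R)`, since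
  -- `‖x‖ ≤ R / 2` leaves `K * R / 2`.
  set y := trajectory x t v t1 with hy
  rcases le_or_gt ‖y‖ R with hyR | hyR
  · have h1 := valueFunction_le_add hD hV hG hLg x htT h1T ht.2 hv
    simp only [GR]
    rw [max_eq_right (by linarith), mul_zero, sub_zero]
    exact h1
  · have h1 := le_runningCost hD hV1 hv x htt h11 ht.2 hK0 hKℓ
    rw [← hy] at h1
    have h2 : GR y = valueFunction V ℓ F G T y t1 - K * (‖y‖ - R) := by
      simp only [GR]; rw [max_eq_left (by linarith)]
    have h3 := (abs_le.1 (hBu y t1 h1T)).1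
    have h4 := (abs_le.1 (hBu x t htT)).2
    have h5 : K * (‖y‖ - ‖x‖) ≤ K * ‖y - x‖ := by
      have := norm_sub_norm_le y x; gcongr
    have h6 : K * ‖x‖ ≤ K * R / 2 := by nlinarith
    have h7 : lam * R ^ q * ((t1 - t) * ρ) ≤ lam * R ^ q * (1 / 4) := by gcongr
    have h8 : (C1 + C) * (t1 - t) ≤ (C1 + C) * 1 := by gcongr
    have h9 : R ^ q ≤ lam * R ^ q := le_mul_of_one_le_left (by positivity) hlam1
    rw [h2]
    rw [hKR] at h6
    nlinarith

/-- Uniqueness of continuous viscosity solutions, without growth conditions. -/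
theorem eq_valueFunction {a b q C1 : ℝ} (hq : 1 < q) (ha : 0 < a) (hb : 0 ≤ b) (hC1 : 0 ≤ C1)
    (hgr : ∀ z, a * ‖z‖ ^ q - C1 ≤ ℓ z ∧ ℓ z ≤ b * ‖z‖ ^ q + C1)
    (hD : IsControlData ℓ F C) (hV : IsControlClass T ℓ V) (hT : 0 < T)
    (hG : ∀ x y, |G x - G y| ≤ Lg * ‖x - y‖) (hLg : 0 ≤ Lg) {B : ℝ} (hGB : ∀ x, |G x| ≤ B)
    {w : E d → ℝ → ℝ}
    (hwc : ContinuousOn (fun z : E d × ℝ => w z.1 z.2) (Set.univ ×ˢ Set.Icc 0 T))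
    (hw : IsViscositySubsolution T (hamiltonian ℓ) F w)
    (hw' : IsViscositySupersolution T (hamiltonian ℓ) F w) (hwT : ∀ x, w x T = G x)
    (x : E d) {t : ℝ} (ht : t ∈ Set.Icc 0 T) : w x t = valueFunction V ℓ F G T x t := by
  have hline := hw.isLineSubsolution hD hwc
  obtain ⟨Bu, hBu0, hBu⟩ := exists_bound_valueFunction hD hV hG hLg hGB
  have hTm : T ∈ Set.Icc 0 T := ⟨hT.le, le_rfl⟩
  refine le_antisymm ?_ ?_
  · have hB0 : 0 ≤ B := (abs_nonneg _).trans (hGB 0)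
    refine hline.le_of_bdd hD hT hwc (continuousOn_valueFunction hD hV hG hLg)
      (valueFunction_isViscositySupersolution hD hV hG hLg)
      (fun y => by rw [hwT, valueFunction_terminal hV])
      (B := Bu + B + T * |ℓ 0 + C|) (by positivity) (fun y s hs => ?_) (fun y s hs => ?_) x ht
    · have h1 := hline.le_terminal_add hD.bound y hs
      rw [hwT, sub_zero] at h1
      linarith [(abs_le.1 (hGB y)).2]
    · have : 0 ≤ T * |ℓ 0 + C| := by positivity
      linarith [(abs_le.1 (hBu y s hs)).1]
  -- The lower growth bound for `w` degenerates at time 0, so the proof works above a positive time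
  -- `σ` and ends with continuity.
  · have key : ∀ σ ∈ Set.Ioc 0 T, ∀ y, valueFunction V ℓ F G T y σ ≤ w y σ := by
      intro σ hσ y
      obtain ⟨A, hA0, hA⟩ : ∃ A : ℝ, 0 ≤ A ∧ ∀ y, ∀ s ∈ Set.Icc σ T,
          -(A * (1 + ‖y‖ ^ q)) ≤ w y s := by
        refine ⟨|w 0 0| + T * (C1 + C) + T * b * (σ⁻¹) ^ q, ?_, fun y s hs => ?_⟩
        · have := hD.nonneg
          have := hσ.1
          positivity
        have hs0 : 0 < s := hσ.1.trans_le hs.1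
        -- The segment from the origin at time 0 to `y` at time `s` has velocity `s⁻¹ • y`; since `w
        -- 0 0` is a fixed number, the line inequality bounds `w y s` from below by the cost of this
        -- segment.
        have h1 := hline 0 s le_rfl hs0.le hs.2 0 (s⁻¹ • y) C
          fun r _ => (abs_le.1 (hD.bound _ _)).2
        rw [sub_zero, zero_add, smul_inv_smul₀ hs0.ne'] at h1
        have h2 := (hgr (s⁻¹ • y)).2
        have h3 : ‖s⁻¹ • y‖ ^ q ≤ (σ⁻¹) ^ q * ‖y‖ ^ q := by
          rw [norm_smul, norm_inv, Real.norm_of_nonneg hs0.le,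
            Real.mul_rpow (by positivity) (norm_nonneg y)]
          have h4 : s⁻¹ ≤ σ⁻¹ := inv_anti₀ hσ.1 hs.1
          gcongr
        have h5 : s * (ℓ (s⁻¹ • y) + C) ≤ T * (b * ((σ⁻¹) ^ q * ‖y‖ ^ q) + C1 + C) := by
          have h6 : ℓ (s⁻¹ • y) + C ≤ b * ((σ⁻¹) ^ q * ‖y‖ ^ q) + C1 + C := by
            have := mul_le_mul_of_nonneg_left h3 hb
            linarith
          have h7 : 0 ≤ b * ((σ⁻¹) ^ q * ‖y‖ ^ q) + C1 + C := by
            have := hD.nonneg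
            have := hσ.1
            positivity
          calc _ ≤ s * (b * ((σ⁻¹) ^ q * ‖y‖ ^ q) + C1 + C) := by gcongr
            _ ≤ _ := by
              have := hs.2
              gcongr
        have h8 := neg_abs_le (w 0 0)
        have h9 : 0 ≤ ‖y‖ ^ q := by positivity
        have h10 : 0 ≤ (|w 0 0| + T * (C1 + C)) * ‖y‖ ^ q := by
          have := hD.nonneg
          positivity
        have h11 : 0 ≤ T * b * (σ⁻¹) ^ q := by
          have := hσ.1
          positivity
        linarith
      obtain ⟨δ, hδ0, hδ⟩ := exists_step_valueFunction_le hq ha (fun z => (hgr z).1) hC1 hD hV hG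
        hLg hGB hwc hw' hσ.1.le hA0 hA
      -- Backward induction over time slabs of the uniform length `δ`, starting from the terminal
      -- condition.
      have hind : ∀ n : ℕ, ∀ t ∈ Set.Icc σ T, T - n * δ ≤ t →
          ∀ x, valueFunction V ℓ F G T x t ≤ w x t := by
        intro n
        induction n with
        | zero =>
          intro t ht htn x
          have : t = T := le_antisymm ht.2 (by simpa using htn)
          rw [this, valueFunction_terminal hV, hwT]
        | succ n ih =>
          intro t ht htn x
          have h1 : t ≤ min T (t + δ) := le_min ht.2 (by linarith)
          have h2 : min T (t + δ) ∈ Set.Icc σ T := ⟨ht.1.trans h1, min_le_left _ _⟩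
          refine hδ _ h2 (ih _ h2 (le_min ?_ ?_)) t ⟨ht.1, h1⟩ ?_ x
          · have : 0 ≤ (n : ℝ) * δ := by positivity
            linarith
          · push_cast at htn
            linarith
          · linarith [min_le_right T (t + δ)]
      obtain ⟨n, hn⟩ := exists_nat_ge (T / δ)
      refine hind n σ ⟨le_rfl, hσ.2⟩ ?_ y
      rw [div_le_iff₀ hδ0] at hn
      linarith [hσ.1]
    have hcl : closure (Set.Ioc 0 T) = Set.Icc 0 T := closure_Ioc hT.ne
    have hx : ∀ {f : E d → ℝ → ℝ},
        ContinuousOn (fun z : E d × ℝ => f z.1 z.2) (Set.univ ×ˢ Set.Icc 0 T) →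
        ContinuousOn (fun s => f x s) (Set.Icc 0 T) := fun hf =>
      hf.comp (f := fun s : ℝ => (x, s)) (by fun_prop) fun s hs => ⟨trivial, hs⟩
    exact le_on_closure (fun s hs => key s hs x)
      (hcl.symm ▸ hx (continuousOn_valueFunction hD hV hG hLg)) (hcl.symm ▸ hx hwc)
      (hcl.symm ▸ ht)

end Uniqueness

section Classes

variable {d : ℕ} {ℓ : E d → ℝ} {F : E d → ℝ → ℝ} {C T : ℝ}

/-! ### Velocities in `L^q` -/

/-- The velocities of the curves in `W^{1,q}([0,T]; ℝ^d)`. -/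
def sobolevVelocities (d : ℕ) (T q : ℝ) : Set (ℝ → E d) :=
  {v | MemLp v (ENNReal.ofReal q) (volume.restrict (Set.Icc 0 T))}

theorem isControlClass_sobolevVelocities {q : ℝ} (hq : 1 < q) (hℓ : Continuous ℓ) {a b C1 : ℝ}
    (ha : 0 ≤ a) (hb : 0 ≤ b)
    (hgr : ∀ z, a * ‖z‖ ^ q - C1 ≤ ℓ z ∧ ℓ z ≤ b * ‖z‖ ^ q + C1) :
    IsControlClass T ℓ (sobolevVelocities d T q) where
  integrable v hv := by
    have hv : MemLp v (ENNReal.ofReal q) (volume.restrict (Set.Icc 0 T)) := hv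
    exact hv.integrable (ENNReal.one_le_ofReal.2 hq.le)
  integrable_cost v hv := by
    have hv : MemLp v (ENNReal.ofReal q) (volume.restrict (Set.Icc 0 T)) := hv
    have h1 := hv.integrable_norm_rpow (by simpa using zero_lt_one.trans hq) (by simp)
    rw [ENNReal.toReal_ofReal (zero_le_one.trans hq.le)] at h1
    refine Integrable.mono' ((h1.const_mul b).add (integrable_const C1))
      (hℓ.comp_aestronglyMeasurable hv.1) (Eventually.of_forall fun s => ?_)
    have h2 := hgr (v s)
    have h3 : 0 ≤ ‖v s‖ ^ q := by positivity
    have h4 := mul_nonneg ha h3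
    have h5 := mul_nonneg hb h3
    simp only [Pi.add_apply]
    rw [Real.norm_eq_abs, abs_le]
    constructor <;> linarith
  const_mem z := memLp_const z
  glue_mem v hv w hw τ := by
    have hv : MemLp v (ENNReal.ofReal q) (volume.restrict (Set.Icc 0 T)) := hv
    have hw : MemLp w (ENNReal.ofReal q) (volume.restrict (Set.Icc 0 T)) := hw
    exact MemLp.piecewise (s := Set.Iic τ) measurableSet_Iic
      (hv.mono_measure Measure.restrict_le_self) (hw.mono_measure Measure.restrict_le_self)

theorem controlCosts_eq {T q : ℝ} {f g : E d → P1 d → ℝ} {m : ℝ → P1 d} (x : E d) {t : ℝ}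
    (hV : IsControlClass T ℓ (sobolevVelocities d T q)) (ht : t ∈ Set.Icc 0 T) :
    controlCosts T q ℓ f g m x t = {c | ∃ v ∈ sobolevVelocities d T q,
      c = runningCost ℓ (fun x s => f x (m s)) x t v T + g (trajectory x t v T) (m T)} := by
  have h0 : (0 : ℝ) ∈ Set.Icc 0 T := ⟨le_rfl, ht.1.trans ht.2⟩
  have hT : T ∈ Set.Icc 0 T := ⟨ht.1.trans ht.2, le_rfl⟩
  ext c
  constructor
  · rintro ⟨γ, v, ⟨hv, hγ⟩, hγt, rfl⟩
    refine ⟨v, hv, ?_⟩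
    have key : ∀ s ∈ Set.Icc 0 T, γ s = trajectory x t v s := by
      intro s hs
      have h1 := intervalIntegral.integral_add_adjacent_intervals
        (hV.intervalIntegrable hv h0 ht) (hV.intervalIntegrable hv ht hs)
      rw [trajectory, hγ s hs, ← hγt, hγ t ht, ← h1, add_assoc]
    rw [key T hT, runningCost]
    congr 1
    refine intervalIntegral.integral_congr fun s hs => ?_
    rw [key s (Set.uIcc_subset_Icc ht hT hs)]
  · rintro ⟨v, hv, rfl⟩
    refine ⟨trajectory x t v, v, ⟨hv, fun s hs => ?_⟩, trajectory_self _ _ _, rfl⟩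
    have h1 := trajectory_trajectory hV hv x ht h0 hs
    rw [← h1, trajectory]

/-! ### Piecewise constant velocities -/

/-- Piecewise constant velocities. -/
inductive IsPiecewiseConstant {d : ℕ} : (ℝ → E d) → Prop
  | const (z : E d) : IsPiecewiseConstant fun _ => z
  | glue (v w : ℝ → E d) (τ : ℝ) : IsPiecewiseConstant v → IsPiecewiseConstant w →
      IsPiecewiseConstant fun s => if s ≤ τ then v s else w s

theorem isControlClass_piecewiseConstant (T : ℝ) (ℓ : E d → ℝ) :
    IsControlClass T ℓ {v : ℝ → E d | IsPiecewiseConstant v} where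
  integrable v hv := by
    have hv' : IsPiecewiseConstant v := hv
    clear hv
    induction hv' with
    | const z => exact integrable_const z
    | glue v w τ _ _ h1 h2 =>
      exact Integrable.piecewise (s := Set.Iic τ) measurableSet_Iic
        (Integrable.integrableOn h1) (Integrable.integrableOn h2)
  integrable_cost v hv := by
    have hv' : IsPiecewiseConstant v := hv
    clear hv
    induction hv' with
    | const z => exact integrable_const (ℓ z)
    | glue v w τ _ _ h1 h2 =>
      have := Integrable.piecewise (s := Set.Iic τ) measurableSet_Iic
        (Integrable.integrableOn h1) (Integrable.integrableOn h2)
      refine this.congr (Eventually.of_forall fun s => ?_)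
      by_cases hs : s ≤ τ <;> simp [Set.piecewise, hs]
  const_mem z := IsPiecewiseConstant.const z
  glue_mem v hv w hw τ := IsPiecewiseConstant.glue v w τ hv hw

/-- Subdivision turns the bounds by constants into a bound by an integral. -/
theorem IsLineSubsolution.le_runningCost_const (hF : Continuous fun z : E d × ℝ => F z.1 z.2)
    {a b : ℝ} {Z : E d → ℝ → ℝ} (hZ : IsLineSubsolution ℓ F a b Z) (x z : E d) {t t' : ℝ}
    (hat : a ≤ t) (htt : t ≤ t') (htb : t' ≤ b) :
    Z x t ≤ runningCost ℓ F x t (fun _ => z) t' + Z (x + (t' - t) • z) t' := by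
  have hφ : Continuous fun r : ℝ => F (x + (r - t) • z) r :=
    hF.comp (g := fun q : E d × ℝ => F q.1 q.2) (f := fun r : ℝ => (x + (r - t) • z, r))
      (by fun_prop)
  have hcost : ∀ r : ℝ, runningCost ℓ F x t (fun _ => z) r =
      ∫ s in t..r, (ℓ z + F (x + (s - t) • z) s) := fun r => by
    simp only [runningCost, trajectory_const]
  have hint : ∀ r r' : ℝ, IntervalIntegrable (fun s => ℓ z + F (x + (s - t) • z) s) volume r r' :=
    fun r r' => (continuous_const.add hφ).intervalIntegrable _ _
  rw [hcost]
  refine le_of_forall_pos_le_add fun η hη => ?_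
  rcases htt.eq_or_lt with rfl | htlt
  · simp [hη.le]
  obtain ⟨e, he⟩ : ∃ e, e = η / (2 * (t' - t)) := ⟨_, rfl⟩
  have htt0 : 0 < t' - t := sub_pos.2 htlt
  have he0 : 0 < e := by rw [he]; positivity
  have heη : 2 * e * (t' - t) = η := by rw [he]; field_simp
  obtain ⟨δ, hδ, hunif⟩ := Metric.uniformContinuousOn_iff.1
    ((isCompact_Icc (a := t) (b := t')).uniformContinuousOn_of_continuous hφ.continuousOn) e he0
  obtain ⟨N, hN⟩ := exists_nat_gt ((t' - t) / δ)
  have hN0 : (0 : ℝ) < N := (by positivity : 0 < (t' - t) / δ).trans hN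
  obtain ⟨h, hh⟩ : ∃ h, h = (t' - t) / N := ⟨_, rfl⟩
  have hh0 : 0 < h := by rw [hh]; positivity
  have hhN : N * h = t' - t := by rw [hh]; field_simp
  have hhδ : h < δ := by
    rw [hh, div_lt_iff₀ hN0]; rwa [div_lt_iff₀ hδ, mul_comm] at hN
  have key : ∀ i : ℕ, i ≤ N → Z x t ≤ (∫ s in t..(t + i * h), (ℓ z + F (x + (s - t) • z) s)) +
      2 * e * (i * h) + Z (x + (i * h) • z) (t + i * h) := by
    intro i
    induction i with
    | zero => simp
    | succ i ih =>
      intro hi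
      have hi' : ((i : ℝ) + 1) * h ≤ t' - t := by
        rw [← hhN]; gcongr; exact_mod_cast hi
      have hih : 0 ≤ (i : ℝ) * h := by positivity
      have h1 := ih (by omega)
      push_cast
      have hr : ∀ r ∈ Set.Icc (t + i * h) (t + (i + 1) * h),
          |F (x + (r - t) • z) r - F (x + (i * h) • z) (t + i * h)| ≤ e := by
        intro r hr
        have h2 := hunif r ⟨by linarith [hr.1], by linarith [hr.2]⟩ (t + i * h)
          ⟨by linarith, by linarith⟩ (by
            rw [Real.dist_eq, abs_of_nonneg (by linarith [hr.1])]; linarith [hr.2])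
        rw [Real.dist_eq, add_sub_cancel_left] at h2
        exact h2.le
      have h3 := hZ (t + i * h) (t + (i + 1) * h) (by linarith) (by linarith) (by linarith)
        (x + (i * h) • z) z (F (x + (i * h) • z) (t + i * h) + e) (by
          intro r hr'
          have h4 : x + (i * h : ℝ) • z + (r - (t + i * h)) • z = x + (r - t) • z := by module
          rw [h4]
          linarith [(abs_le.1 (hr r hr')).2])
      have h5 : t + (i + 1) * h - (t + i * h) = h := by ring
      have h6 : x + (i * h : ℝ) • z + h • z = x + ((i + 1) * h : ℝ) • z := by module
      rw [h5, h6] at h3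
      have h7 : h * (ℓ z + F (x + (i * h) • z) (t + i * h) - e) ≤
          ∫ s in (t + i * h)..(t + (i + 1) * h), (ℓ z + F (x + (s - t) • z) s) := by
        have h8 : h * (ℓ z + F (x + (i * h) • z) (t + i * h) - e) =
            ∫ _ in (t + i * h)..(t + (i + 1) * h),
              (ℓ z + F (x + (i * h) • z) (t + i * h) - e) := by
          rw [intervalIntegral.integral_const, smul_eq_mul, h5]
        rw [h8]
        refine intervalIntegral.integral_mono_on (by linarith) intervalIntegrable_const
          (hint _ _) fun r hr' => ?_
        linarith [(abs_le.1 (hr r hr')).1]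
      have h9 := intervalIntegral.integral_add_adjacent_intervals (hint t (t + i * h))
        (hint (t + i * h) (t + (i + 1) * h))
      rw [← h9]
      linarith
  have hfin := key N le_rfl
  rw [hhN, heη, add_sub_cancel] at hfin
  linarith

/-- The inequality concatenates, so it passes from constant velocities to glued ones, by splitting
at the gluing time. Hence a line subsolution below the terminal cost is below the value function
over piecewise constant velocities, without any continuity of `Z`. -/
theorem IsLineSubsolution.le_runningCost (hD : IsControlData ℓ F C)
    {Z : E d → ℝ → ℝ} (hZ : IsLineSubsolution ℓ F 0 T Z) {v : ℝ → E d}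
    (hv : IsPiecewiseConstant v) (x : E d) {t t' : ℝ} (ht : 0 ≤ t) (htt : t ≤ t') (htT : t' ≤ T) :
    Z x t ≤ runningCost ℓ F x t v t' + Z (trajectory x t v t') t' := by
  have hV := isControlClass_piecewiseConstant T ℓ
  induction hv generalizing x t t' with
  | const z =>
    rw [trajectory_const]
    exact hZ.le_runningCost_const hD.continuous_potential x z ht htt htT
  | glue v w τ hv hw h1 h2 =>
    have hg := IsPiecewiseConstant.glue v w τ hv hw
    have e1 : ∀ {s s'}, s' ≤ τ → ∀ r ∈ Set.Ioc s s', (if r ≤ τ then v r else w r) = v r :=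
      fun hs r hr => if_pos (hr.2.trans hs)
    have e2 : ∀ {s s'}, τ ≤ s → ∀ r ∈ Set.Ioc s s', (if r ≤ τ then v r else w r) = w r :=
      fun hs r hr => if_neg (not_le.2 (hs.trans_lt hr.1))
    have h1' : ∀ (x : E d) {t t' : ℝ}, 0 ≤ t → t ≤ t' → t' ≤ T → t' ≤ τ →
        Z x t ≤ runningCost ℓ F x t (fun r => if r ≤ τ then v r else w r) t' +
          Z (trajectory x t (fun r => if r ≤ τ then v r else w r) t') t' := by
      intro x t t' ht htt htT hτ
      rw [runningCost_congr htt (e1 hτ), trajectory_congr htt (e1 hτ)]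
      exact h1 x ht htt htT
    have h2' : ∀ (x : E d) {t t' : ℝ}, 0 ≤ t → t ≤ t' → t' ≤ T → τ ≤ t →
        Z x t ≤ runningCost ℓ F x t (fun r => if r ≤ τ then v r else w r) t' +
          Z (trajectory x t (fun r => if r ≤ τ then v r else w r) t') t' := by
      intro x t t' ht htt htT hτ
      rw [runningCost_congr htt (e2 hτ), trajectory_congr htt (e2 hτ)]
      exact h2 x ht htt htT
    rcases le_total t' τ with h | h
    · exact h1' x ht htt htT h
    rcases le_total τ t with h' | h'
    · exact h2' x ht htt htT h'
    have m1 : t ∈ Set.Icc 0 T := ⟨ht, htt.trans htT⟩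
    have m2 : τ ∈ Set.Icc 0 T := ⟨ht.trans h', h.trans htT⟩
    have m3 : t' ∈ Set.Icc 0 T := ⟨ht.trans htt, htT⟩
    have h3 := h1' x ht h' m2.2 le_rfl
    have h4 := h2' (trajectory x t (fun r => if r ≤ τ then v r else w r) τ) m2.1 h htT le_rfl
    rw [trajectory_trajectory hV hg x m1 m2 m3] at h4
    rw [runningCost_add hD hV hg x m1 m2 m3]
    linarith

end Classes

/-! ### The finite game -/

section Discrete

variable {d : ℕ}

theorem norm_le_sqrt_mul {x : E d} {c : ℝ} (hc : 0 ≤ c) (h : ∀ j, |x j| ≤ c) :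
    ‖x‖ ≤ √d * c := by
  rw [EuclideanSpace.norm_eq, ← Real.sqrt_sq hc, ← Real.sqrt_mul (Nat.cast_nonneg d)]
  refine Real.sqrt_le_sqrt ?_
  calc ∑ i, ‖x i‖ ^ 2 ≤ ∑ _i : Fin d, c ^ 2 :=
        Finset.sum_le_sum fun i _ => by
          rw [Real.norm_eq_abs]; exact pow_le_pow_left₀ (abs_nonneg _) (h i) 2
    _ = d * c ^ 2 := by simp

/-! ### Probability vectors and their entropy -/

section Simplex

variable {S : Finset (E d)}

/-- The probability vector concentrated at `y`. -/
noncomputable def diracVector (y : S) : stdSimplex ℝ S := by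
  classical exact ⟨Pi.single y 1, single_mem_stdSimplex ℝ y⟩

theorem sum_diracVector (y : S) (a : S → ℝ) : ∑ z, (diracVector y).1 z * a z = a y := by
  classical
  rw [Finset.sum_eq_single y]
  · simp [diracVector]
  · intro z _ hz
    simp [diracVector, hz]
  · simp

theorem entropy_diracVector (y : S) : entropy (diracVector y) = 0 := by
  classical
  refine Finset.sum_eq_zero fun z _ => ?_
  by_cases hz : z = y
  · subst hz; simp [diracVector]
  · simp [diracVector, hz]

/-- Nonnegativity of the relative entropy with respect to the uniform law: `log r ≤ r - 1` at `r = 1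
/ (|S| p(x))`, weighted by `p(x)` and summed. -/
theorem neg_log_card_le_entropy (p : stdSimplex ℝ S) : -Real.log S.card ≤ entropy p := by
  have hne : S.Nonempty := by
    by_contra h
    rw [Finset.not_nonempty_iff_eq_empty] at h
    subst h
    have := p.2.2
    simp at this
  have hK : (0 : ℝ) < S.card := by exact_mod_cast hne.card_pos
  have key : ∀ x : S, -(p.1 x * Real.log S.card) - 1 / S.card + p.1 x ≤
      p.1 x * Real.log (p.1 x) := by
    intro x
    rcases (p.2.1 x).eq_or_lt with h | h
    · rw [← h]
      have : 0 ≤ 1 / (S.card : ℝ) := by positivity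
      simp
    · have h1 := Real.log_le_sub_one_of_pos (show 0 < 1 / (S.card * p.1 x) by positivity)
      rw [one_div, Real.log_inv, Real.log_mul hK.ne' h.ne'] at h1
      have h2 := mul_le_mul_of_nonneg_left h1 h.le
      have h3 : p.1 x * ((S.card * p.1 x)⁻¹ - 1) = 1 / S.card - p.1 x := by field_simp
      rw [h3] at h2
      linarith
  have h := Finset.sum_le_sum fun x (_ : x ∈ Finset.univ) => key x
  rw [Finset.sum_add_distrib, Finset.sum_sub_distrib, Finset.sum_neg_distrib,
    ← Finset.sum_mul, p.2.2, Finset.sum_const, Finset.card_univ, Fintype.card_coe, nsmul_eq_mul,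
    mul_one_div_cancel hK.ne'] at h
  unfold entropy
  linarith

theorem le_sum_of_forall_le (p : stdSimplex ℝ S) {c : ℝ} {a : S → ℝ} (h : ∀ y, c ≤ a y) :
    c ≤ ∑ y, p.1 y * a y := by
  calc c = ∑ y, p.1 y * c := by rw [← Finset.sum_mul, p.2.2, one_mul]
    _ ≤ _ := Finset.sum_le_sum fun y _ => mul_le_mul_of_nonneg_left (h y) (p.2.1 y)

theorem sum_le_of_forall_le (p : stdSimplex ℝ S) {c : ℝ} {a : S → ℝ} (h : ∀ y, a y ≤ c) :
    ∑ y, p.1 y * a y ≤ c := by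
  calc _ ≤ ∑ y, p.1 y * c :=
        Finset.sum_le_sum fun y _ => mul_le_mul_of_nonneg_left (h y) (p.2.1 y)
    _ = c := by rw [← Finset.sum_mul, p.2.2, one_mul]

end Simplex

theorem card_grid_le (N : ℕ) : (grid d N).card ≤ (2 * N ^ 2 + 1) ^ d := by
  classical
  unfold grid
  refine Finset.card_image_le.trans ?_
  rw [Fintype.card_piFinset]
  simp only [Int.card_Icc, Finset.prod_const, Finset.card_univ, Fintype.card_fin]
  refine Nat.pow_le_pow_left ?_ d
  have : ((N : ℤ) ^ 2 + 1 - -(N : ℤ) ^ 2) = ((2 * N ^ 2 + 1 : ℕ) : ℤ) := by push_cast; ring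
  rw [this, Int.toNat_natCast]

theorem log_card_grid_le {N : ℕ} (hN : 2 ≤ N) :
    Real.log (grid d N).card ≤ 4 * d * Real.log N := by
  have h1 : ((grid d N).card : ℝ) ≤ ((N : ℝ) ^ 4) ^ d := by
    have h2 : 2 * N ^ 2 + 1 ≤ N ^ 4 := by
      have : 4 ≤ N ^ 2 := by nlinarith
      nlinarith
    exact_mod_cast (card_grid_le N).trans (Nat.pow_le_pow_left h2 d)
  rcases Nat.eq_zero_or_pos (grid d N).card with h | h
  · rw [h, Nat.cast_zero, Real.log_zero]
    have := Real.log_natCast_nonneg N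
    positivity
  · calc Real.log (grid d N).card ≤ Real.log (((N : ℝ) ^ 4) ^ d) :=
          Real.log_le_log (by exact_mod_cast h) h1
      _ = 4 * d * Real.log N := by rw [Real.log_pow, Real.log_pow]; push_cast; ring

/-- A telescoping sum in disguise: both `b + X` and `b - X` are antitone. -/
theorem abs_sub_le_of_abs_succ_sub_le {N : ℕ} {X b : Fin (N + 1) → ℝ}
    (h : ∀ k : Fin N, |X k.succ - X k.castSucc| ≤ b k.castSucc - b k.succ) {i j : Fin (N + 1)}
    (hij : i ≤ j) : |X j - X i| ≤ b i - b j := by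
  have h1 : Antitone fun k => b k + X k := Fin.antitone_iff_succ_le.2 fun k => by
    linarith [(abs_le.1 (h k)).2]
  have h2 : Antitone fun k => b k - X k := Fin.antitone_iff_succ_le.2 fun k => by
    linarith [(abs_le.1 (h k)).1]
  have h3 := h1 hij
  have h4 := h2 hij
  simp only at h3 h4
  rw [abs_le]
  constructor <;> linarith

/-! ### A priori estimates for one finite game -/

section Game

variable {T : ℝ} {ℓ : E d → ℝ} {f g : E d → P1 d → ℝ} {m₀ : ProbabilityMeasure (E d)}
  {Ns Nt : ℕ} {ε : ℝ} {U : grid d Ns → Fin (Nt + 1) → ℝ}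
  {M : Fin (Nt + 1) → stdSimplex ℝ (grid d Ns)}
  {P : grid d Ns → Fin Nt → stdSimplex ℝ (grid d Ns)}

theorem timeStep_pos (hT : 0 < T) (hNt : 0 < Nt) : 0 < timeStep T Nt := by
  unfold timeStep; positivity

theorem mul_timeStep (hNt : 0 < Nt) : (Nt : ℝ) * timeStep T Nt = T := by
  unfold timeStep
  have : (Nt : ℝ) ≠ 0 := by exact_mod_cast hNt.ne'
  field_simp

theorem gridTime_castSucc (k : Fin Nt) : gridTime T Nt k.castSucc = (k : ℕ) * timeStep T Nt := by
  simp [gridTime]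

theorem gridTime_succ (k : Fin Nt) :
    gridTime T Nt k.succ = gridTime T Nt k.castSucc + timeStep T Nt := by
  simp [gridTime]; ring

theorem gridTime_last (hNt : 0 < Nt) : gridTime T Nt (Fin.last Nt) = T := by
  simp [gridTime, mul_timeStep hNt]

theorem gridTime_zero : gridTime T Nt 0 = 0 := by simp [gridTime]

theorem gridTime_mono (hT : 0 < T) (hNt : 0 < Nt) : Monotone (gridTime T Nt) := fun i j hij => by
  unfold gridTime
  have := (timeStep_pos hT hNt).le
  have h : ((i : ℕ) : ℝ) ≤ ((j : ℕ) : ℝ) := by exact_mod_cast hij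
  gcongr

theorem gridTime_mem (hT : 0 < T) (hNt : 0 < Nt) (k : Fin (Nt + 1)) :
    gridTime T Nt k ∈ Set.Icc 0 T := by
  constructor
  · rw [← gridTime_zero (T := T) (Nt := Nt)]
    exact gridTime_mono hT hNt (Fin.zero_le k)
  · exact (gridTime_mono hT hNt (Fin.le_last k)).trans_eq (gridTime_last hNt)

/-- A Dirac vector has zero entropy, so testing minimality against it produces no entropy error. -/
theorem IsFiniteMFGSolution.value_le (h : IsFiniteMFGSolution T ℓ f g m₀ Ns Nt ε U M P)
    (x y : grid d Ns) (k : Fin Nt) :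
    U x k.castSucc ≤ timeStep T Nt * ℓ ((timeStep T Nt)⁻¹ • ((y : E d) - (x : E d))) +
      U y k.succ + timeStep T Nt * f x (simplexToP1 (M k.castSucc)) := by
  rw [h.value_eq x k]
  have h1 := h.kernel_isMin x k (diracVector y)
  have h2 : oneStepCost ℓ (timeStep T Nt) ε (fun y => U y k.succ) x (diracVector y) =
      timeStep T Nt * ℓ ((timeStep T Nt)⁻¹ • ((y : E d) - (x : E d))) + U y k.succ := by
    unfold oneStepCost
    rw [entropy_diracVector, sum_diracVector, mul_zero, add_zero]
  linarith

/-- The averaged cost is at least its smallest value, and the entropy costs at most `ε log |S|` in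
each step. -/
theorem IsFiniteMFGSolution.le_value (h : IsFiniteMFGSolution T ℓ f g m₀ Ns Nt ε U M P)
    (hε : 0 ≤ ε) (x : grid d Ns) (k : Fin Nt) {c : ℝ}
    (hc : ∀ y : grid d Ns, c ≤
      timeStep T Nt * ℓ ((timeStep T Nt)⁻¹ • ((y : E d) - (x : E d))) + U y k.succ) :
    c - ε * Real.log (grid d Ns).card + timeStep T Nt * f x (simplexToP1 (M k.castSucc)) ≤
      U x k.castSucc := by
  rw [h.value_eq x k]
  unfold oneStepCost
  have h1 := le_sum_of_forall_le (P x k) hc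
  have h2 := mul_le_mul_of_nonneg_left (neg_log_card_le_entropy (P x k)) hε
  linarith

variable {C K0 : ℝ}

theorem IsFiniteMFGSolution.value_le_bound (h : IsFiniteMFGSolution T ℓ f g m₀ Ns Nt ε U M P)
    (hT : 0 < T) (hNt : 0 < Nt) (hf : ∀ x μ, |f x μ| ≤ C) (hg : ∀ x μ, |g x μ| ≤ C)
    (x : grid d Ns) (k : Fin (Nt + 1)) :
    U x k ≤ C + (T - gridTime T Nt k) * |ℓ 0 + C| := by
  induction k using Fin.reverseInduction generalizing x with
  | last =>
    rw [h.terminal_eq, gridTime_last hNt, sub_self, zero_mul, add_zero]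
    exact (abs_le.1 (hg _ _)).2
  | cast k ih =>
    have h1 := h.value_le x x k
    have h2 := ih x
    rw [sub_self, smul_zero] at h1
    rw [gridTime_succ] at h2
    have hΔ := (timeStep_pos hT hNt).le
    have h3 := mul_le_mul_of_nonneg_left (abs_le.1 (hf x (simplexToP1 (M k.castSucc)))).2 hΔ
    have h4 := mul_le_mul_of_nonneg_left (le_abs_self (ℓ 0 + C)) hΔ
    linarith

theorem IsFiniteMFGSolution.bound_le_value (h : IsFiniteMFGSolution T ℓ f g m₀ Ns Nt ε U M P)
    (hT : 0 < T) (hNt : 0 < Nt) (hε : 0 ≤ ε) (hf : ∀ x μ, |f x μ| ≤ C) (hg : ∀ x μ, |g x μ| ≤ C)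
    (hK : ∀ z, -K0 ≤ ℓ z) (x : grid d Ns) (k : Fin (Nt + 1)) :
    -C - (T - gridTime T Nt k) * (K0 + C) -
      ((Nt : ℝ) - (k : ℕ)) * (ε * Real.log (grid d Ns).card) ≤ U x k := by
  induction k using Fin.reverseInduction generalizing x with
  | last =>
    rw [h.terminal_eq, gridTime_last hNt, sub_self, zero_mul, sub_zero, Fin.val_last, sub_self,
      zero_mul, sub_zero]
    exact (abs_le.1 (hg _ _)).1
  | cast k ih =>
    have hΔ := (timeStep_pos hT hNt).le
    have h1 := h.le_value hε x k (c := -(timeStep T Nt * K0) + (-C -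
      (T - gridTime T Nt k.succ) * (K0 + C) -
      ((Nt : ℝ) - (k.succ : ℕ)) * (ε * Real.log (grid d Ns).card))) fun y => by
        have h2 := mul_le_mul_of_nonneg_left
          (hK ((timeStep T Nt)⁻¹ • ((y : E d) - (x : E d)))) hΔ
        linarith [ih y]
    have h3 := mul_le_mul_of_nonneg_left (abs_le.1 (hf x (simplexToP1 (M k.castSucc)))).1 hΔ
    rw [gridTime_succ, Fin.val_succ] at h1
    push_cast at h1
    rw [Fin.val_castSucc]
    linarith

theorem IsFiniteMFGSolution.abs_value_le (h : IsFiniteMFGSolution T ℓ f g m₀ Ns Nt ε U M P)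
    (hT : 0 < T) (hNt : 0 < Nt) (hε : 0 ≤ ε) (hf : ∀ x μ, |f x μ| ≤ C) (hg : ∀ x μ, |g x μ| ≤ C)
    (hK0 : 0 ≤ K0) (hK : ∀ z, -K0 ≤ ℓ z) (x : grid d Ns) (k : Fin (Nt + 1)) :
    |U x k| ≤ C + T * (|ℓ 0 + C| + K0 + C) + Nt * (ε * Real.log (grid d Ns).card) := by
  have h1 := h.value_le_bound hT hNt hf hg x k
  have h2 := h.bound_le_value hT hNt hε hf hg hK x k
  have hC : 0 ≤ C := (abs_nonneg _).trans (hf 0 (simplexToP1 (M 0)))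
  have hm := gridTime_mem hT hNt k
  have h3 : 0 ≤ ε * Real.log (grid d Ns).card := mul_nonneg hε (Real.log_natCast_nonneg _)
  have h4 : (T - gridTime T Nt k) * |ℓ 0 + C| ≤ T * |ℓ 0 + C| := by
    gcongr; linarith [hm.1]
  have h5 : (T - gridTime T Nt k) * (K0 + C) ≤ T * (K0 + C) := by
    gcongr; linarith [hm.1]
  have h6 : ((Nt : ℝ) - (k : ℕ)) * (ε * Real.log (grid d Ns).card) ≤
      Nt * (ε * Real.log (grid d Ns).card) := by
    gcongr; linarith [Nat.cast_nonneg (α := ℝ) (k : ℕ)]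
  have h7 : 0 ≤ T * |ℓ 0 + C| := by positivity
  have h8 : 0 ≤ T * (K0 + C) := by positivity
  have h9 : 0 ≤ (Nt : ℝ) * (ε * Real.log (grid d Ns).card) := by positivity
  rw [abs_le]
  constructor <;> linarith

theorem IsFiniteMFGSolution.sum_succ (h : IsFiniteMFGSolution T ℓ f g m₀ Ns Nt ε U M P)
    (k : Fin Nt) (ψ : grid d Ns → ℝ) :
    ∑ y, (M k.succ).1 y * ψ y = ∑ x, (M k.castSucc).1 x * ∑ y, (P x k).1 y * ψ y := by
  simp_rw [h.distribution_eq, Finset.sum_mul, Finset.mul_sum]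
  rw [Finset.sum_comm]
  refine Finset.sum_congr rfl fun x _ => Finset.sum_congr rfl fun y _ => by ring

/-- The running cost of the distribution in one step is controlled by the decrease of the average
value. -/
theorem IsFiniteMFGSolution.sum_cost_le (h : IsFiniteMFGSolution T ℓ f g m₀ Ns Nt ε U M P)
    (hT : 0 < T) (hNt : 0 < Nt) (hε : 0 ≤ ε) (hf : ∀ x μ, |f x μ| ≤ C) (k : Fin Nt) :
    ∑ x, (M k.castSucc).1 x * ∑ y, (P x k).1 y *
        (timeStep T Nt * ℓ ((timeStep T Nt)⁻¹ • ((y : E d) - (x : E d)))) ≤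
      (∑ x, (M k.castSucc).1 x * U x k.castSucc) - (∑ x, (M k.succ).1 x * U x k.succ) +
        (ε * Real.log (grid d Ns).card + timeStep T Nt * C) := by
  rw [h.sum_succ]
  have key : ∀ x, (∑ y, (P x k).1 y *
        (timeStep T Nt * ℓ ((timeStep T Nt)⁻¹ • ((y : E d) - (x : E d))))) ≤
      U x k.castSucc - (∑ y, (P x k).1 y * U y k.succ) +
        (ε * Real.log (grid d Ns).card + timeStep T Nt * C) := by
    intro x
    have h1 := h.value_eq x k
    unfold oneStepCost at h1
    simp only [mul_add, Finset.sum_add_distrib] at h1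
    have h2 := mul_le_mul_of_nonneg_left (neg_log_card_le_entropy (P x k)) hε
    have h3 := mul_le_mul_of_nonneg_left
      (abs_le.1 (hf x (simplexToP1 (M k.castSucc)))).1 (timeStep_pos hT hNt).le
    linarith
  have h4 := Finset.sum_le_sum fun x (_ : x ∈ Finset.univ) =>
    mul_le_mul_of_nonneg_left (key x) ((M k.castSucc).2.1 x)
  refine h4.trans_eq ?_
  simp only [mul_add, mul_sub, Finset.sum_add_distrib, Finset.sum_sub_distrib, ← Finset.sum_mul]
  rw [(M k.castSucc).2.2]
  ring

/-- The average displacement in one step. -/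
noncomputable def displacement {Ns Nt : ℕ} (M : Fin (Nt + 1) → stdSimplex ℝ (grid d Ns))
    (P : grid d Ns → Fin Nt → stdSimplex ℝ (grid d Ns)) (k : Fin Nt) : ℝ :=
  ∑ x, (M k.castSucc).1 x * ∑ y, (P x k).1 y * ‖(y : E d) - (x : E d)‖

theorem timeStep_mul_norm_smul (hT : 0 < T) (hNt : 0 < Nt) (z : E d) :
    timeStep T Nt * ‖(timeStep T Nt)⁻¹ • z‖ = ‖z‖ := by
  have := timeStep_pos hT hNt
  rw [norm_smul, norm_inv, Real.norm_of_nonneg this.le, mul_inv_cancel_left₀ this.ne']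

/-- The slope `L` is arbitrary. Since the right side telescopes over the steps, a large `L` makes
the mean displacement small relative to the total variation of the average value. -/
theorem IsFiniteMFGSolution.displacement_le (h : IsFiniteMFGSolution T ℓ f g m₀ Ns Nt ε U M P)
    (hT : 0 < T) (hNt : 0 < Nt) (hε : 0 ≤ ε) (hf : ∀ x μ, |f x μ| ≤ C) {L K : ℝ}
    (hK : ∀ z, L * ‖z‖ - K ≤ ℓ z) (k : Fin Nt) :
    L * displacement M P k ≤
      (∑ x, (M k.castSucc).1 x * U x k.castSucc) - (∑ x, (M k.succ).1 x * U x k.succ) +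
        (ε * Real.log (grid d Ns).card + timeStep T Nt * (C + K)) := by
  have h1 := h.sum_cost_le hT hNt hε hf k
  have h2 : ∀ x : grid d Ns, L * (∑ y, (P x k).1 y * ‖(y : E d) - (x : E d)‖) - timeStep T Nt * K ≤
      ∑ y, (P x k).1 y *
        (timeStep T Nt * ℓ ((timeStep T Nt)⁻¹ • ((y : E d) - (x : E d)))) := by
    intro x
    have h3 : timeStep T Nt * K = ∑ y, (P x k).1 y * (timeStep T Nt * K) := by
      rw [← Finset.sum_mul, (P x k).2.2, one_mul]
    rw [h3, Finset.mul_sum, ← Finset.sum_sub_distrib]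
    refine Finset.sum_le_sum fun y _ => ?_
    have h4 := mul_le_mul_of_nonneg_left
      (hK ((timeStep T Nt)⁻¹ • ((y : E d) - (x : E d)))) (timeStep_pos hT hNt).le
    have h5 := timeStep_mul_norm_smul hT hNt ((y : E d) - (x : E d))
    have h6 : L * ‖(y : E d) - (x : E d)‖ - timeStep T Nt * K ≤
        timeStep T Nt * ℓ ((timeStep T Nt)⁻¹ • ((y : E d) - (x : E d))) := by
      rw [mul_sub, mul_left_comm, h5] at h4; exact h4
    have := mul_le_mul_of_nonneg_left h6 ((P x k).2.1 y)
    linarith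
  have h7 := Finset.sum_le_sum fun x (_ : x ∈ Finset.univ) =>
    mul_le_mul_of_nonneg_left (h2 x) ((M k.castSucc).2.1 x)
  simp only [mul_sub, Finset.sum_sub_distrib, ← Finset.sum_mul, mul_left_comm _ L,
    ← Finset.mul_sum] at h7
  rw [(M k.castSucc).2.2] at h7
  unfold displacement
  linarith

theorem IsFiniteMFGSolution.abs_sum_succ_sub_le
    (h : IsFiniteMFGSolution T ℓ f g m₀ Ns Nt ε U M P) {ψ : E d → ℝ} (hψ : LipschitzWith 1 ψ)
    (k : Fin Nt) :
    |∑ x, (M k.succ).1 x * ψ x - ∑ x, (M k.castSucc).1 x * ψ x| ≤ displacement M P k := by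
  rw [h.sum_succ k fun x => ψ x, ← Finset.sum_sub_distrib]
  refine (Finset.abs_sum_le_sum_abs _ _).trans (Finset.sum_le_sum fun x _ => ?_)
  rw [← mul_sub, abs_mul, abs_of_nonneg ((M k.castSucc).2.1 x)]
  refine mul_le_mul_of_nonneg_left ?_ ((M k.castSucc).2.1 x)
  have h1 : ψ x = ∑ y, (P x k).1 y * ψ x := by rw [← Finset.sum_mul, (P x k).2.2, one_mul]
  rw [h1, ← Finset.sum_sub_distrib]
  refine (Finset.abs_sum_le_sum_abs _ _).trans (Finset.sum_le_sum fun y _ => ?_)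
  rw [← mul_sub, abs_mul, abs_of_nonneg ((P x k).2.1 y)]
  refine mul_le_mul_of_nonneg_left ?_ ((P x k).2.1 y)
  have := hψ.dist_le_mul y x
  rwa [NNReal.coe_one, one_mul, Real.dist_eq, dist_eq_norm] at this

theorem IsFiniteMFGSolution.abs_sum_value_le {B : ℝ} (hB : ∀ x k, |U x k| ≤ B)
    (k : Fin (Nt + 1)) : |∑ x, (M k).1 x * U x k| ≤ B :=
  abs_le.2 ⟨le_sum_of_forall_le _ fun x => (abs_le.1 (hB x k)).1,
    sum_le_of_forall_le _ fun x => (abs_le.1 (hB x k)).2⟩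

/-- Equicontinuity in time of the distributions. -/
theorem IsFiniteMFGSolution.abs_sum_sub_le (h : IsFiniteMFGSolution T ℓ f g m₀ Ns Nt ε U M P)
    (hT : 0 < T) (hNt : 0 < Nt) (hε : 0 ≤ ε) (hf : ∀ x μ, |f x μ| ≤ C) {B : ℝ}
    (hB : ∀ x k, |U x k| ≤ B) {L K : ℝ} (hL : 0 ≤ L) (hK : ∀ z, L * ‖z‖ - K ≤ ℓ z)
    {ψ : E d → ℝ} (hψ : LipschitzWith 1 ψ) {i j : Fin (Nt + 1)} (hij : i ≤ j) :
    L * |∑ x, (M j).1 x * ψ x - ∑ x, (M i).1 x * ψ x| ≤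
      2 * B + Nt * (ε * Real.log (grid d Ns).card) +
        (C + K) * (gridTime T Nt j - gridTime T Nt i) := by
  -- The comparison sequence is the average value, corrected by linear drifts that absorb the
  -- entropy and the bounded terms of each step.
  have h1 := abs_sub_le_of_abs_succ_sub_le (X := fun k => L * ∑ x, (M k).1 x * ψ x)
    (b := fun k => ∑ x, (M k).1 x * U x k - (k : ℕ) * (ε * Real.log (grid d Ns).card) -
      (C + K) * gridTime T Nt k) (fun k => by
      have h2 := h.displacement_le hT hNt hε hf hK k
      have h3 := mul_le_mul_of_nonneg_left (h.abs_sum_succ_sub_le hψ k) hL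
      rw [← mul_sub, abs_mul, abs_of_nonneg hL, gridTime_succ, Fin.val_succ, Fin.val_castSucc]
      push_cast
      linarith) hij
  rw [← mul_sub, abs_mul, abs_of_nonneg hL] at h1
  have h4 := (abs_le.1 (abs_sum_value_le (M := M) hB i)).2
  have h5 := (abs_le.1 (abs_sum_value_le (M := M) hB j)).1
  have h6 : (((j : ℕ) : ℝ) - (i : ℕ)) * (ε * Real.log (grid d Ns).card) ≤
      Nt * (ε * Real.log (grid d Ns).card) := by
    refine mul_le_mul_of_nonneg_right ?_ (mul_nonneg hε (Real.log_natCast_nonneg _))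
    have e1 : ((j : ℕ) : ℝ) ≤ Nt := by exact_mod_cast Nat.lt_succ_iff.1 j.2
    linarith [Nat.cast_nonneg (α := ℝ) (i : ℕ)]
  linarith

theorem IsFiniteMFGSolution.mul_displacement_le
    (h : IsFiniteMFGSolution T ℓ f g m₀ Ns Nt ε U M P)
    (hT : 0 < T) (hNt : 0 < Nt) (hε : 0 ≤ ε) (hf : ∀ x μ, |f x μ| ≤ C) {B : ℝ}
    (hB : ∀ x k, |U x k| ≤ B) {L K : ℝ} (hK : ∀ z, L * ‖z‖ - K ≤ ℓ z) (k : Fin Nt) :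
    L * displacement M P k ≤
      2 * B + Nt * (ε * Real.log (grid d Ns).card) + (C + K) * timeStep T Nt := by
  have h1 := h.displacement_le hT hNt hε hf hK k
  have h4 := (abs_le.1 (abs_sum_value_le (M := M) hB k.castSucc)).2
  have h5 := (abs_le.1 (abs_sum_value_le (M := M) hB k.succ)).1
  have h6 : 1 * (ε * Real.log (grid d Ns).card) ≤ Nt * (ε * Real.log (grid d Ns).card) := by
    refine mul_le_mul_of_nonneg_right ?_ (mul_nonneg hε (Real.log_natCast_nonneg _))
    exact_mod_cast hNt
  linarith

/-- Uniform integrability of the distributions. -/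
theorem IsFiniteMFGSolution.sum_tail_le (h : IsFiniteMFGSolution T ℓ f g m₀ Ns Nt ε U M P)
    (hT : 0 < T) (hNt : 0 < Nt) (hε : 0 ≤ ε) (hf : ∀ x μ, |f x μ| ≤ C) {B : ℝ}
    (hB : ∀ x k, |U x k| ≤ B) (hK0 : 0 ≤ K0) (hKℓ : ∀ z, -K0 ≤ ℓ z) {L K R : ℝ} (hL : 0 ≤ L)
    (hK0' : 0 ≤ K) (hK : ∀ z, L * ‖z‖ - K ≤ ℓ z) (hR : ∀ x, (M 0).1 x ≠ 0 → ‖(x : E d)‖ ≤ R)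
    (k : Fin (Nt + 1)) :
    ∑ x, (M k).1 x * max 0 (L * (‖(x : E d)‖ - R) - K * T) ≤
      2 * B + Nt * (ε * Real.log (grid d Ns).card) + (C + K0) * T := by
  have hΔ := (timeStep_pos hT hNt).le
  -- A cone vanishing on the initial support and lowered at rate `K` in time: the growth `L * ‖y -
  -- x‖` in one step is then paid for by the kinetic cost. Adding `K0` keeps this cost nonnegative,
  -- which handles the truncation at 0.
  let ψ : Fin (Nt + 1) → E d → ℝ := fun k x => max 0 (L * (‖x‖ - R) - K * gridTime T Nt k)
  have hstep : ∀ (k : Fin Nt) (x y : E d), ψ k.succ y ≤ ψ k.castSucc x +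
      (timeStep T Nt * ℓ ((timeStep T Nt)⁻¹ • (y - x)) + timeStep T Nt * K0) := by
    intro k x y
    have h1 := mul_le_mul_of_nonneg_left (hK ((timeStep T Nt)⁻¹ • (y - x))) hΔ
    rw [mul_sub, mul_left_comm, timeStep_mul_norm_smul hT hNt] at h1
    have h2 := mul_le_mul_of_nonneg_left (hKℓ ((timeStep T Nt)⁻¹ • (y - x))) hΔ
    have h3 : L * ‖y‖ ≤ L * ‖x‖ + L * ‖y - x‖ := by
      rw [← mul_add]
      refine mul_le_mul_of_nonneg_left ?_ hL
      have := norm_add_le x (y - x)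
      rwa [add_sub_cancel] at this
    have h4 := le_max_left 0 (L * (‖x‖ - R) - K * gridTime T Nt k.castSucc)
    have h5 := le_max_right 0 (L * (‖x‖ - R) - K * gridTime T Nt k.castSucc)
    have h6 := mul_nonneg hΔ hK0
    refine max_le ?_ ?_
    · linarith
    · rw [gridTime_succ]
      linarith
  -- Adding the average value compensates for the kinetic cost that feeds the cone, so the corrected
  -- sum can only decrease; at time 0 the cone contributes nothing.
  have hanti : Antitone fun k : Fin (Nt + 1) => (∑ x, (M k).1 x * ψ k x) +
      (∑ x, (M k).1 x * U x k - (k : ℕ) * (ε * Real.log (grid d Ns).card) -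
        (C + K0) * gridTime T Nt k) := by
    refine Fin.antitone_iff_succ_le.2 fun k => ?_
    have h1 := h.sum_cost_le hT hNt hε hf k
    have h2 : ∑ x, (M k.succ).1 x * ψ k.succ x ≤ (∑ x, (M k.castSucc).1 x * ψ k.castSucc x) +
        ((∑ x, (M k.castSucc).1 x * ∑ y, (P x k).1 y *
          (timeStep T Nt * ℓ ((timeStep T Nt)⁻¹ • ((y : E d) - (x : E d))))) +
            timeStep T Nt * K0) := by
      rw [h.sum_succ k fun x => ψ k.succ x]
      have h3 : ∀ x : grid d Ns, ∑ y, (P x k).1 y * ψ k.succ y ≤ ψ k.castSucc x +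
          ((∑ y, (P x k).1 y *
            (timeStep T Nt * ℓ ((timeStep T Nt)⁻¹ • ((y : E d) - (x : E d))))) +
              timeStep T Nt * K0) := by
        intro x
        refine (Finset.sum_le_sum fun (y : grid d Ns) _ =>
          mul_le_mul_of_nonneg_left (hstep k x y) ((P x k).2.1 y)).trans_eq ?_
        simp only [mul_add, Finset.sum_add_distrib, ← Finset.sum_mul]
        rw [(P x k).2.2]
        ring
      refine (Finset.sum_le_sum fun x _ =>
        mul_le_mul_of_nonneg_left (h3 x) ((M k.castSucc).2.1 x)).trans_eq ?_
      simp only [mul_add, Finset.sum_add_distrib, ← Finset.sum_mul]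
      rw [(M k.castSucc).2.2]
      ring
    rw [gridTime_succ, Fin.val_succ, Fin.val_castSucc]
    push_cast
    linarith
  have h1 := hanti (Fin.zero_le k)
  have h2 : ∑ x, (M 0).1 x * ψ 0 x = 0 := by
    refine Finset.sum_eq_zero fun x _ => ?_
    by_cases hx : (M 0).1 x = 0
    · rw [hx, zero_mul]
    · have h3 : ψ 0 x = 0 := by
        simp only [ψ]
        rw [gridTime_zero, mul_zero, sub_zero]
        exact max_eq_left (mul_nonpos_of_nonneg_of_nonpos hL (sub_nonpos.2 (hR x hx)))
      rw [h3, mul_zero]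
  simp only [h2, gridTime_zero, Fin.val_zero, Nat.cast_zero] at h1
  have h4 := (abs_le.1 (abs_sum_value_le (M := M) hB 0)).2
  have h5 := (abs_le.1 (abs_sum_value_le (M := M) hB k)).1
  have h6 : ((k : ℕ) : ℝ) * (ε * Real.log (grid d Ns).card) ≤
      Nt * (ε * Real.log (grid d Ns).card) := by
    refine mul_le_mul_of_nonneg_right ?_ (mul_nonneg hε (Real.log_natCast_nonneg _))
    exact_mod_cast Nat.lt_succ_iff.1 k.2
  have hm := gridTime_mem hT hNt k
  have hC : 0 ≤ C := (abs_nonneg _).trans (hf 0 (simplexToP1 (M 0)))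
  have h7 : (C + K0) * gridTime T Nt k ≤ (C + K0) * T := by
    gcongr; exact hm.2
  have h8 : ∑ x, (M k).1 x * max 0 (L * (‖(x : E d)‖ - R) - K * T) ≤
      ∑ x, (M k).1 x * ψ k x := by
    refine Finset.sum_le_sum fun x _ => mul_le_mul_of_nonneg_left ?_ ((M k).2.1 x)
    have := mul_le_mul_of_nonneg_left hm.2 hK0'
    exact max_le_max le_rfl (by linarith)
  linarith

/-- The initial distributions have uniformly bounded supports. -/
theorem IsFiniteMFGSolution.norm_le_of_initial_ne_zero
    (h : IsFiniteMFGSolution T ℓ f g m₀ Ns Nt ε U M P) (hNs : 0 < Ns) {R : ℝ}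
    (hR : ∀ x ∈ (m₀ : Measure (E d)).support, ‖x‖ ≤ R) (x : grid d Ns) (hx : (M 0).1 x ≠ 0) :
    ‖(x : E d)‖ ≤ R + √d := by
  rw [h.initial_eq] at hx
  have h1 : (m₀ : Measure (E d)) (cell Ns (x : E d)) ≠ 0 := fun h0 =>
    hx (by simp [measureReal_def, h0])
  have h2 : (cell Ns (x : E d) ∩ (m₀ : Measure (E d)).support).Nonempty := by
    by_contra hne
    rw [Set.not_nonempty_iff_eq_empty, ← Set.disjoint_iff_inter_eq_empty] at hne
    refine h1 (measure_mono_null (Set.disjoint_left.1 hne) ?_)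
    exact Measure.measure_compl_support
  obtain ⟨x', hx', hx's⟩ := h2
  have h3 : ‖(x : E d) - x'‖ ≤ √d * 1 := by
    refine norm_le_sqrt_mul zero_le_one fun j => ?_
    have h4 : |x' j - (x : E d) j| ≤ 1 / (Ns : ℝ) / 2 := hx' j
    have h5 : (1 : ℝ) ≤ Ns := by exact_mod_cast hNs
    have h6 : 1 / (Ns : ℝ) ≤ 1 := by rw [div_le_one (by linarith)]; exact h5
    rw [PiLp.sub_apply, abs_sub_comm]
    linarith
  have h7 := norm_add_le ((x : E d) - x') x'
  rw [sub_add_cancel] at h7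
  linarith [hR x' hx's]

end Game

end Discrete

/-! ### Convergence for the Kantorovich-Rubinstein distance -/

section Kantorovich

variable {d : ℕ}

instance (μ : P1 d) : IsProbabilityMeasure μ.toMeasure := μ.1.2

/-- The element of `P1 d` with a given underlying measure. -/
def P1.mk (μ : ProbabilityMeasure (E d))
    (h : Integrable (fun x : E d => ‖x‖) (μ : Measure (E d))) : P1 d := ⟨μ, h⟩

theorem P1.integrable_norm (μ : P1 d) : Integrable (fun x : E d => ‖x‖) μ.toMeasure := μ.2

theorem abs_sub_apply_zero_le {ψ : E d → ℝ} (hψ : LipschitzWith 1 ψ) (x : E d) :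
    |ψ x - ψ 0| ≤ ‖x‖ := by
  have := hψ.dist_le_mul x 0
  rwa [NNReal.coe_one, one_mul, Real.dist_eq, dist_zero_right] at this

theorem P1.integrable_of_lipschitz (μ : P1 d) {ψ : E d → ℝ} (hψ : LipschitzWith 1 ψ) :
    Integrable ψ μ.toMeasure := by
  refine Integrable.mono' (μ.integrable_norm.add (integrable_const |ψ 0|))
    hψ.continuous.aestronglyMeasurable (Eventually.of_forall fun x => ?_)
  have h1 := abs_sub_apply_zero_le hψ x
  have h2 := abs_sub_abs_le_abs_sub (ψ x) (ψ 0)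
  simp only [Pi.add_apply, Real.norm_eq_abs]
  linarith

theorem P1.integrable_tail (μ : P1 d) (R : ℝ) :
    Integrable (fun x : E d => max 0 (‖x‖ - R)) μ.toMeasure :=
  (integrable_const 0).sup (μ.integrable_norm.sub (integrable_const R))

/-- Layer-cake formula for the nonnegative function `ψ + R`: as `ψ` is 1-Lipschitz, the
`ε`-thickening of a superlevel set lies in the corresponding superlevel set of `ψ + R + ε`. -/
theorem integral_le_of_levyProkhorov {μ ν : Measure (E d)} [IsProbabilityMeasure μ]
    [IsProbabilityMeasure ν] {ε R : ℝ} (hε : 0 < ε) (hR : 0 ≤ R)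
    (h : levyProkhorovEDist μ ν < ENNReal.ofReal ε) {ψ : E d → ℝ} (hψ : LipschitzWith 1 ψ)
    (hψR : ∀ x, |ψ x| ≤ R) : ∫ x, ψ x ∂μ ≤ ∫ x, ψ x ∂ν + ε * (1 + 2 * R) := by
  let F : BoundedContinuousFunction (E d) ℝ := BoundedContinuousFunction.ofNormedAddCommGroup
    (fun x => ψ x + R) (hψ.continuous.add continuous_const) (2 * R) fun x => by
      have := abs_le.1 (hψR x)
      rw [Real.norm_eq_abs, abs_le]; constructor <;> linarith
  let F' : BoundedContinuousFunction (E d) ℝ := BoundedContinuousFunction.ofNormedAddCommGroup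
    (fun x => ψ x + R + ε) ((hψ.continuous.add continuous_const).add continuous_const)
    (2 * R + ε) fun x => by
      have := abs_le.1 (hψR x)
      rw [Real.norm_eq_abs, abs_le]; constructor <;> linarith
  have hF0 : ∀ x, 0 ≤ F x := fun x => by
    have := (abs_le.1 (hψR x)).1
    change 0 ≤ ψ x + R
    linarith
  have hFn : ‖F‖ ≤ 2 * R := BoundedContinuousFunction.norm_ofNormedAddCommGroup_le _ (by positivity) _
  have hFF' : ‖F‖ ≤ ‖F'‖ := by
    refine (BoundedContinuousFunction.norm_le (norm_nonneg _)).2 fun x => ?_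
    rw [Real.norm_of_nonneg (hF0 x)]
    refine le_trans ?_ (BoundedContinuousFunction.apply_le_norm F' x)
    change ψ x + R ≤ ψ x + R + ε
    linarith
  have hψi : ∀ (ρ : Measure (E d)) [IsProbabilityMeasure ρ], Integrable ψ ρ := fun ρ _ =>
    Integrable.of_bound hψ.continuous.aestronglyMeasurable R (Eventually.of_forall hψR)
  have h1 := BoundedContinuousFunction.integral_le_of_levyProkhorovEDist_lt μ ν hε h F
    (Eventually.of_forall hF0)
  have h2 : ∫ t in Set.Ioc 0 ‖F‖, ν.real (Metric.thickening ε {a | t ≤ F a}) ≤ ∫ x, F' x ∂ν := by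
    rw [BoundedContinuousFunction.integral_eq_integral_meas_le F' ν
      (Eventually.of_forall fun x => ?_)]
    · have hint : ∀ b : ℝ, IntegrableOn (fun t => ν.real {a | t ≤ F' a}) (Set.Ioc 0 b) := fun b => by
        have hanti : Antitone fun t => ν.real {a | t ≤ F' a} := fun s t hst =>
          measureReal_mono fun a ha => hst.trans ha
        exact (hanti.antitoneOn _).integrableOn_isCompact isCompact_Icc |>.mono_set
          Set.Ioc_subset_Icc_self
      have hint' : IntegrableOn (fun t => ν.real (Metric.thickening ε {a | t ≤ F a}))
          (Set.Ioc 0 ‖F‖) := by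
        have hanti : Antitone fun t => ν.real (Metric.thickening ε {a | t ≤ F a}) := fun s t hst =>
          measureReal_mono (Metric.thickening_subset_of_subset _ fun a ha => hst.trans ha)
        exact (hanti.antitoneOn _).integrableOn_isCompact isCompact_Icc |>.mono_set
          Set.Ioc_subset_Icc_self
      refine (setIntegral_mono_on hint' (hint ‖F‖) measurableSet_Ioc fun t _ => ?_).trans
        (setIntegral_mono_set (hint _) (Eventually.of_forall fun t => measureReal_nonneg)
          (Set.Ioc_subset_Ioc_right hFF').eventuallyLE)
      refine measureReal_mono fun a ha => ?_
      obtain ⟨b, hb, hab⟩ := Metric.mem_thickening_iff.1 ha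
      have hb : t ≤ ψ b + R := hb
      change t ≤ ψ a + R + ε
      have h3 := hψ.dist_le_mul b a
      rw [NNReal.coe_one, one_mul, Real.dist_eq, dist_comm] at h3
      linarith [(abs_le.1 h3).2]
    · have := hF0 x
      change 0 ≤ ψ x + R at this
      change 0 ≤ ψ x + R + ε
      linarith
  have h3 : ∫ x, F x ∂μ = ∫ x, ψ x ∂μ + R := by
    change ∫ x, (ψ x + R) ∂μ = _
    rw [integral_add (hψi μ) (integrable_const _)]; simp
  have h4 : ∫ x, F' x ∂ν = ∫ x, ψ x ∂ν + R + ε := by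
    change ∫ x, (ψ x + R + ε) ∂ν = _
    have hi : Integrable (fun x => ψ x + R) ν := (hψi ν).add (integrable_const _)
    rw [integral_add hi (integrable_const _), integral_add (hψi ν) (integrable_const _)]; simp
  have h5 := mul_le_mul_of_nonneg_left hFn hε.le
  linarith

/-- Each 1-Lipschitz function, normalised at the origin, is truncated at height `R`. The truncation
is covered by the Lévy-Prokhorov bound and the remainder by the tails, uniformly in the function. -/
theorem edist_le_of_levyProkhorov {μ ν : P1 d} {ε R η : ℝ} (hε : 0 < ε) (hR : 0 ≤ R)
    (h : levyProkhorovEDist μ.toMeasure ν.toMeasure < ENNReal.ofReal ε)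
    (hμ : ∫ x, max 0 (‖x‖ - R) ∂μ.toMeasure ≤ η) (hν : ∫ x, max 0 (‖x‖ - R) ∂ν.toMeasure ≤ η) :
    edist μ ν ≤ ENNReal.ofReal (ε * (1 + 2 * R) + 2 * η) := by
  refine iSup_le fun ⟨ψ, hψ⟩ => ENNReal.ofReal_le_ofReal ?_
  let χ : E d → ℝ := fun x => max (-R) (min R (ψ x - ψ 0))
  have hψ0 : LipschitzWith 1 fun x => ψ x - ψ 0 := by
    refine LipschitzWith.of_dist_le_mul fun x y => ?_
    simpa using hψ.dist_le_mul x y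
  have hχ : LipschitzWith 1 χ := (hψ0.const_min R).const_max (-R)
  have hχR : ∀ x, |χ x| ≤ R := fun x => abs_le.2
    ⟨le_max_left _ _, max_le (by linarith) (min_le_left _ _)⟩
  have hdiff : ∀ x, |ψ x - ψ 0 - χ x| ≤ max 0 (‖x‖ - R) := by
    intro x
    have h1 := abs_le.1 (abs_sub_apply_zero_le hψ x)
    simp only [χ]
    rw [abs_le]
    rcases le_total R (ψ x - ψ 0) with h2 | h2
    · rw [min_eq_left h2, max_eq_right (show -R ≤ R by linarith)]
      constructor
      · linarith [le_max_left 0 (‖x‖ - R)]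
      · linarith [le_max_right 0 (‖x‖ - R)]
    · rw [min_eq_right h2]
      rcases le_total (-R) (ψ x - ψ 0) with h3 | h3
      · rw [max_eq_right h3, sub_self]
        constructor <;> linarith [le_max_left 0 (‖x‖ - R)]
      · rw [max_eq_left h3]
        constructor
        · linarith [le_max_right 0 (‖x‖ - R)]
        · linarith [le_max_left 0 (‖x‖ - R)]
  have key : ∀ ρ : P1 d, ∫ x, max 0 (‖x‖ - R) ∂ρ.toMeasure ≤ η →
      |∫ x, ψ x ∂ρ.toMeasure - ψ 0 - ∫ x, χ x ∂ρ.toMeasure| ≤ η := by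
    intro ρ hρ
    have h1 : ∫ x, ψ x ∂ρ.toMeasure - ψ 0 - ∫ x, χ x ∂ρ.toMeasure =
        ∫ x, (ψ x - ψ 0 - χ x) ∂ρ.toMeasure := by
      rw [integral_sub (ρ.integrable_of_lipschitz hψ0) (ρ.integrable_of_lipschitz hχ),
        integral_sub (ρ.integrable_of_lipschitz hψ) (integrable_const _)]
      simp
    rw [h1]
    refine le_trans ?_ hρ
    refine (abs_integral_le_integral_abs).trans (integral_mono ?_ (ρ.integrable_tail R) hdiff)
    exact (((ρ.integrable_of_lipschitz hψ).sub (integrable_const _)).sub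
      (ρ.integrable_of_lipschitz hχ)).abs
  have h1 := abs_le.1 (key μ hμ)
  have h2 := abs_le.1 (key ν hν)
  have h3 := integral_le_of_levyProkhorov hε hR h hχ hχR
  rw [levyProkhorovEDist_comm] at h
  have h4 := integral_le_of_levyProkhorov hε hR h hχ hχR
  simp only
  rw [abs_le]
  constructor <;> linarith

/-- The Fatou lemma for narrow convergence. -/
theorem lintegral_le_of_tendsto {μs : ℕ → ProbabilityMeasure (E d)} {μ : ProbabilityMeasure (E d)}
    (h : Tendsto μs atTop (𝓝 μ)) {φ : E d → ℝ} (hφ : Continuous φ) (hφ0 : ∀ x, 0 ≤ φ x)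
    (hi : ∀ n, Integrable φ (μs n : Measure (E d))) {c : ℝ}
    (hc : ∀ n, ∫ x, φ x ∂(μs n : Measure (E d)) ≤ c) :
    ∫⁻ x, ENNReal.ofReal (φ x) ∂(μ : Measure (E d)) ≤ ENNReal.ofReal c := by
  refine (lintegral_le_liminf_lintegral_of_forall_isOpen_measure_le_liminf_measure hφ hφ0
    fun G hG => ProbabilityMeasure.le_liminf_measure_open_of_tendsto h hG).trans ?_
  refine Filter.liminf_le_of_frequently_le' (Frequently.of_forall fun n => ?_)
  rw [← ofReal_integral_eq_lintegral_ofReal (hi n) (Eventually.of_forall hφ0)]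
  exact ENNReal.ofReal_le_ofReal (hc n)

theorem integral_le_of_tendsto {μs : ℕ → ProbabilityMeasure (E d)} {μ : ProbabilityMeasure (E d)}
    (h : Tendsto μs atTop (𝓝 μ)) {φ : E d → ℝ} (hφ : Continuous φ) (hφ0 : ∀ x, 0 ≤ φ x)
    (hi : ∀ n, Integrable φ (μs n : Measure (E d))) {c : ℝ} (hc0 : 0 ≤ c)
    (hc : ∀ n, ∫ x, φ x ∂(μs n : Measure (E d)) ≤ c) :
    Integrable φ (μ : Measure (E d)) ∧ ∫ x, φ x ∂(μ : Measure (E d)) ≤ c := by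
  have h1 := lintegral_le_of_tendsto h hφ hφ0 hi hc
  have h2 : Integrable φ (μ : Measure (E d)) := by
    refine ⟨hφ.aestronglyMeasurable, ?_⟩
    rw [hasFiniteIntegral_iff_ofReal (Eventually.of_forall hφ0)]
    exact h1.trans_lt ENNReal.ofReal_lt_top
  refine ⟨h2, ?_⟩
  rw [← ofReal_integral_eq_lintegral_ofReal h2 (Eventually.of_forall hφ0)] at h1
  exact (ENNReal.ofReal_le_ofReal_iff hc0).1 h1

/-- Narrow convergence and uniform integrability imply convergence for the
Kantorovich-Rubinstein distance. -/
theorem P1.exists_tendsto {ν : ℕ → P1 d} {μ : ProbabilityMeasure (E d)}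
    (h : Tendsto (fun n => (ν n).1) atTop (𝓝 μ))
    (htail : ∀ η > 0, ∃ R, 0 ≤ R ∧ ∀ n, ∫ x, max 0 (‖x‖ - R) ∂(ν n).toMeasure ≤ η) :
    ∃ hμ : Integrable (fun x : E d => ‖x‖) (μ : Measure (E d)),
      Tendsto ν atTop (𝓝 (P1.mk μ hμ)) := by
  have htailμ : ∀ R η, 0 ≤ η → (∀ n, ∫ x, max 0 (‖x‖ - R) ∂(ν n).toMeasure ≤ η) →
      Integrable (fun x : E d => max 0 (‖x‖ - R)) (μ : Measure (E d)) ∧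
      ∫ x, max 0 (‖x‖ - R) ∂(μ : Measure (E d)) ≤ η := fun R η hη hR =>
    integral_le_of_tendsto h (by fun_prop) (fun x => le_max_left _ _)
      (fun n => (ν n).integrable_tail R) hη hR
  have hμ : Integrable (fun x : E d => ‖x‖) (μ : Measure (E d)) := by
    obtain ⟨R, hR0, hR⟩ := htail 1 one_pos
    refine Integrable.mono' ((htailμ R 1 zero_le_one hR).1.add (integrable_const R))
      continuous_norm.aestronglyMeasurable (Eventually.of_forall fun x => ?_)
    simp only [Pi.add_apply, norm_norm]
    linarith [le_max_right 0 (‖x‖ - R)]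
  refine ⟨hμ, ?_⟩
  rw [EMetric.tendsto_nhds]
  intro e he
  obtain ⟨r, hr0, hre⟩ : ∃ r : ℝ, 0 < r ∧ ENNReal.ofReal r < e := by
    rcases eq_or_ne e ⊤ with rfl | he'
    · exact ⟨1, one_pos, ENNReal.ofReal_lt_top⟩
    · refine ⟨e.toReal / 2, half_pos (ENNReal.toReal_pos he.ne' he'), ?_⟩
      rw [ENNReal.ofReal_lt_iff_lt_toReal (by positivity) he']
      exact half_lt_self (ENNReal.toReal_pos he.ne' he')
  obtain ⟨R, hR0, hR⟩ := htail (r / 4) (by positivity)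
  obtain ⟨δ, hδ⟩ : ∃ δ, δ = r / 2 / (1 + 2 * R) := ⟨_, rfl⟩
  have hδ0 : 0 < δ := by rw [hδ]; positivity
  have hδR : δ * (1 + 2 * R) = r / 2 := by rw [hδ]; field_simp
  -- Narrow convergence implies convergence for the Lévy-Prokhorov distance, which gives the
  -- uniformity over all test functions.
  have hLP := (LevyProkhorov.continuous_ofMeasure_probabilityMeasure (Ω := E d)).tendsto μ |>.comp h
  rw [EMetric.tendsto_nhds] at hLP
  filter_upwards [hLP (ENNReal.ofReal δ) (ENNReal.ofReal_pos.2 hδ0)] with n hn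
  refine (edist_le_of_levyProkhorov (ν := P1.mk μ hμ) hδ0 hR0 hn (hR n)
    (htailμ R _ (by positivity) hR).2).trans_lt ?_
  rw [hδR, show r / 2 + 2 * (r / 4) = r by ring]
  exact hre

end Kantorovich

/-! ### The law of the interpolated Markov chain -/

section PathLaw

variable {d : ℕ}

/-- Conditioning on the path up to the last step; marginals of the chain then follow by induction on
its length. -/
theorem sum_pathWeight_succ {S : Finset (E d)} {N : ℕ} (p₀ : stdSimplex ℝ S)
    (P : S → Fin (N + 1) → stdSimplex ℝ S) (φ : (Fin (N + 2) → S) → ℝ) :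
    ∑ ω, pathWeight p₀ P ω * φ ω =
      ∑ ω : Fin (N + 1) → S, pathWeight p₀ (fun x k => P x k.castSucc) ω *
        ∑ y, (P (ω (Fin.last N)) (Fin.last N)).1 y *
          φ (Fin.snoc (α := fun _ => (S : Type)) ω y) := by
  rw [← (Fin.snocEquiv fun _ : Fin (N + 2) => (S : Type)).sum_comp, Fintype.sum_prod_type_right]
  refine Finset.sum_congr rfl fun ω _ => ?_
  rw [Finset.mul_sum]
  refine Finset.sum_congr rfl fun y _ => ?_
  have h0 : (Fin.snoc ω y : Fin (N + 2) → S) 0 = ω 0 :=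
    Fin.snoc_castSucc (α := fun _ => (S : Type)) y ω 0
  simp only [pathWeight, Fin.snocEquiv, Equiv.coe_fn_mk, Fin.prod_univ_castSucc,
    Fin.succ_last, Fin.snoc_last, Fin.snoc_castSucc, Fin.succ_castSucc, h0]
  ring

theorem sum_pathWeight_last {S : Finset (E d)} {N : ℕ} {M : Fin (N + 1) → stdSimplex ℝ S}
    {P : S → Fin N → stdSimplex ℝ S}
    (h : ∀ (y : S) (k : Fin N), (M k.succ).1 y = ∑ x, (P x k).1 y * (M k.castSucc).1 x)
    (φ : S → ℝ) :
    ∑ ω, pathWeight (M 0) P ω * φ (ω (Fin.last N)) = ∑ x, (M (Fin.last N)).1 x * φ x := by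
  induction N generalizing φ with
  | zero =>
    rw [← (Equiv.funUnique (Fin 1) S).symm.sum_comp]
    simp [pathWeight]
  | succ N ih =>
    rw [sum_pathWeight_succ]
    simp only [Fin.snoc_last]
    have h1 := ih (M := fun k => M k.castSucc) (P := fun x k => P x k.castSucc)
      (fun y k => h y k.castSucc)
      (fun x => ∑ y, (P x (Fin.last N)).1 y * φ y)
    simp only [Fin.castSucc_zero] at h1
    rw [h1, ← Fin.succ_last]
    simp_rw [h, Finset.sum_mul, Finset.mul_sum]
    rw [Finset.sum_comm]
    exact Finset.sum_congr rfl fun y _ => Finset.sum_congr rfl fun x _ => by ring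

/-- The joint law of two consecutive values of the Markov chain. -/
theorem sum_pathWeight_pair {S : Finset (E d)} {N : ℕ} {M : Fin (N + 1) → stdSimplex ℝ S}
    {P : S → Fin N → stdSimplex ℝ S}
    (h : ∀ (y : S) (k : Fin N), (M k.succ).1 y = ∑ x, (P x k).1 y * (M k.castSucc).1 x)
    (k : Fin N) (φ : S → S → ℝ) :
    ∑ ω, pathWeight (M 0) P ω * φ (ω k.castSucc) (ω k.succ) =
      ∑ x, (M k.castSucc).1 x * ∑ y, (P x k).1 y * φ x y := by
  induction N with
  | zero => exact k.elim0
  | succ N ih =>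
    rw [sum_pathWeight_succ]
    have h' : ∀ (y : S) (k : Fin N), (M k.castSucc.succ).1 y =
        ∑ x, (P x k.castSucc).1 y * (M k.castSucc.castSucc).1 x := fun y k => h y k.castSucc
    induction k using Fin.lastCases with
    | last =>
      simp only [Fin.succ_last, Fin.snoc_last, Fin.snoc_castSucc]
      have h1 := sum_pathWeight_last (M := fun k => M k.castSucc) (P := fun x k => P x k.castSucc)
        h' (fun x => ∑ y, (P x (Fin.last N)).1 y * φ x y)
      simpa only [Fin.castSucc_zero] using h1
    | cast k =>
      simp only [Fin.succ_castSucc, Fin.snoc_castSucc]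
      have h1 := ih (M := fun k => M k.castSucc) (P := fun x k => P x k.castSucc) h' k
      simp only [Fin.castSucc_zero] at h1
      rw [← h1]
      refine Finset.sum_congr rfl fun ω _ => ?_
      rw [← Finset.sum_mul, (P _ _).2.2, one_mul]

theorem interpolate_apply {T : ℝ} {N : ℕ} (ω : Fin (N + 1) → E d) (k : Fin N)
    (t : Set.Icc (0 : ℝ) T) {θ : ℝ} (hθ0 : 0 ≤ θ) (hθ1 : θ ≤ 1)
    (ht : (t : ℝ) / timeStep T N = (k : ℕ) + θ) :
    interpolate T N ω t = (1 - θ) • ω k.castSucc + θ • ω k.succ := by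
  change ∑ i : Fin (N + 1), max 0 (1 - |(t : ℝ) / timeStep T N - ((i : ℕ) : ℝ)|) • ω i = _
  rw [Fintype.sum_eq_add k.castSucc k.succ k.castSucc_lt_succ.ne]
  · rw [ht, Fin.val_castSucc, Fin.val_succ]
    congr 2
    · rw [add_sub_cancel_left, abs_of_nonneg hθ0, max_eq_right (by linarith)]
    · push_cast
      rw [show ((k : ℕ) : ℝ) + θ - ((k : ℕ) + 1) = θ - 1 by ring, abs_of_nonpos (by linarith),
        max_eq_right (by linarith)]
      ring
  · rintro i ⟨h1, h2⟩
    have h3 : (i : ℕ) ≠ k := fun h => h1 (Fin.ext h)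
    have h4 : (i : ℕ) ≠ k + 1 := fun h => h2 (Fin.ext h)
    have h5 : 1 ≤ |(t : ℝ) / timeStep T N - ((i : ℕ) : ℝ)| := by
      rw [ht, le_abs]
      rcases lt_or_gt_of_ne h3 with h | h
      · left
        have : ((i : ℕ) : ℝ) + 1 ≤ (k : ℕ) := by exact_mod_cast h
        linarith
      · right
        have : ((k : ℕ) : ℝ) + 2 ≤ (i : ℕ) := by exact_mod_cast (show (k : ℕ) + 2 ≤ i by omega)
        linarith
    rw [max_eq_left (by linarith), zero_smul]

theorem norm_interpolate_sub_le {T : ℝ} (hT : 0 < T) {N : ℕ} (hN : 0 < N)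
    (ω : Fin (N + 1) → E d) (k : Fin N) (t : Set.Icc (0 : ℝ) T)
    (h1 : gridTime T N k.castSucc ≤ t) (h2 : t ≤ gridTime T N k.succ) :
    ‖interpolate T N ω t - ω k.castSucc‖ ≤ ‖ω k.succ - ω k.castSucc‖ := by
  have hΔ := timeStep_pos hT hN
  rw [gridTime_succ] at h2
  rw [gridTime_castSucc] at h1 h2
  have hθ0 : 0 ≤ (t : ℝ) / timeStep T N - (k : ℕ) := by
    rw [sub_nonneg, le_div_iff₀ hΔ]; exact h1
  have hθ1 : (t : ℝ) / timeStep T N - (k : ℕ) ≤ 1 := by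
    rw [sub_le_iff_le_add, div_le_iff₀ hΔ]; linarith
  rw [interpolate_apply ω k t hθ0 hθ1 (by ring)]
  set θ := (t : ℝ) / timeStep T N - (k : ℕ)
  rw [show (1 - θ) • ω k.castSucc + θ • ω k.succ - ω k.castSucc =
    θ • (ω k.succ - ω k.castSucc) by module, norm_smul, Real.norm_of_nonneg hθ0]
  exact mul_le_of_le_one_left (norm_nonneg _) hθ1

theorem integral_simplexToP1 {S : Finset (E d)} (p : stdSimplex ℝ S) (ψ : E d → ℝ) :
    ∫ x, ψ x ∂(simplexToP1 p).toMeasure = ∑ x : S, p.1 x * ψ x := by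
  change ∫ x, ψ x ∂(∑ x : S, ENNReal.ofReal (p.1 x) • Measure.dirac (x : E d)) = _
  rw [integral_finsetSum_measure fun x _ => (integrable_dirac (by simp)).smul_measure
    ENNReal.ofReal_ne_top]
  refine Finset.sum_congr rfl fun x _ => ?_
  rw [integral_smul_measure, integral_dirac, ENNReal.toReal_ofReal (p.2.1 x), smul_eq_mul]

theorem integral_pathLaw {S : Finset (E d)} {N : ℕ} (T : ℝ) (p₀ : stdSimplex ℝ S)
    (P : S → Fin N → stdSimplex ℝ S) (Φ : Curve d T → ℝ) :
    ∫ γ, Φ γ ∂(pathLaw T p₀ P : Measure (Curve d T)) =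
      ∑ ω : Fin (N + 1) → S, pathWeight p₀ P ω * Φ (interpolate T N fun k => (ω k : E d)) := by
  change ∫ γ, Φ γ ∂(∑ ω : Fin (N + 1) → S, ENNReal.ofReal (pathWeight p₀ P ω) •
      Measure.dirac (interpolate T N fun k => (ω k : E d))) = _
  rw [integral_finsetSum_measure fun x _ => (integrable_dirac (by simp)).smul_measure
    ENNReal.ofReal_ne_top]
  refine Finset.sum_congr rfl fun ω _ => ?_
  rw [integral_smul_measure, integral_dirac, ENNReal.toReal_ofReal (pathWeight_nonneg p₀ P ω),
    smul_eq_mul]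

/-- The law at time `t` of the interpolated chain is close to the distribution at a neighbouring
grid time. -/
theorem abs_integral_pathLaw_sub_le {T : ℝ} (hT : 0 < T) {Ns Nt : ℕ} (hNt : 0 < Nt)
    {M : Fin (Nt + 1) → stdSimplex ℝ (grid d Ns)}
    {P : grid d Ns → Fin Nt → stdSimplex ℝ (grid d Ns)}
    (h : ∀ (y : grid d Ns) (k : Fin Nt),
      (M k.succ).1 y = ∑ x, (P x k).1 y * (M k.castSucc).1 x)
    {ψ : E d → ℝ} {L : NNReal} (hψ : LipschitzWith L ψ) (k : Fin Nt) (t : Set.Icc (0 : ℝ) T)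
    (h1 : gridTime T Nt k.castSucc ≤ t) (h2 : t ≤ gridTime T Nt k.succ) :
    |∫ γ, ψ (γ t) ∂(pathLaw T (M 0) P : Measure (Curve d T)) -
      ∑ x, (M k.castSucc).1 x * ψ x| ≤ L * displacement M P k := by
  have e1 := sum_pathWeight_pair h k fun x _ => ψ x
  have e2 := sum_pathWeight_pair h k fun x y => L * ‖(y : E d) - (x : E d)‖
  simp only [← Finset.sum_mul, (P _ k).2.2, one_mul] at e1
  have e3 : L * displacement M P k =
      ∑ x, (M k.castSucc).1 x * ∑ y, (P x k).1 y * (L * ‖(y : E d) - (x : E d)‖) := by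
    simp only [displacement, Finset.mul_sum]
    exact Finset.sum_congr rfl fun x _ => Finset.sum_congr rfl fun y _ => by ring
  rw [integral_pathLaw, ← e1, e3, ← e2, ← Finset.sum_sub_distrib]
  refine (Finset.abs_sum_le_sum_abs _ _).trans (Finset.sum_le_sum fun ω _ => ?_)
  rw [← mul_sub, abs_mul, abs_of_nonneg (pathWeight_nonneg _ _ _)]
  refine mul_le_mul_of_nonneg_left ?_ (pathWeight_nonneg _ _ _)
  have e4 := hψ.dist_le_mul (interpolate T Nt (fun k => (ω k : E d)) t) (ω k.castSucc)
  rw [Real.dist_eq, dist_eq_norm] at e4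
  refine e4.trans (mul_le_mul_of_nonneg_left ?_ L.2)
  exact norm_interpolate_sub_le hT hNt (fun k => (ω k : E d)) k t h1 h2

end PathLaw

/-! ### Sequences of finite games -/

/-- A sequence of solutions of finite games whose parameters converge at the required rates, with
uniformly bounded data. -/
structure IsGameSequence {d : ℕ} (T : ℝ) (ℓ : E d → ℝ) (f g : E d → P1 d → ℝ)
    (m₀ : ProbabilityMeasure (E d)) (Ns Nt : ℕ → ℕ) (ε : ℕ → ℝ)
    (U : ∀ n, grid d (Ns n) → Fin (Nt n + 1) → ℝ)
    (M : ∀ n, Fin (Nt n + 1) → stdSimplex ℝ (grid d (Ns n)))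
    (P : ∀ n, grid d (Ns n) → Fin (Nt n) → stdSimplex ℝ (grid d (Ns n))) (C : ℝ) : Prop where
  pos : 0 < T
  space_pos : ∀ n, 0 < Ns n
  time_pos : ∀ n, 0 < Nt n
  eps_nonneg : ∀ n, 0 ≤ ε n
  space_tendsto : Tendsto Ns atTop atTop
  time_tendsto : Tendsto Nt atTop atTop
  ratio_tendsto : Tendsto (fun n => (Nt n : ℝ) / (Ns n : ℝ)) atTop (𝓝 0)
  entropy_tendsto :
    Tendsto (fun n => (Nt n : ℝ) * (ε n * Real.log (grid d (Ns n)).card)) atTop (𝓝 0)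
  solution : ∀ n, IsFiniteMFGSolution T ℓ f g m₀ (Ns n) (Nt n) (ε n) (U n) (M n) (P n)
  superlinear : ∀ L : ℝ, ∃ K : ℝ, ∀ z, L * ‖z‖ - K ≤ ℓ z
  running_bound : ∀ x μ, |f x μ| ≤ C
  terminal_bound : ∀ x μ, |g x μ| ≤ C
  compact_support : IsCompact (m₀ : Measure (E d)).support

section Sequence

variable {d : ℕ} {T : ℝ} {ℓ : E d → ℝ} {f g : E d → P1 d → ℝ}
  {m₀ : ProbabilityMeasure (E d)} {Ns Nt : ℕ → ℕ} {ε : ℕ → ℝ}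
  {U : ∀ n, grid d (Ns n) → Fin (Nt n + 1) → ℝ}
  {M : ∀ n, Fin (Nt n + 1) → stdSimplex ℝ (grid d (Ns n))}
  {P : ∀ n, grid d (Ns n) → Fin (Nt n) → stdSimplex ℝ (grid d (Ns n))} {C : ℝ}

/-- The rate assumed for `ε` is used only here: the number of grid points is polynomial in `Ns`, so
`log |S|` is of order `log Ns`, and the entropy accumulated over all steps vanishes. -/
theorem tendsto_entropy {Ns Nt : ℕ → ℕ} {ε : ℕ → ℝ} (hε : ∀ n, 0 ≤ ε n)
    (hNs : Tendsto Ns atTop atTop)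
    (h : ε =o[atTop] fun n => 1 / ((Nt n : ℝ) * Real.log (Ns n : ℝ))) :
    Tendsto (fun n => (Nt n : ℝ) * (ε n * Real.log (grid d (Ns n)).card)) atTop (𝓝 0) := by
  have h1 := h.tendsto_div_nhds_zero
  simp only [div_div_eq_mul_div, div_one] at h1
  have h2 := h1.const_mul (4 * d : ℝ)
  rw [mul_zero] at h2
  refine tendsto_of_tendsto_of_tendsto_of_le_of_le' tendsto_const_nhds h2 ?_ ?_
  · refine Eventually.of_forall fun n => ?_
    exact mul_nonneg (Nat.cast_nonneg _) (mul_nonneg (hε n) (Real.log_natCast_nonneg _))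
  · filter_upwards [hNs.eventually_ge_atTop 2] with n hn
    have h3 := mul_le_mul_of_nonneg_left (log_card_grid_le (d := d) hn)
      (mul_nonneg (Nat.cast_nonneg (α := ℝ) (Nt n)) (hε n))
    linarith

theorem IsGameSequence.tendsto_timeStep (h : IsGameSequence T ℓ f g m₀ Ns Nt ε U M P C) :
    Tendsto (fun n => timeStep T (Nt n)) atTop (𝓝 0) :=
  (tendsto_natCast_atTop_atTop.comp h.time_tendsto).const_div_atTop T

theorem IsGameSequence.nonneg (h : IsGameSequence T ℓ f g m₀ Ns Nt ε U M P C) : 0 ≤ C :=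
  (abs_nonneg _).trans (h.running_bound 0 (simplexToP1 (M 0 0)))

theorem exists_superlinear_nonneg (h : ∀ L : ℝ, ∃ K : ℝ, ∀ z : E d, L * ‖z‖ - K ≤ ℓ z) (L : ℝ) :
    ∃ K : ℝ, 0 ≤ K ∧ ∀ z, L * ‖z‖ - K ≤ ℓ z := by
  obtain ⟨K, hK⟩ := h L
  exact ⟨max K 0, le_max_right _ _, fun z => by linarith [hK z, le_max_left K 0]⟩

theorem IsGameSequence.exists_entropy_le (h : IsGameSequence T ℓ f g m₀ Ns Nt ε U M P C) :
    ∃ D : ℝ, 0 ≤ D ∧ ∀ n, (Nt n : ℝ) * (ε n * Real.log (grid d (Ns n)).card) ≤ D := by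
  obtain ⟨D, hD⟩ := h.entropy_tendsto.bddAbove_range
  exact ⟨max D 0, le_max_right _ _, fun n => (hD ⟨n, rfl⟩).trans (le_max_left _ _)⟩

theorem IsGameSequence.exists_value_le (h : IsGameSequence T ℓ f g m₀ Ns Nt ε U M P C) :
    ∃ B : ℝ, 0 ≤ B ∧ ∀ n x k, |U n x k| ≤ B := by
  obtain ⟨D, hD0, hD⟩ := h.exists_entropy_le
  obtain ⟨K, hK0, hK⟩ := exists_superlinear_nonneg h.superlinear 0
  have hC := h.nonneg
  have hT := h.pos
  refine ⟨C + T * (|ℓ 0 + C| + K + C) + D, by positivity, fun n x k => ?_⟩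
  have h1 := (h.solution n).abs_value_le h.pos (h.time_pos n) (h.eps_nonneg n) h.running_bound
    h.terminal_bound hK0 (fun z => by simpa using hK z) x k
  linarith [hD n]

/-- Choose the slope `L` so large that the bounded terms divided by `L` are below `η`; the constant
`K` belonging to `L` then fixes the admissible time increment. -/
theorem IsGameSequence.exists_modulus (h : IsGameSequence T ℓ f g m₀ Ns Nt ε U M P C) {η : ℝ}
    (hη : 0 < η) : ∃ δ > 0, ∀ n (i j : Fin (Nt n + 1)),
      |gridTime T (Nt n) j - gridTime T (Nt n) i| ≤ δ →
        edist (simplexToP1 (M n i)) (simplexToP1 (M n j)) ≤ ENNReal.ofReal η := by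
  obtain ⟨D, hD0, hD⟩ := h.exists_entropy_le
  obtain ⟨B, hB0, hB⟩ := h.exists_value_le
  obtain ⟨L, hL⟩ : ∃ L, L = (2 * B + D + 1) / η := ⟨_, rfl⟩
  have hL0 : 0 < L := by rw [hL]; positivity
  have hLη : L * η = 2 * B + D + 1 := by rw [hL]; field_simp
  obtain ⟨K, hK0, hK⟩ := exists_superlinear_nonneg h.superlinear L
  have hC := h.nonneg
  refine ⟨1 / (C + K + 1), by positivity, fun n => ?_⟩
  have key : ∀ i j : Fin (Nt n + 1), i ≤ j →
      |gridTime T (Nt n) j - gridTime T (Nt n) i| ≤ 1 / (C + K + 1) →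
        edist (simplexToP1 (M n i)) (simplexToP1 (M n j)) ≤ ENNReal.ofReal η := by
    intro i j hij hδ
    refine iSup_le fun ⟨ψ, hψ⟩ => ENNReal.ofReal_le_ofReal ?_
    simp only
    rw [integral_simplexToP1, integral_simplexToP1, abs_sub_comm]
    have h1 := (h.solution n).abs_sum_sub_le h.pos (h.time_pos n) (h.eps_nonneg n) h.running_bound
      (hB n) hL0.le hK hψ hij
    have h2 := (le_abs_self _).trans hδ
    have h3 : (C + K) * (gridTime T (Nt n) j - gridTime T (Nt n) i) ≤ 1 := by
      refine (mul_le_mul_of_nonneg_left h2 (by positivity)).trans ?_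
      rw [mul_one_div, div_le_one (by positivity)]
      linarith
    refine le_of_mul_le_mul_left (h1.trans ?_) hL0
    linarith [hD n]
  intro i j hδ
  rcases le_total i j with hij | hij
  · exact key i j hij hδ
  · rw [edist_comm]
    exact key j i hij (by rwa [abs_sub_comm])

theorem IsGameSequence.tendsto_displacement (h : IsGameSequence T ℓ f g m₀ Ns Nt ε U M P C)
    {η : ℝ} (hη : 0 < η) : ∀ᶠ n in atTop, ∀ k, displacement (M n) (P n) k ≤ η := by
  obtain ⟨D, hD0, hD⟩ := h.exists_entropy_le
  obtain ⟨B, hB0, hB⟩ := h.exists_value_le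
  obtain ⟨L, hL⟩ : ∃ L, L = (2 * B + D + 1) / η := ⟨_, rfl⟩
  have hL0 : 0 < L := by rw [hL]; positivity
  have hLη : L * η = 2 * B + D + 1 := by rw [hL]; field_simp
  obtain ⟨K, hK0, hK⟩ := exists_superlinear_nonneg h.superlinear L
  have h1 : Tendsto (fun n => (C + K) * timeStep T (Nt n)) atTop (𝓝 0) := by
    simpa using h.tendsto_timeStep.const_mul (C + K)
  filter_upwards [h1.eventually (gt_mem_nhds one_pos)] with n hn k
  have h2 := (h.solution n).mul_displacement_le h.pos (h.time_pos n) (h.eps_nonneg n)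
    h.running_bound (hB n) hK k
  refine le_of_mul_le_mul_left (h2.trans ?_) hL0
  linarith [hD n]

theorem IsGameSequence.exists_tail_le (h : IsGameSequence T ℓ f g m₀ Ns Nt ε U M P C)
    {η : ℝ} (hη : 0 < η) : ∃ R, 0 ≤ R ∧ ∀ n k,
      ∫ x, max 0 (‖x‖ - R) ∂(simplexToP1 (M n k)).toMeasure ≤ η := by
  obtain ⟨D, hD0, hD⟩ := h.exists_entropy_le
  obtain ⟨B, hB0, hB⟩ := h.exists_value_le
  obtain ⟨K0, hK00, hK0⟩ := exists_superlinear_nonneg h.superlinear 0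
  have hC := h.nonneg
  have hT := h.pos
  obtain ⟨L, hL⟩ : ∃ L, L = (2 * B + D + (C + K0) * T + 1) / η := ⟨_, rfl⟩
  have hL0 : 0 < L := by rw [hL]; positivity
  have hLη : L * η = 2 * B + D + (C + K0) * T + 1 := by rw [hL]; field_simp
  obtain ⟨K, hKp, hK⟩ := exists_superlinear_nonneg h.superlinear L
  obtain ⟨R0, hR0⟩ := h.compact_support.isBounded.exists_norm_le
  -- The cone in the tail estimate has slope `L` and is lowered by `K * T` in all, so it vanishes up
  -- to `K * T / L` beyond the initial support; `√d` accounts for the projection to the grid.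
  refine ⟨max R0 0 + √d + K * T / L, by positivity, fun n k => ?_⟩
  rw [integral_simplexToP1]
  have h1 := (h.solution n).sum_tail_le h.pos (h.time_pos n) (h.eps_nonneg n) h.running_bound
    (hB n) hK00 (fun z => by simpa using hK0 z) hL0.le hKp hK
    ((h.solution n).norm_le_of_initial_ne_zero (h.space_pos n) (R := max R0 0)
      fun x hx => (hR0 x hx).trans (le_max_left _ _)) k
  refine le_of_mul_le_mul_left (le_trans ?_ (h1.trans ?_)) hL0
  · rw [Finset.mul_sum]
    refine le_of_eq (Finset.sum_congr rfl fun x _ => ?_)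
    rw [mul_left_comm, mul_max_of_nonneg _ _ hL0.le, mul_zero]
    congr 2
    field_simp
    ring
  · linarith [hD n]

theorem exists_grid_cell (hT : 0 < T) {N : ℕ} (hN : 0 < N) {t : ℝ} (ht : t ∈ Set.Icc 0 T) :
    ∃ k : Fin N, gridTime T N k.castSucc ≤ t ∧ t ≤ gridTime T N k.succ := by
  have hΔ := timeStep_pos hT hN
  have hNT := mul_timeStep (T := T) hN
  rcases ht.2.eq_or_lt with rfl | hlt
  · refine ⟨⟨N - 1, by omega⟩, (gridTime_mem hT hN _).2, ?_⟩
    have : (⟨N - 1, by omega⟩ : Fin N).succ = Fin.last N := Fin.ext (by simp; omega)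
    rw [this, gridTime_last hN]
  · have h1 : ⌊t / timeStep T N⌋₊ < N := by
      rw [Nat.floor_lt (div_nonneg ht.1 hΔ.le), div_lt_iff₀ hΔ, hNT]
      exact hlt
    refine ⟨⟨_, h1⟩, ?_, ?_⟩
    · rw [gridTime_castSucc]
      exact (le_div_iff₀ hΔ).1 (Nat.floor_le (div_nonneg ht.1 hΔ.le))
    · rw [gridTime_succ, gridTime_castSucc]
      have := (div_le_iff₀ hΔ).1 (Nat.lt_floor_add_one (t / timeStep T N)).le
      simp only
      linarith

/-- The limit flow of measures. -/
theorem IsGameSequence.exists_limit_flow (h : IsGameSequence T ℓ f g m₀ Ns Nt ε U M P C)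
    {ξ : ProbabilityMeasure (Curve d T)}
    (hξ : Tendsto (fun n => pathLaw T (M n 0) (P n)) atTop (𝓝 ξ)) :
    ∃ m : ℝ → P1 d, Continuous m ∧
      (∀ t : Set.Icc (0 : ℝ) T, (m t).toMeasure =
        (ξ : Measure (Curve d T)).map fun γ : Curve d T => γ t) ∧
      ∀ r > 0, ∀ᶠ n in atTop, ∀ k, edist (simplexToP1 (M n k)) (m (gridTime T (Nt n) k)) ≤
        ENNReal.ofReal r := by
  have hT := h.pos
  have hΔ0 := fun n => (timeStep_pos hT (h.time_pos n)).le
  have hcell : ∀ (t : Set.Icc (0 : ℝ) T) (n : ℕ), ∃ k : Fin (Nt n),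
      gridTime T (Nt n) k.castSucc ≤ t ∧ t ≤ gridTime T (Nt n) k.succ := fun t n =>
    exists_grid_cell hT (h.time_pos n) t.2
  choose idx hidx1 hidx2 using hcell
  have hidx : ∀ (t : Set.Icc (0 : ℝ) T) (n : ℕ),
      |(t : ℝ) - gridTime T (Nt n) (idx t n).castSucc| ≤ timeStep T (Nt n) := by
    intro t n
    have h1 := hidx1 t n
    have h2 := hidx2 t n
    rw [gridTime_succ] at h2
    rw [abs_of_nonneg (by linarith)]
    linarith
  let ν : Set.Icc (0 : ℝ) T → ℕ → P1 d := fun t n => simplexToP1 (M n (idx t n).castSucc)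
  have hev : ∀ t : Set.Icc (0 : ℝ) T, Continuous fun γ : Curve d T => γ t :=
    fun t => continuous_eval_const t
  -- convergence at a fixed time
  have hlim : ∀ t : Set.Icc (0 : ℝ) T, ∃ μ : P1 d, Tendsto (ν t) atTop (𝓝 μ) ∧
      μ.toMeasure = (ξ : Measure (Curve d T)).map fun γ : Curve d T => γ t := by
    intro t
    -- Bounded Lipschitz test functions suffice for narrow convergence, and for them evaluation at
    -- `t` differs from evaluation at the grid time by at most the mean displacement of one step.
    have hnar : Tendsto (fun n => (ν t n).1) atTop
        (𝓝 (ξ.map (hev t).measurable.aemeasurable)) := by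
      rw [tendsto_iff_forall_lipschitz_integral_tendsto]
      rintro ψ ⟨b, hb⟩ ⟨L, hψ⟩
      let Φ : BoundedContinuousFunction (Curve d T) ℝ :=
        BoundedContinuousFunction.mkOfBound ⟨fun γ => ψ (γ t), hψ.continuous.comp (hev t)⟩ b
          fun γ γ' => hb _ _
      have h1 := (ProbabilityMeasure.tendsto_iff_forall_integral_tendsto.1 hξ) Φ
      have h2 : ∫ x, ψ x ∂(ξ.map (hev t).measurable.aemeasurable : Measure (E d)) =
          ∫ γ, Φ γ ∂(ξ : Measure (Curve d T)) := by
        rw [ProbabilityMeasure.toMeasure_map,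
          integral_map (hev t).measurable.aemeasurable hψ.continuous.aestronglyMeasurable]
        rfl
      rw [h2]
      have h3 : Tendsto (fun n => ∫ x, ψ x ∂(ν t n).toMeasure -
          ∫ γ, Φ γ ∂(pathLaw T (M n 0) (P n) : Measure (Curve d T))) atTop (𝓝 0) := by
        rw [Metric.tendsto_nhds]
        intro e he
        filter_upwards [h.tendsto_displacement (show 0 < e / (L + 1) / 2 by positivity)] with n hn
        rw [dist_zero_right, Real.norm_eq_abs, integral_simplexToP1, abs_sub_comm]
        refine (abs_integral_pathLaw_sub_le hT (h.time_pos n) (h.solution n).distribution_eq hψ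
          (idx t n) t (hidx1 t n) (hidx2 t n)).trans_lt ?_
        calc (L : ℝ) * displacement (M n) (P n) (idx t n) ≤ L * (e / (L + 1) / 2) :=
              mul_le_mul_of_nonneg_left (hn _) L.2
          _ ≤ (L + 1) * (e / (L + 1) / 2) := by gcongr; linarith
          _ = e / 2 := by field_simp
          _ < e := half_lt_self he
      have h4 := h3.add h1
      have h5 : Tendsto (fun n => ∫ x, ψ x ∂(ν t n).toMeasure) atTop
          (𝓝 (∫ γ, Φ γ ∂(ξ : Measure (Curve d T)))) := by simpa using h4
      exact h5
    obtain ⟨hμ, hlim⟩ := P1.exists_tendsto hnar fun η hη => by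
      obtain ⟨R, hR0, hR⟩ := h.exists_tail_le hη
      exact ⟨R, hR0, fun n => hR n _⟩
    exact ⟨_, hlim, rfl⟩
  choose m hm hmξ using hlim
  -- equicontinuity passes to the limit
  have hmod : ∀ η > 0, ∃ δ > 0, ∀ s t : Set.Icc (0 : ℝ) T, |(t : ℝ) - s| ≤ δ →
      edist (m s) (m t) ≤ ENNReal.ofReal η := by
    intro η hη
    obtain ⟨δ, hδ0, hδ⟩ := h.exists_modulus hη
    refine ⟨δ / 2, by positivity, fun s t hst => ?_⟩
    refine le_of_tendsto ((hm s).edist (hm t)) ?_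
    filter_upwards [h.tendsto_timeStep.eventually (gt_mem_nhds (show 0 < δ / 4 by positivity))]
      with n hn
    refine hδ n _ _ ?_
    have h1 := abs_le.1 (hidx s n)
    have h2 := abs_le.1 (hidx t n)
    have h3 := abs_le.1 hst
    rw [abs_le]
    constructor <;> linarith
  -- The flow is extended by constants outside `[0, T]`, which makes it continuous on the whole
  -- line.
  refine ⟨fun t => m (Set.projIcc 0 T hT.le t), ?_, fun t => ?_, fun r hr => ?_⟩
  · refine Continuous.comp ?_ continuous_projIcc
    rw [continuous_iff_continuousAt]
    intro t
    rw [ContinuousAt, EMetric.tendsto_nhds]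
    intro e he
    obtain ⟨r, hr0, hre⟩ := ENNReal.lt_iff_exists_nnreal_btwn.1 he
    obtain ⟨δ, hδ0, hδ⟩ := hmod r (by exact_mod_cast hr0)
    filter_upwards [Metric.ball_mem_nhds t hδ0] with s hs
    refine (hδ s t ?_).trans_lt (by simpa using hre)
    rw [Metric.mem_ball, dist_comm] at hs
    exact hs.le
  · simp only [Set.projIcc_val]
    exact hmξ t
  · obtain ⟨δ1, hδ10, hδ1⟩ := h.exists_modulus (show 0 < r / 3 by positivity)
    obtain ⟨δ2, hδ20, hδ2⟩ := hmod (r / 3) (by positivity)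
    obtain ⟨δ, hδ⟩ : ∃ δ, δ = min δ1 δ2 / 2 := ⟨_, rfl⟩
    have hδ0 : 0 < δ := by rw [hδ]; positivity
    -- Pointwise convergence on a finite net of times, together with the moduli of `M n` and of the
    -- limit, gives uniform convergence.
    obtain ⟨s, -, hsfin, hs⟩ := (isCompact_univ (X := Set.Icc (0 : ℝ) T)).finite_cover_balls hδ0
    have hall : ∀ᶠ n in atTop, ∀ t ∈ s, edist (ν t n) (m t) ≤ ENNReal.ofReal (r / 3) := by
      rw [Filter.eventually_all_finite hsfin]
      intro t _
      have := (EMetric.tendsto_nhds.1 (hm t)) (ENNReal.ofReal (r / 3))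
        (ENNReal.ofReal_pos.2 (by positivity))
      filter_upwards [this] with n hn using hn.le
    filter_upwards [hall, h.tendsto_timeStep.eventually (gt_mem_nhds hδ0)] with n hn hΔ k
    have hk := gridTime_mem hT (h.time_pos n) k
    rw [Set.projIcc_of_mem hT.le hk]
    obtain ⟨t, hts, htk⟩ := Set.mem_iUnion₂.1 (hs (Set.mem_univ ⟨_, hk⟩))
    have htk : |gridTime T (Nt n) k - t| < δ := htk
    have hm1 : δ ≤ δ1 / 2 := by rw [hδ]; linarith [min_le_left δ1 δ2]
    have hm2 : δ ≤ δ2 / 2 := by rw [hδ]; linarith [min_le_right δ1 δ2]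
    have htk' := abs_lt.1 htk
    have h1 := abs_le.1 (hidx t n)
    have e1 : edist (simplexToP1 (M n k)) (ν t n) ≤ ENNReal.ofReal (r / 3) := by
      refine hδ1 n _ _ (abs_le.2 ⟨?_, ?_⟩) <;> linarith
    have e2 : edist (m t) (m ⟨gridTime T (Nt n) k, hk⟩) ≤ ENNReal.ofReal (r / 3) := by
      refine hδ2 _ _ (abs_le.2 ⟨?_, ?_⟩) <;> simp only <;> linarith
    calc _ ≤ edist (simplexToP1 (M n k)) (ν t n) + edist (ν t n) (m t) +
          edist (m t) (m ⟨gridTime T (Nt n) k, hk⟩) := edist_triangle4 _ _ _ _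
      _ ≤ ENNReal.ofReal (r / 3) + ENNReal.ofReal (r / 3) + ENNReal.ofReal (r / 3) := by
        gcongr
        exact hn t hts
      _ = ENNReal.ofReal r := by
        rw [← ENNReal.ofReal_add (by positivity) (by positivity),
          ← ENNReal.ofReal_add (by positivity) (by positivity)]
        congr 1; ring

end Sequence

/-! ### Regularity of the data along a flow of measures -/

section Coupling

variable {d : ℕ} {T q C : ℝ} {ℓ : E d → ℝ} {h : E d → P1 d → ℝ} {m : ℝ → P1 d}

theorem IsKineticCost.superlinear (hℓ : IsKineticCost q ℓ) (hq : 1 < q) (L : ℝ) :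
    ∃ K : ℝ, ∀ z, L * ‖z‖ - K ≤ ℓ z := by
  obtain ⟨a, b, C, ha, hb, hC, hgr⟩ := hℓ.growth
  have h1 : Tendsto (fun r : ℝ => r ^ (q - 1)) atTop atTop := tendsto_rpow_atTop (by linarith)
  obtain ⟨ρ, hρ⟩ := eventually_atTop.1 (h1.eventually_ge_atTop (|L| / a))
  refine ⟨C + |L| * max ρ 1, fun z => ?_⟩
  refine le_trans ?_ (hgr z).1
  have h2 : L * ‖z‖ ≤ |L| * ‖z‖ := mul_le_mul_of_nonneg_right (le_abs_self L) (norm_nonneg z)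
  have h3 : |L| * ‖z‖ ≤ a * ‖z‖ ^ q + |L| * max ρ 1 := by
    rcases le_total ‖z‖ (max ρ 1) with hz | hz
    · have := mul_le_mul_of_nonneg_left hz (abs_nonneg L)
      have h4 : 0 ≤ a * ‖z‖ ^ q := by positivity
      linarith
    · have hz0 : 0 < ‖z‖ := lt_of_lt_of_le (by positivity) hz
      have h5 := hρ ‖z‖ ((le_max_left _ _).trans hz)
      rw [div_le_iff₀ ha] at h5
      have h6 : ‖z‖ ^ q = ‖z‖ ^ (q - 1) * ‖z‖ := by
        rw [← Real.rpow_add_one hz0.ne']; congr 1; ring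
      have h7 := mul_le_mul_of_nonneg_right h5 hz0.le
      have h8 : 0 ≤ |L| * max ρ 1 := by positivity
      rw [h6]
      linarith
  linarith

theorem IsCoupling.exists_lipschitz (hh : IsCoupling h) :
    ∃ C : ℝ, (∀ x μ, |h x μ| ≤ C) ∧ ∀ x y μ, |h x μ - h y μ| ≤ C * ‖x - y‖ := by
  obtain ⟨C, -, hC⟩ := hh.bounded
  refine ⟨C, fun x μ => (hC x μ).1, fun x y μ => ?_⟩
  exact Convex.norm_image_sub_le_of_norm_fderiv_le (𝕜 := ℝ) (s := Set.univ)
    (fun z _ => ((hh.contDiff μ).differentiable (by simp)).differentiableAt)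
    (fun z _ => (hC z μ).2) convex_univ (Set.mem_univ y) (Set.mem_univ x)

theorem continuous_comp_flow (hh : Continuous fun z : E d × P1 d => h z.1 z.2)
    (hm : Continuous m) : Continuous fun z : E d × ℝ => h z.1 (m z.2) :=
  hh.comp (continuous_fst.prodMk (hm.comp continuous_snd))

/-- Continuous functions on `ℝ^d × P1` are uniformly close along close flows of measures. -/
theorem eventually_abs_sub_le (hh : Continuous fun z : E d × P1 d => h z.1 z.2)
    (hm : Continuous m) (hT : 0 < T) {Nt : ℕ → ℕ} (hNt : ∀ n, 0 < Nt n)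
    {ν : ∀ n, Fin (Nt n + 1) → P1 d}
    (hν : ∀ r > 0, ∀ᶠ n in atTop, ∀ k, edist (ν n k) (m (gridTime T (Nt n) k)) ≤ ENNReal.ofReal r)
    (R : ℝ) {η : ℝ} (hη : 0 < η) :
    ∀ᶠ n in atTop, ∀ x : E d, ‖x‖ ≤ R → ∀ k,
      |h x (ν n k) - h x (m (gridTime T (Nt n) k))| ≤ η := by
  -- The measures `ν n k` need not lie in a compact set. Uniform continuity at the points of the
  -- compact set swept by `m` is enough, since only one of the two compared points has to belong to
  -- it.
  have hK : IsCompact (Metric.closedBall (0 : E d) R ×ˢ (m '' Set.Icc 0 T)) :=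
    (isCompact_closedBall 0 R).prod (isCompact_Icc.image hm)
  have h1 := hK.uniformContinuousAt_of_continuousAt (fun z : E d × P1 d => h z.1 z.2)
    (fun _ _ => hh.continuousAt) (Metric.dist_mem_uniformity hη)
  obtain ⟨e, he, hsub⟩ := mem_uniformity_edist.1 h1
  obtain ⟨r, hr0, hre⟩ := ENNReal.lt_iff_exists_nnreal_btwn.1 he
  have hr0 : 0 < r := by exact_mod_cast hr0
  filter_upwards [hν r hr0] with n hn x hx k
  have h2 : edist (x, m (gridTime T (Nt n) k)) (x, ν n k) < e := by
    rw [Prod.edist_eq, edist_self, max_eq_right zero_le, edist_comm]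
    exact (hn k).trans_lt (by simpa using hre)
  have h3 := hsub h2 ⟨by simpa using hx, ⟨_, gridTime_mem hT (hNt n) k, rfl⟩⟩
  have h4 : |h x (m (gridTime T (Nt n) k)) - h x (ν n k)| < η := h3
  rw [abs_sub_comm]
  exact h4.le

theorem exists_time_modulus {F : E d → ℝ → ℝ} (hF : Continuous fun z : E d × ℝ => F z.1 z.2)
    (R T : ℝ) {η : ℝ} (hη : 0 < η) :
    ∃ δ > 0, ∀ x : E d, ‖x‖ ≤ R → ∀ s ∈ Set.Icc 0 T, ∀ t, |t - s| < δ → |F x t - F x s| ≤ η := by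
  have hK : IsCompact (Metric.closedBall (0 : E d) R ×ˢ Set.Icc 0 T) :=
    (isCompact_closedBall 0 R).prod isCompact_Icc
  have h1 := hK.uniformContinuousAt_of_continuousAt (fun z : E d × ℝ => F z.1 z.2)
    (fun _ _ => hF.continuousAt) (Metric.dist_mem_uniformity hη)
  obtain ⟨δ, hδ, hsub⟩ := Metric.mem_uniformity_dist.1 h1
  refine ⟨δ, hδ, fun x hx s hs t hst => ?_⟩
  have h2 : dist (x, s) (x, t) < δ := by
    rw [Prod.dist_eq, dist_self, max_eq_right dist_nonneg, dist_comm]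
    exact hst
  have h3 : |F x s - F x t| < η := hsub h2 ⟨by simpa using hx, hs⟩
  rw [abs_sub_comm]
  exact h3.le

end Coupling

/-! ### Lower bound for the discrete value functions -/

section LowerBound

variable {d : ℕ} {T : ℝ} {ℓ : E d → ℝ} {f g : E d → P1 d → ℝ}
  {m₀ : ProbabilityMeasure (E d)}

/-- A line subsolution, penalized at infinity, is a subsolution of the discrete equation up to
small errors. -/
theorem IsFiniteMFGSolution.penalized_le_value {Ns Nt : ℕ} {ε : ℝ}
    {U : grid d Ns → Fin (Nt + 1) → ℝ} {M : Fin (Nt + 1) → stdSimplex ℝ (grid d Ns)}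
    {P : grid d Ns → Fin Nt → stdSimplex ℝ (grid d Ns)}
    (h : IsFiniteMFGSolution T ℓ f g m₀ Ns Nt ε U M P) (hT : 0 < T) (hNt : 0 < Nt) (hε : 0 ≤ ε)
    {F : E d → ℝ → ℝ} {u : E d → ℝ → ℝ} {C B Bu K lam ω R : ℝ}
    (hf : ∀ x μ, |f x μ| ≤ C) (hg : ∀ x μ, |g x μ| ≤ C)
    (hFlip : ∀ x y t, |F x t - F y t| ≤ C * ‖x - y‖)
    (hu : IsLineSubsolution ℓ F 0 T u) (huB : ∀ x, ∀ t ∈ Set.Icc 0 T, |u x t| ≤ Bu)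
    (hB : ∀ x k, |U x k| ≤ B) (hK0 : 0 ≤ K) (hK : ∀ z, 2 * ‖z‖ - K ≤ ℓ z)
    (hlam0 : 0 ≤ lam) (hlam1 : lam ≤ 1) (hω : 0 ≤ ω) (hR : Bu + B ≤ lam * R)
    (hlamC : C * timeStep T Nt ≤ lam)
    (hF : ∀ x : E d, ‖x‖ ≤ R → ∀ s ∈ Set.Icc 0 T, ∀ t, |t - s| ≤ timeStep T Nt →
      |F x t - F x s| ≤ ω)
    (hfF : ∀ x : E d, ‖x‖ ≤ R → ∀ k, |f x (simplexToP1 (M k)) - F x (gridTime T Nt k)| ≤ ω)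
    (hgu : ∀ x : E d, ‖x‖ ≤ R → |g x (simplexToP1 (M (Fin.last Nt))) - u x T| ≤ ω)
    (x : grid d Ns) (k : Fin (Nt + 1)) :
    (1 - lam) * u x (gridTime T Nt k) + lam * (-‖(x : E d)‖ - (K + C) * (T - gridTime T Nt k)) -
      lam * C - ω - ((Nt : ℝ) - (k : ℕ)) * (2 * ω * timeStep T Nt + ε * Real.log (grid d Ns).card) ≤
      U x k := by
  have hΔ := timeStep_pos hT hNt
  have hC : 0 ≤ C := (abs_nonneg _).trans (hf 0 (simplexToP1 (M 0)))
  have hlog : 0 ≤ ε * Real.log (grid d Ns).card := mul_nonneg hε (Real.log_natCast_nonneg _)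
  -- Beyond the radius `R` the penalty alone pushes the left side below `-B`. The uniform estimates
  -- on `f` and `g`, which hold only on bounded sets, are thus needed only inside.
  have hfar : ∀ (x : grid d Ns) (k : Fin (Nt + 1)), R ≤ ‖(x : E d)‖ →
      (1 - lam) * u x (gridTime T Nt k) + lam * (-‖(x : E d)‖ - (K + C) * (T - gridTime T Nt k)) -
      lam * C - ω - ((Nt : ℝ) - (k : ℕ)) * (2 * ω * timeStep T Nt + ε * Real.log (grid d Ns).card) ≤
      U x k := by
    intro x k hx
    have ht := gridTime_mem hT hNt k
    have h1 := abs_le.1 (huB x _ ht)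
    have h2 := (abs_le.1 (hB x k)).1
    have hBu : 0 ≤ Bu := (abs_nonneg _).trans (huB x _ ht)
    have h3 : (1 - lam) * u x (gridTime T Nt k) ≤ 1 * Bu :=
      (mul_le_mul_of_nonneg_left h1.2 (by linarith)).trans
        (mul_le_mul_of_nonneg_right (by linarith) hBu)
    have h4 := mul_le_mul_of_nonneg_left hx hlam0
    have h5 : 0 ≤ lam * ((K + C) * (T - gridTime T Nt k)) :=
      mul_nonneg hlam0 (mul_nonneg (by linarith) (by linarith [ht.2]))
    have h6 : 0 ≤ lam * C := mul_nonneg hlam0 hC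
    have h7 : 0 ≤ ((Nt : ℝ) - (k : ℕ)) *
        (2 * ω * timeStep T Nt + ε * Real.log (grid d Ns).card) := by
      refine mul_nonneg (sub_nonneg.2 ?_) (by positivity)
      exact_mod_cast Nat.lt_succ_iff.1 k.2
    linarith
  induction k using Fin.reverseInduction generalizing x with
  | last =>
    rcases le_total R ‖(x : E d)‖ with hx | hx
    · exact hfar x _ hx
    have h1 := abs_le.1 (hgu x hx)
    have h2 := abs_le.1 (hg x (simplexToP1 (M (Fin.last Nt))))
    rw [h.terminal_eq, gridTime_last hNt, sub_self, mul_zero, Fin.val_last, sub_self, zero_mul]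
    have h3 : (1 - lam) * u x T ≤ (1 - lam) * (g x (simplexToP1 (M (Fin.last Nt))) + ω) :=
      mul_le_mul_of_nonneg_left (by linarith) (by linarith)
    have h4 : 0 ≤ lam * ‖(x : E d)‖ := by positivity
    have h5 : lam * -g x (simplexToP1 (M (Fin.last Nt))) ≤ lam * C :=
      mul_le_mul_of_nonneg_left (by linarith) hlam0
    have h6 : 0 ≤ lam * ω := by positivity
    linarith
  | cast k ih =>
    rcases le_total R ‖(x : E d)‖ with hx | hx
    · exact hfar x _ hx
    obtain ⟨s, hs⟩ : ∃ s, s = gridTime T Nt k.castSucc := ⟨_, rfl⟩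
    obtain ⟨Δ, hΔe⟩ : ∃ Δ, Δ = timeStep T Nt := ⟨_, rfl⟩
    obtain ⟨φ, hφ⟩ : ∃ φ, φ = f x (simplexToP1 (M k.castSucc)) := ⟨_, rfl⟩
    obtain ⟨Λ, hΛ⟩ : ∃ Λ, Λ = ε * Real.log (grid d Ns).card := ⟨_, rfl⟩
    have hs0 := gridTime_mem hT hNt k.castSucc
    have hs1 := gridTime_mem hT hNt k.succ
    have hfF' := abs_le.1 (hfF x hx k.castSucc)
    have hφC := abs_le.1 (hf x (simplexToP1 (M k.castSucc)))
    simp only [gridTime_succ] at ih hs1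
    rw [← hs, ← hΔe] at hs1
    rw [← hs] at hs0
    rw [← hφ, ← hs] at hfF'
    rw [← hφ] at hφC
    have hval := h.le_value hε x k
      (c := (1 - lam) * u x s + lam * (-‖(x : E d)‖ - (K + C) * (T - s))
      - lam * C - ω - ((Nt : ℝ) - (k.castSucc : ℕ)) * (2 * ω * Δ + Λ) + Λ - Δ * φ) ?_
    · rw [← hφ, ← hΔe, ← hΛ] at hval
      rw [← hs, ← hΔe, ← hΛ]
      linarith
    intro y
    have ihy := ih y
    rw [← hs, ← hΔe, ← hΛ] at ihy
    rw [← hΔe]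
    rw [← hΔe] at hlamC hF hΔ
    obtain ⟨z, hz⟩ : ∃ z, z = Δ⁻¹ • ((y : E d) - (x : E d)) := ⟨_, rfl⟩
    have hΔz : Δ • z = (y : E d) - x := by rw [hz, smul_inv_smul₀ hΔ.ne']
    have hnz : Δ * ‖z‖ = ‖(y : E d) - x‖ := by
      rw [← hΔz, norm_smul, Real.norm_of_nonneg hΔ.le]
    rw [← hz]
    -- the line inequality
    have hline := hu s (s + Δ) hs0.1 (by linarith) hs1.2 x z (φ + 2 * ω + C * ‖(y : E d) - x‖) ?_
    · have e1 : (x : E d) + (s + Δ - s) • z = y := by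
        rw [add_sub_cancel_left, hΔz, add_sub_cancel]
      rw [e1, add_sub_cancel_left] at hline
      have e2 := mul_le_mul_of_nonneg_left hline (show 0 ≤ 1 - lam by linarith)
      have e3 := mul_le_mul_of_nonneg_left (hK z) hΔ.le
      have e4 : ‖(y : E d)‖ ≤ ‖(x : E d)‖ + ‖(y : E d) - x‖ := by
        calc ‖(y : E d)‖ = ‖(x : E d) + ((y : E d) - x)‖ := by rw [add_sub_cancel]
          _ ≤ _ := norm_add_le _ _
      have e5 : -‖(x : E d)‖ - (K + C) * (T - s) ≤ Δ * (ℓ z + φ) - ‖(y : E d) - x‖ +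
          (-‖(y : E d)‖ - (K + C) * (T - (s + Δ))) := by
        have := mul_le_mul_of_nonneg_left hφC.1 hΔ.le
        nlinarith
      have e6 := mul_le_mul_of_nonneg_left e5 hlam0
      have e7 : C * Δ * ‖(y : E d) - x‖ ≤ lam * ‖(y : E d) - x‖ :=
        mul_le_mul_of_nonneg_right hlamC (norm_nonneg _)
      have e8 : 0 ≤ lam * (Δ * (2 * ω + C * ‖(y : E d) - x‖)) := by positivity
      simp only [Fin.val_castSucc, Fin.val_succ] at ihy ⊢
      push_cast at ihy
      nlinarith
    · intro r hr
      have e1 := hF x hx s hs0 r (by rw [abs_of_nonneg (by linarith [hr.1])]; linarith [hr.2])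
      have e2 := hFlip (x + (r - s) • z) x r
      rw [add_sub_cancel_left, norm_smul, Real.norm_of_nonneg (by linarith [hr.1])] at e2
      have e3 : C * ((r - s) * ‖z‖) ≤ C * ‖(y : E d) - x‖ := by
        rw [← hnz]
        refine mul_le_mul_of_nonneg_left (mul_le_mul_of_nonneg_right ?_ (norm_nonneg _)) hC
        linarith [hr.2]
      linarith [(abs_le.1 e1).2, (abs_le.1 e2).2]

end LowerBound

/-! ### Lower bound along the sequence -/

section LowerBound

variable {d : ℕ} {T : ℝ} {ℓ : E d → ℝ} {f g : E d → P1 d → ℝ}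
  {m₀ : ProbabilityMeasure (E d)} {Ns Nt : ℕ → ℕ} {ε : ℕ → ℝ}
  {U : ∀ n, grid d (Ns n) → Fin (Nt n + 1) → ℝ}
  {M : ∀ n, Fin (Nt n + 1) → stdSimplex ℝ (grid d (Ns n))}
  {P : ∀ n, grid d (Ns n) → Fin (Nt n) → stdSimplex ℝ (grid d (Ns n))} {C : ℝ} {m : ℝ → P1 d}
  {u : E d → ℝ → ℝ}

theorem IsGameSequence.eventually_le_value (h : IsGameSequence T ℓ f g m₀ Ns Nt ε U M P C)
    (hf : Continuous fun z : E d × P1 d => f z.1 z.2)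
    (hg : Continuous fun z : E d × P1 d => g z.1 z.2)
    (hflip : ∀ x y μ, |f x μ - f y μ| ≤ C * ‖x - y‖) (hm : Continuous m)
    (hflow : ∀ r > 0, ∀ᶠ n in atTop, ∀ k,
      edist (simplexToP1 (M n k)) (m (gridTime T (Nt n) k)) ≤ ENNReal.ofReal r)
    (hu : IsLineSubsolution ℓ (fun x t => f x (m t)) 0 T u) {Bu : ℝ}
    (huB : ∀ x, ∀ t ∈ Set.Icc 0 T, |u x t| ≤ Bu) (huT : ∀ x, u x T = g x (m T))
    (R₀ : ℝ) {η : ℝ} (hη : 0 < η) :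
    ∀ᶠ n in atTop, ∀ x : grid d (Ns n), ‖(x : E d)‖ ≤ R₀ → ∀ k,
      u x (gridTime T (Nt n) k) - η ≤ U n x k := by
  have hT := h.pos
  have hC := h.nonneg
  have hBu : 0 ≤ Bu := (abs_nonneg _).trans (huB 0 T ⟨hT.le, le_rfl⟩)
  obtain ⟨B, hB0, hB⟩ := h.exists_value_le
  obtain ⟨K, hK0, hK⟩ := exists_superlinear_nonneg h.superlinear 2
  obtain ⟨A, hA⟩ : ∃ A, A = C + Bu + |R₀| + (K + C) * T := ⟨_, rfl⟩
  have hA0 : 0 ≤ A := by rw [hA]; positivity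
  -- The penalisation, the modulus `ω` and the accumulated entropy are each allotted `η / 4`. The
  -- weight `lam` is fixed first; it determines the radius `R`, and only then is `n` taken large.
  obtain ⟨lam, hlam⟩ : ∃ lam, lam = min 1 (η / (4 * (A + 1))) := ⟨_, rfl⟩
  have hlam0 : 0 < lam := by rw [hlam]; positivity
  have hlam1 : lam ≤ 1 := by rw [hlam]; exact min_le_left _ _
  have hlamA : lam * A ≤ η / 4 := by
    have h1 : lam ≤ η / (4 * (A + 1)) := by rw [hlam]; exact min_le_right _ _
    rw [le_div_iff₀ (by positivity)] at h1
    linarith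
  obtain ⟨ω, hω⟩ : ∃ ω, ω = η / (4 * (1 + 2 * T)) := ⟨_, rfl⟩
  have hω0 : 0 < ω := by rw [hω]; positivity
  have hωη : ω * (1 + 2 * T) = η / 4 := by rw [hω]; field_simp
  obtain ⟨R, hR⟩ : ∃ R, R = (Bu + B) / lam := ⟨_, rfl⟩
  have hRlam : Bu + B = lam * R := by rw [hR]; field_simp
  obtain ⟨δ, hδ0, hδ⟩ := exists_time_modulus (F := fun x t => f x (m t))
    (continuous_comp_flow hf hm) R T hω0
  have h1 : Tendsto (fun n => C * timeStep T (Nt n)) atTop (𝓝 0) := by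
    simpa using h.tendsto_timeStep.const_mul C
  filter_upwards [h1.eventually (gt_mem_nhds hlam0),
    h.tendsto_timeStep.eventually (gt_mem_nhds hδ0),
    h.entropy_tendsto.eventually (gt_mem_nhds (show 0 < η / 4 by positivity)),
    eventually_abs_sub_le hf hm hT h.time_pos hflow R hω0,
    eventually_abs_sub_le hg hm hT h.time_pos hflow R hω0] with n n1 n2 n3 n4 n5 x hx k
  have key := (h.solution n).penalized_le_value hT (h.time_pos n) (h.eps_nonneg n)
    h.running_bound h.terminal_bound (fun x y t => hflip x y (m t)) hu huB (hB n) hK0 hK hlam0.le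
    hlam1 hω0.le hRlam.le n1.le (fun x hx s hs t ht => hδ x hx s hs t (ht.trans_lt n2)) n4
    (fun x hx => by
      have := n5 x hx (Fin.last (Nt n))
      rwa [gridTime_last (h.time_pos n), ← huT] at this) x k
  refine le_trans ?_ key
  have ht := gridTime_mem hT (h.time_pos n) k
  have e1 := (abs_le.1 (huB x _ ht)).2
  have e2 : lam * (C + u x (gridTime T (Nt n) k) + ‖(x : E d)‖ +
      (K + C) * (T - gridTime T (Nt n) k)) ≤ lam * A := by
    refine mul_le_mul_of_nonneg_left ?_ hlam0.le
    rw [hA]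
    have := mul_le_mul_of_nonneg_left (show T - gridTime T (Nt n) k ≤ T by linarith [ht.1])
      (show 0 ≤ K + C by positivity)
    linarith [le_abs_self R₀]
  have e3 : ((Nt n : ℝ) - (k : ℕ)) * (2 * ω * timeStep T (Nt n) +
      ε n * Real.log (grid d (Ns n)).card) ≤ 2 * ω * T + η / 4 := by
    have hΔ := timeStep_pos hT (h.time_pos n)
    have hlog : 0 ≤ ε n * Real.log (grid d (Ns n)).card :=
      mul_nonneg (h.eps_nonneg n) (Real.log_natCast_nonneg _)
    calc _ ≤ (Nt n : ℝ) * (2 * ω * timeStep T (Nt n) + ε n * Real.log (grid d (Ns n)).card) :=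
          mul_le_mul_of_nonneg_right (sub_le_self _ (Nat.cast_nonneg _)) (by positivity)
      _ = 2 * ω * ((Nt n : ℝ) * timeStep T (Nt n)) +
          (Nt n : ℝ) * (ε n * Real.log (grid d (Ns n)).card) := by ring
      _ ≤ _ := by rw [mul_timeStep (h.time_pos n)]; linarith
  nlinarith

end LowerBound

/-! ### Rounding to the grid -/

section Rounding

variable {d : ℕ}

/-- Rounding to the lattice `N⁻¹ ℤ^d`. -/
noncomputable def roundTo (N : ℕ) (v : E d) : E d :=
  WithLp.toLp 2 fun j => (round ((N : ℝ) * v j) : ℝ) * (1 / (N : ℝ))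

theorem roundTo_zero (N : ℕ) : roundTo N (0 : E d) = 0 := by
  ext j
  simp [roundTo]

theorem abs_roundTo_sub_le {N : ℕ} (hN : 0 < N) (v : E d) (j : Fin d) :
    |roundTo N v j - v j| ≤ 1 / (N : ℝ) / 2 := by
  have hN' : (0 : ℝ) < N := by exact_mod_cast hN
  have h1 : roundTo N v j - v j = (round ((N : ℝ) * v j) - N * v j) * (1 / (N : ℝ)) := by
    simp only [roundTo]
    field_simp
  rw [h1, abs_mul, abs_sub_comm, abs_of_pos (show (0 : ℝ) < 1 / N by positivity)]
  have := mul_le_mul_of_nonneg_right (abs_sub_round ((N : ℝ) * v j))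
    (show (0 : ℝ) ≤ 1 / N by positivity)
  linarith

/-- Each rounding errs by at most half a cell in every coordinate. Applied to consecutive points of
a line, this bounds the deviation of the rounded displacement from the true one. -/
theorem norm_roundTo_sub_sub_le {N : ℕ} (hN : 0 < N) (v w : E d) :
    ‖roundTo N v - roundTo N w - (v - w)‖ ≤ √d * (1 / (N : ℝ)) := by
  refine norm_le_sqrt_mul (by positivity) fun j => ?_
  have h1 := abs_le.1 (abs_roundTo_sub_le hN v j)
  have h2 := abs_le.1 (abs_roundTo_sub_le hN w j)
  simp only [PiLp.sub_apply]
  rw [abs_le]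
  constructor <;> linarith

theorem norm_roundTo_sub_le {N : ℕ} (hN : 0 < N) (v : E d) :
    ‖roundTo N v - v‖ ≤ √d * (1 / (N : ℝ)) := by
  simpa [roundTo_zero] using norm_roundTo_sub_sub_le hN v 0

theorem mem_grid {N : ℕ} {x : E d} : x ∈ grid d N ↔
    ∃ i : Fin d → ℤ, (∀ j, |i j| ≤ (N : ℤ) ^ 2) ∧ ∀ j, x j = (i j : ℝ) * (1 / (N : ℝ)) := by
  classical
  simp only [grid, Finset.mem_image, Fintype.mem_piFinset, Finset.mem_Icc, abs_le]
  refine exists_congr fun i => and_congr_right fun _ => ?_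
  constructor
  · rintro rfl j; rfl
  · intro h; ext j; exact (h j).symm

theorem zero_mem_grid (N : ℕ) : (0 : E d) ∈ grid d N :=
  mem_grid.2 ⟨0, fun j => by simp, fun j => by simp⟩

/-- The indices run up to `N ^ 2` with mesh `1 / N`, so the grid fills a cube of half-width `N`; the
summand 1 leaves room for rounding. -/
theorem add_roundTo_mem_grid {N : ℕ} (hN : 0 < N) {x : E d} (hx : x ∈ grid d N) {v : E d}
    (h : ‖x‖ + ‖v‖ + 1 ≤ N) : x + roundTo N v ∈ grid d N := by
  have hN' : (0 : ℝ) < N := by exact_mod_cast hN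
  have hN1 : (1 : ℝ) ≤ N := by exact_mod_cast hN
  obtain ⟨i, -, hix⟩ := mem_grid.1 hx
  refine mem_grid.2 ⟨fun j => i j + round ((N : ℝ) * v j), fun j => ?_, fun j => ?_⟩
  · have h1 : |x j| ≤ ‖x‖ := by simpa using PiLp.norm_apply_le x j
    have h2 : |v j| ≤ ‖v‖ := by simpa using PiLp.norm_apply_le v j
    have h3 : (i j : ℝ) = N * x j := by rw [hix]; field_simp
    have h4 := abs_sub_round ((N : ℝ) * v j)
    have h5 : |(i j : ℝ) + (round ((N : ℝ) * v j) : ℝ)| ≤ (N : ℝ) ^ 2 := by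
      calc |(i j : ℝ) + (round ((N : ℝ) * v j) : ℝ)|
          = |N * x j + (N * v j - ((N : ℝ) * v j - round ((N : ℝ) * v j)))| := by
            rw [h3]; congr 1; ring
        _ ≤ |N * x j| + (|N * v j| + |(N : ℝ) * v j - round ((N : ℝ) * v j)|) :=
            (abs_add_le _ _).trans (add_le_add le_rfl (abs_sub _ _))
        _ ≤ N * ‖x‖ + (N * ‖v‖ + 1 / 2) := by
            rw [abs_mul, abs_mul, abs_of_pos hN']
            gcongr
        _ ≤ N * (‖x‖ + ‖v‖ + 1) := by nlinarith
        _ ≤ (N : ℝ) ^ 2 := by rw [pow_two]; gcongr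
    exact_mod_cast h5
  · simp only [PiLp.add_apply, hix, roundTo]
    push_cast
    ring

end Rounding

/-! ### The filter of grid points converging to a given point -/

section GridFilter

variable {d : ℕ} {T : ℝ} {Ns Nt : ℕ → ℕ}

theorem eventually_gridFilter {x : E d} {t : ℝ}
    {p : (Σ n : ℕ, grid d (Ns n) × Fin (Nt n + 1)) → Prop} :
    (∀ᶠ z in gridFilter T Ns Nt x t, p z) ↔
      ∃ δ > 0, ∀ᶠ n in atTop, ∀ (y : grid d (Ns n)) (k : Fin (Nt n + 1)), ‖(y : E d) - x‖ < δ →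
        |gridTime T (Nt n) k - t| < δ → p ⟨n, y, k⟩ := by
  rw [gridFilter, eventually_comap]
  constructor
  · intro h
    obtain ⟨pa, hpa, pb, hpb, hp⟩ := eventually_prod_iff.1 h
    obtain ⟨δ, hδ, hball⟩ := Metric.eventually_nhds_iff.1 hpb
    refine ⟨δ, hδ, hpa.mono fun n hn y k hy hk => ?_⟩
    refine hp hn (hball (y := ((y : E d), gridTime T (Nt n) k)) ?_) ⟨n, y, k⟩ rfl
    rw [Prod.dist_eq, dist_eq_norm, dist_eq_norm]
    exact max_lt hy hk
  · rintro ⟨δ, hδ, h⟩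
    refine eventually_prod_iff.2 ⟨_, h, _, Metric.ball_mem_nhds (x, t) hδ, ?_⟩
    rintro n hn ⟨y', s⟩ hy ⟨n', y, k⟩ hz
    simp only [Prod.mk.injEq] at hz
    obtain ⟨rfl, rfl, rfl⟩ := hz
    have hy : dist ((y : E d), gridTime T (Nt n') k) (x, t) < δ := hy
    rw [Prod.dist_eq, dist_eq_norm, dist_eq_norm] at hy
    exact hn y k ((le_max_left _ _).trans_lt hy) ((le_max_right _ _).trans_lt hy)

theorem neBot_gridFilter (hT : 0 < T) (hNs0 : ∀ n, 0 < Ns n) (hNt0 : ∀ n, 0 < Nt n)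
    (hNs : Tendsto Ns atTop atTop) (hNt : Tendsto Nt atTop atTop) (x : E d) {t : ℝ}
    (ht : t ∈ Set.Icc 0 T) : (gridFilter T Ns Nt x t).NeBot := by
  rw [← frequently_true_iff_neBot, Filter.Frequently]
  simp only [not_true_eq_false, eventually_gridFilter]
  rintro ⟨δ, hδ, h⟩
  have h1 : Tendsto (fun n => √d * (1 / (Ns n : ℝ))) atTop (𝓝 0) := by
    simpa using ((tendsto_natCast_atTop_atTop (R := ℝ).comp hNs).const_div_atTop 1).const_mul (√d)
  have h2 : Tendsto (fun n => timeStep T (Nt n)) atTop (𝓝 0) :=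
    (tendsto_natCast_atTop_atTop.comp hNt).const_div_atTop T
  obtain ⟨n, hn, hn1, hn2, hn3⟩ := (h.and ((h1.eventually (gt_mem_nhds hδ)).and
    ((h2.eventually (gt_mem_nhds hδ)).and ((tendsto_natCast_atTop_atTop (R := ℝ).comp
      hNs).eventually_ge_atTop (‖x‖ + 1))))).exists
  obtain ⟨k, hk1, hk2⟩ := exists_grid_cell hT (hNt0 n) ht
  have hmem := add_roundTo_mem_grid (hNs0 n) (zero_mem_grid (d := d) (Ns n)) (v := x)
    (by rw [norm_zero, zero_add]; exact hn3)
  refine hn ⟨_, hmem⟩ k.castSucc ?_ ?_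
  · simp only [zero_add]
    exact (norm_roundTo_sub_le (hNs0 n) x).trans_lt hn1
  · rw [gridTime_succ] at hk2
    rw [abs_lt]
    constructor <;> linarith

end GridFilter

/-! ### Upper bound for the discrete value functions -/

theorem le_add_of_le_succ {N : ℕ} {X : Fin (N + 1) → ℝ} {b : ℝ} {i j : Fin (N + 1)} (hij : i ≤ j)
    (h : ∀ k : Fin N, i ≤ k.castSucc → k.succ ≤ j → X k.castSucc ≤ b + X k.succ) :
    X i ≤ (((j : ℕ) : ℝ) - ((i : ℕ) : ℝ)) * b + X j := by
  induction j using Fin.induction with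
  | zero =>
    obtain rfl : i = 0 := le_antisymm hij (Fin.zero_le _)
    simp
  | succ j ih =>
    rcases hij.eq_or_lt with rfl | hlt
    · simp
    have hij' : i ≤ j.castSucc := Fin.le_castSucc_iff.2 hlt
    have h1 := ih hij' fun k h1 h2 => h k h1 (h2.trans Fin.castSucc_lt_succ.le)
    have h2 := h j hij' le_rfl
    simp only [Fin.val_castSucc, Fin.val_succ] at h1 ⊢
    push_cast
    linarith

section OneGame

variable {d : ℕ} {T : ℝ} {ℓ : E d → ℝ} {f g : E d → P1 d → ℝ}
  {m₀ : ProbabilityMeasure (E d)} {Ns Nt : ℕ} {ε : ℝ}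
  {U : grid d Ns → Fin (Nt + 1) → ℝ} {M : Fin (Nt + 1) → stdSimplex ℝ (grid d Ns)}
  {P : grid d Ns → Fin Nt → stdSimplex ℝ (grid d Ns)}

/-- Comparison of the discrete value function along a rounded straight line. -/
theorem IsFiniteMFGSolution.value_le_line (h : IsFiniteMFGSolution T ℓ f g m₀ Ns Nt ε U M P)
    (hT : 0 < T) (hNt : 0 < Nt) (hNs : 0 < Ns) {x z : E d} {k k' : Fin (Nt + 1)} (hkk : k ≤ k')
    (hmem : ∀ l, x + roundTo Ns ((gridTime T Nt l - gridTime T Nt k) • z) ∈ grid d Ns) {A c : ℝ}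
    (hA : ∀ w, ‖w - z‖ ≤ √d * (1 / (Ns : ℝ)) / timeStep T Nt → ℓ w ≤ A)
    (hc : ∀ l, k ≤ l → l ≤ k' → f (x + roundTo Ns ((gridTime T Nt l - gridTime T Nt k) • z))
      (simplexToP1 (M l)) ≤ c) :
    U ⟨_, hmem k⟩ k ≤ (gridTime T Nt k' - gridTime T Nt k) * (A + c) + U ⟨_, hmem k'⟩ k' := by
  have hΔ := timeStep_pos hT hNt
  have key := le_add_of_le_succ (X := fun l => U ⟨_, hmem l⟩ l) (b := timeStep T Nt * (A + c)) hkk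
    fun l h1 h2 => ?_
  · refine key.trans_eq ?_
    simp only [gridTime]
    ring
  have h3 := h.value_le ⟨_, hmem l.castSucc⟩ ⟨_, hmem l.succ⟩ l
  have h4 := hc l.castSucc h1 ((Fin.castSucc_lt_succ).le.trans h2)
  have h5 := hA ((timeStep T Nt)⁻¹ •
    ((x + roundTo Ns ((gridTime T Nt l.succ - gridTime T Nt k) • z)) -
      (x + roundTo Ns ((gridTime T Nt l.castSucc - gridTime T Nt k) • z)))) ?_
  · have h6 := mul_le_mul_of_nonneg_left h5 hΔ.le
    have h7 := mul_le_mul_of_nonneg_left h4 hΔ.le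
    simp only at h3
    linarith
  -- The rounding error of a displacement, divided by the time step, is the error in velocity.
  · have h8 := norm_roundTo_sub_sub_le hNs ((gridTime T Nt l.succ - gridTime T Nt k) • z)
      ((gridTime T Nt l.castSucc - gridTime T Nt k) • z)
    rw [← sub_smul, sub_sub_sub_cancel_right, gridTime_succ, add_sub_cancel_left] at h8
    rw [le_div_iff₀ hΔ, add_sub_add_left_eq_sub, gridTime_succ]
    refine le_trans (le_of_eq ?_) h8
    rw [mul_comm, ← Real.norm_of_nonneg hΔ.le, ← norm_smul, Real.norm_of_nonneg hΔ.le, smul_sub,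
      smul_inv_smul₀ hΔ.ne']

theorem IsFiniteMFGSolution.value_le_terminal_add
    (h : IsFiniteMFGSolution T ℓ f g m₀ Ns Nt ε U M P) (hT : 0 < T) (hNt : 0 < Nt) {C : ℝ}
    (hf : ∀ x μ, |f x μ| ≤ C) (x : grid d Ns) (k : Fin (Nt + 1)) :
    U x k ≤ (T - gridTime T Nt k) * (ℓ 0 + C) + g x (simplexToP1 (M (Fin.last Nt))) := by
  have hΔ := timeStep_pos hT hNt
  have key := le_add_of_le_succ (X := fun l => U x l) (b := timeStep T Nt * (ℓ 0 + C))
    (Fin.le_last k) fun l _ _ => ?_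
  · rw [← h.terminal_eq]
    refine key.trans_eq ?_
    rw [gridTime, Fin.val_last]
    linear_combination (ℓ 0 + C) * mul_timeStep (T := T) hNt
  have h3 := h.value_le x x l
  rw [sub_self, smul_zero] at h3
  have h7 := mul_le_mul_of_nonneg_left (abs_le.1 (hf x (simplexToP1 (M l.castSucc)))).2 hΔ.le
  linarith

end OneGame

/-! ### The upper relaxed limit as a line subsolution -/

section UpperBound

variable {d : ℕ} {T : ℝ} {ℓ : E d → ℝ} {f g : E d → P1 d → ℝ}
  {m₀ : ProbabilityMeasure (E d)} {Ns Nt : ℕ → ℕ} {ε : ℕ → ℝ}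
  {U : ∀ n, grid d (Ns n) → Fin (Nt n + 1) → ℝ}
  {M : ∀ n, Fin (Nt n + 1) → stdSimplex ℝ (grid d (Ns n))}
  {P : ∀ n, grid d (Ns n) → Fin (Nt n) → stdSimplex ℝ (grid d (Ns n))} {C : ℝ} {m : ℝ → P1 d}
  {u : E d → ℝ → ℝ}

/-- The upper relaxed limit as a real number. -/
noncomputable def realUpperLimit (T : ℝ) (Ns Nt : ℕ → ℕ)
    (U : ∀ n, grid d (Ns n) → Fin (Nt n + 1) → ℝ) (x : E d) (t : ℝ) : ℝ :=
  limsup (fun z : Σ n : ℕ, grid d (Ns n) × Fin (Nt n + 1) => U z.1 z.2.1 z.2.2)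
    (gridFilter T Ns Nt x t)

theorem IsGameSequence.neBot (h : IsGameSequence T ℓ f g m₀ Ns Nt ε U M P C) (x : E d) {t : ℝ}
    (ht : t ∈ Set.Icc 0 T) : (gridFilter T Ns Nt x t).NeBot :=
  neBot_gridFilter h.pos h.space_pos h.time_pos h.space_tendsto h.time_tendsto x ht

theorem IsGameSequence.realUpperLimit_le (h : IsGameSequence T ℓ f g m₀ Ns Nt ε U M P C) {x : E d}
    {t a : ℝ} (ht : t ∈ Set.Icc 0 T) {δ : ℝ} (hδ : 0 < δ)
    (ha : ∀ᶠ n in atTop, ∀ (y : grid d (Ns n)) (k : Fin (Nt n + 1)), ‖(y : E d) - x‖ < δ →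
      |gridTime T (Nt n) k - t| < δ → U n y k ≤ a) : realUpperLimit T Ns Nt U x t ≤ a := by
  obtain ⟨B, -, hB⟩ := h.exists_value_le
  have := h.neBot x ht
  refine limsup_le_of_le ?_ (eventually_gridFilter.2 ⟨δ, hδ, ha⟩)
  exact IsBoundedUnder.isCoboundedUnder_le
    (isBoundedUnder_of ⟨-B, fun z => (abs_le.1 (hB z.1 z.2.1 z.2.2)).1⟩)

theorem IsGameSequence.exists_value_lt (h : IsGameSequence T ℓ f g m₀ Ns Nt ε U M P C) {x : E d}
    {t a : ℝ} (ha : realUpperLimit T Ns Nt U x t < a) :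
    ∃ δ > 0, ∀ᶠ n in atTop, ∀ (y : grid d (Ns n)) (k : Fin (Nt n + 1)), ‖(y : E d) - x‖ < δ →
      |gridTime T (Nt n) k - t| < δ → U n y k < a := by
  obtain ⟨B, -, hB⟩ := h.exists_value_le
  exact eventually_gridFilter.1 (eventually_lt_of_limsup_lt ha
    (isBoundedUnder_of ⟨B, fun z => (abs_le.1 (hB z.1 z.2.1 z.2.2)).2⟩))

/-- From a grid point near `x` at a time near `T`, waiting until the end costs little and yields the
terminal cost, which is continuous in the point and in the measure. -/
theorem IsGameSequence.realUpperLimit_terminal_le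
    (h : IsGameSequence T ℓ f g m₀ Ns Nt ε U M P C)
    (hg : Continuous fun z : E d × P1 d => g z.1 z.2)
    (hglip : ∀ x y μ, |g x μ - g y μ| ≤ C * ‖x - y‖) (hm : Continuous m)
    (hflow : ∀ r > 0, ∀ᶠ n in atTop, ∀ k,
      edist (simplexToP1 (M n k)) (m (gridTime T (Nt n) k)) ≤ ENNReal.ofReal r) (x : E d) :
    realUpperLimit T Ns Nt U x T ≤ g x (m T) := by
  have hT := h.pos
  have hC := h.nonneg
  refine le_of_forall_pos_le_add fun η hη => ?_
  obtain ⟨δ, hδ⟩ : ∃ δ, δ = min 1 (η / (2 * (|ℓ 0 + C| + C + 1))) := ⟨_, rfl⟩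
  have hδ0 : 0 < δ := by rw [hδ]; positivity
  have hδ1 : δ ≤ 1 := by rw [hδ]; exact min_le_left _ _
  have hδη : δ * (|ℓ 0 + C| + C + 1) ≤ η / 2 := by
    have h1 : δ ≤ η / (2 * (|ℓ 0 + C| + C + 1)) := by rw [hδ]; exact min_le_right _ _
    rw [le_div_iff₀ (by positivity)] at h1
    linarith
  refine h.realUpperLimit_le ⟨hT.le, le_rfl⟩ hδ0 ?_
  filter_upwards [eventually_abs_sub_le hg hm hT h.time_pos hflow (‖x‖ + 1) (half_pos hη)]
    with n hn y k hy hk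
  have e1 := (h.solution n).value_le_terminal_add hT (h.time_pos n) h.running_bound y k
  have hynorm : ‖(y : E d)‖ ≤ ‖x‖ + 1 := by
    have := norm_le_norm_add_norm_sub' (y : E d) x
    linarith
  have e2 := hn y hynorm (Fin.last (Nt n))
  rw [gridTime_last (h.time_pos n)] at e2
  have e2 := (abs_le.1 e2).2
  have e3 := (abs_le.1 (hglip y x (m T))).2
  have e4 : C * ‖(y : E d) - x‖ ≤ C * δ := mul_le_mul_of_nonneg_left hy.le hC
  have ht := gridTime_mem hT (h.time_pos n) k
  have e5 : (T - gridTime T (Nt n) k) * (ℓ 0 + C) ≤ δ * |ℓ 0 + C| := by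
    have := (abs_lt.1 hk).1
    exact (mul_le_mul_of_nonneg_left (le_abs_self _) (by linarith [ht.2])).trans
      (mul_le_mul_of_nonneg_right (by linarith) (abs_nonneg _))
  linarith

/-- From any grid point close to `(y, s)`, follow the rounded line of velocity `z` to a grid time
close to `s'`. Continuity of `ℓ` controls the perturbed velocity, and a thickening of the segment on
which the potential stays below `c + ω` controls the coupling. At the endpoint, the relaxed limit
there bounds the discrete value. -/
theorem IsGameSequence.isLineSubsolution_realUpperLimit
    (h : IsGameSequence T ℓ f g m₀ Ns Nt ε U M P C) (hℓ : Continuous ℓ)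
    (hf : Continuous fun z : E d × P1 d => f z.1 z.2) (hm : Continuous m)
    (hflow : ∀ r > 0, ∀ᶠ n in atTop, ∀ k,
      edist (simplexToP1 (M n k)) (m (gridTime T (Nt n) k)) ≤ ENNReal.ofReal r) :
    IsLineSubsolution ℓ (fun x t => f x (m t)) 0 T (realUpperLimit T Ns Nt U) := by
  have hT := h.pos
  intro s s' hs hss hs' y z c hc
  obtain ⟨a, ha⟩ : ∃ a, a = realUpperLimit T Ns Nt U (y + (s' - s) • z) s' := ⟨_, rfl⟩
  rw [← ha]
  suffices key : ∀ ω, 0 < ω → ω ≤ 1 → realUpperLimit T Ns Nt U y s ≤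
      (s' - s) * (ℓ z + c) + a + (3 * T + 2) * ω by
    refine le_of_forall_pos_le_add fun η hη => ?_
    refine (key (min 1 (η / (3 * T + 2))) (by positivity) (min_le_left _ _)).trans ?_
    have h1 := min_le_right 1 (η / (3 * T + 2))
    rw [le_div_iff₀ (by positivity)] at h1
    linarith
  intro ω hω0 hω1
  obtain ⟨ρ, hρ0, hρ⟩ := Metric.continuousAt_iff.1 (hℓ.continuousAt (x := z)) ω hω0
  obtain ⟨δ₁, hδ₁0, hδ₁⟩ := h.exists_value_lt (a := a + ω) (by rw [← ha]; linarith)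
  obtain ⟨δ₂, hδ₂0, hδ₂⟩ := IsCompact.exists_thickening_subset_open
    (s := (fun r : ℝ => (y + (r - s) • z, r)) '' Set.Icc s s')
    (t := {p : E d × ℝ | f p.1 (m p.2) < c + ω})
    (isCompact_Icc.image (by fun_prop))
    (isOpen_lt (continuous_comp_flow hf hm) continuous_const) (by
      rintro _ ⟨r, hr, rfl⟩
      exact (hc r hr).trans_lt (by linarith))
  obtain ⟨D, hD⟩ : ∃ D, D = |ℓ z + c| + 3 := ⟨_, rfl⟩
  have hD0 : 0 < D := by rw [hD]; positivity
  obtain ⟨δ, hδ⟩ : ∃ δ, δ = min (min 1 (ω / (3 * D))) (min δ₁ δ₂ / (5 * (1 + ‖z‖))) := ⟨_, rfl⟩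
  have hδ0 : 0 < δ := by rw [hδ]; positivity
  have hδ1 : δ ≤ 1 := by rw [hδ]; exact (min_le_left _ _).trans (min_le_left _ _)
  have hδD : 3 * δ * D ≤ ω := by
    have h1 : δ ≤ ω / (3 * D) := by rw [hδ]; exact (min_le_left _ _).trans (min_le_right _ _)
    rw [le_div_iff₀ (by positivity)] at h1
    linarith
  have hδz : δ * (5 * (1 + ‖z‖)) ≤ min δ₁ δ₂ := by
    have h1 : δ ≤ min δ₁ δ₂ / (5 * (1 + ‖z‖)) := by rw [hδ]; exact min_le_right _ _
    rwa [le_div_iff₀ (by positivity)] at h1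
  obtain ⟨R, hR⟩ : ∃ R, R = ‖y‖ + T * ‖z‖ + 2 := ⟨_, rfl⟩
  have l1 : Tendsto (fun n => √d * (1 / (Ns n : ℝ))) atTop (𝓝 0) := by
    simpa using ((tendsto_natCast_atTop_atTop (R := ℝ).comp
      h.space_tendsto).const_div_atTop 1).const_mul (√d)
  -- The velocity error is the mesh divided by the time step, which is where `Nt / Ns → 0` is
  -- needed.
  have l2 : Tendsto (fun n => √d * (1 / (Ns n : ℝ)) / timeStep T (Nt n)) atTop (𝓝 0) := by
    have := h.ratio_tendsto.const_mul (√d / T)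
    rw [mul_zero] at this
    refine this.congr fun n => ?_
    have h1 : (Nt n : ℝ) ≠ 0 := by exact_mod_cast (h.time_pos n).ne'
    have h2 : (Ns n : ℝ) ≠ 0 := by exact_mod_cast (h.space_pos n).ne'
    unfold timeStep
    field_simp
  refine h.realUpperLimit_le ⟨hs, hss.trans hs'⟩ hδ0 ?_
  filter_upwards [hδ₁, l1.eventually (gt_mem_nhds hδ0), l2.eventually (gt_mem_nhds hρ0),
    h.tendsto_timeStep.eventually (gt_mem_nhds hδ0),
    eventually_abs_sub_le hf hm hT h.time_pos hflow R hω0,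
    (tendsto_natCast_atTop_atTop (R := ℝ).comp h.space_tendsto).eventually_ge_atTop R]
    with n n1 n2 n3 n4 n5 n6 x k hx hk
  have hNs := h.space_pos n
  have hNt := h.time_pos n
  have hxnorm : ‖(x : E d)‖ ≤ ‖y‖ + 1 := by
    have := norm_le_norm_add_norm_sub' (x : E d) y
    linarith
  have htime : ∀ l, ‖(gridTime T (Nt n) l - gridTime T (Nt n) k) • z‖ ≤ T * ‖z‖ := by
    intro l
    have h1 := gridTime_mem hT hNt l
    have h2 := gridTime_mem hT hNt k
    rw [norm_smul, Real.norm_eq_abs]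
    refine mul_le_mul_of_nonneg_right (abs_le.2 ⟨?_, ?_⟩) (norm_nonneg z) <;>
      linarith [h1.1, h1.2, h2.1, h2.2]
  have hmem : ∀ l, (x : E d) + roundTo (Ns n) ((gridTime T (Nt n) l - gridTime T (Nt n) k) • z) ∈
      grid d (Ns n) := fun l => add_roundTo_mem_grid hNs x.2 (by
    refine le_trans ?_ n6
    rw [hR]
    linarith [htime l])
  have hclose : ∀ l r, |gridTime T (Nt n) l - gridTime T (Nt n) k - (r - s)| ≤ 3 * δ →
      ‖(x : E d) + roundTo (Ns n) ((gridTime T (Nt n) l - gridTime T (Nt n) k) • z) -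
        (y + (r - s) • z)‖ < min δ₁ δ₂ := by
    intro l r hr
    obtain ⟨τ, hτ⟩ : ∃ τ, τ = gridTime T (Nt n) l - gridTime T (Nt n) k := ⟨_, rfl⟩
    rw [← hτ] at hr ⊢
    have e1 : (x : E d) + roundTo (Ns n) (τ • z) - (y + (r - s) • z) =
        ((x : E d) - y) + (roundTo (Ns n) (τ • z) - τ • z) + (τ - (r - s)) • z := by
      module
    have e2 : ‖(τ - (r - s)) • z‖ ≤ 3 * δ * ‖z‖ := by
      rw [norm_smul, Real.norm_eq_abs]
      exact mul_le_mul_of_nonneg_right hr (norm_nonneg z)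
    rw [e1]
    refine (norm_add₃_le).trans_lt ?_
    have e3 := norm_roundTo_sub_le hNs (τ • z)
    have e4 : 0 ≤ δ * ‖z‖ := by positivity
    linarith
  obtain ⟨k₀, hk₀, hk₀'⟩ := exists_grid_cell hT hNt (t := s') ⟨hs.trans hss, hs'⟩
  rw [gridTime_succ] at hk₀'
  have hk := abs_lt.1 hk
  -- When `s` and `s'` are close, the starting grid time may already be past the cell of `s'`; the
  -- line is then reduced to a point.
  obtain ⟨k', hkk', hk'⟩ : ∃ k', k ≤ k' ∧ |gridTime T (Nt n) k' - s'| ≤ δ := by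
    rcases le_total k k₀.castSucc with hle | hle
    · exact ⟨_, hle, abs_le.2 ⟨by linarith, by linarith⟩⟩
    · have := gridTime_mono hT hNt hle
      exact ⟨k, le_rfl, abs_le.2 ⟨by linarith, by linarith⟩⟩
  have hk'' := abs_le.1 hk'
  have hline := (h.solution n).value_le_line hT hNt hNs hkk' hmem (A := ℓ z + ω) (c := c + 2 * ω)
    (fun w hw => ?_) (fun l h1 h2 => ?_)
  · have e0 : (⟨_, hmem k⟩ : grid d (Ns n)) = x := Subtype.ext (by simp [roundTo_zero])
    rw [e0] at hline
    have e1 := n1 ⟨_, hmem k'⟩ k' ((hclose k' s' (abs_le.2 ⟨by linarith, by linarith⟩)).trans_le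
      (min_le_left _ _)) (hk'.trans_lt ?_)
    · have e2 : (gridTime T (Nt n) k' - gridTime T (Nt n) k - (s' - s)) * (ℓ z + c + 3 * ω) ≤
          3 * δ * D := by
        refine (le_abs_self _).trans ?_
        rw [abs_mul]
        refine mul_le_mul (abs_le.2 ⟨by linarith, by linarith⟩) ?_ (abs_nonneg _) (by positivity)
        rw [hD]
        refine (abs_add_le _ _).trans (add_le_add le_rfl ?_)
        rw [abs_of_nonneg (by positivity)]
        linarith
      have e3 : (s' - s) * (3 * ω) ≤ T * (3 * ω) :=
        mul_le_mul_of_nonneg_right (by linarith) (by positivity)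
      nlinarith
    · refine lt_of_lt_of_le ?_ (hδz.trans (min_le_left _ _))
      have : 0 ≤ δ * ‖z‖ := by positivity
      linarith
  · have := hρ (x := w) (by rw [dist_eq_norm]; exact hw.trans_lt n3)
    rw [Real.dist_eq] at this
    linarith [(abs_lt.1 this).2]
  · have t1 := gridTime_mono hT hNt h1
    have t2 := gridTime_mono hT hNt h2
    obtain ⟨r, hr, hr1⟩ : ∃ r ∈ Set.Icc s s', |gridTime T (Nt n) l - r| ≤ δ := by
      rcases le_total (gridTime T (Nt n) l) s with hl | hl
      · exact ⟨s, ⟨le_rfl, hss⟩, abs_le.2 ⟨by linarith, by linarith⟩⟩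
      rcases le_total (gridTime T (Nt n) l) s' with hl' | hl'
      · exact ⟨_, ⟨hl, hl'⟩, by simpa using hδ0.le⟩
      · exact ⟨s', ⟨hss, le_rfl⟩, abs_le.2 ⟨by linarith, by linarith⟩⟩
    have hr1' := abs_le.1 hr1
    have e1 := hclose l r (abs_le.2 ⟨by linarith, by linarith⟩)
    have e2 : ((x : E d) + roundTo (Ns n) ((gridTime T (Nt n) l - gridTime T (Nt n) k) • z),
        gridTime T (Nt n) l) ∈ Metric.thickening δ₂
          ((fun r : ℝ => (y + (r - s) • z, r)) '' Set.Icc s s') := by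
      refine Metric.mem_thickening_iff.2 ⟨_, ⟨r, hr, rfl⟩, ?_⟩
      rw [Prod.dist_eq, dist_eq_norm, Real.dist_eq]
      refine max_lt (e1.trans_le (min_le_right _ _)) (hr1.trans_lt ?_)
      refine lt_of_lt_of_le ?_ (hδz.trans (min_le_right _ _))
      have : 0 ≤ δ * ‖z‖ := by positivity
      linarith
    have e3 : f ((x : E d) + roundTo (Ns n) ((gridTime T (Nt n) l - gridTime T (Nt n) k) • z))
        (m (gridTime T (Nt n) l)) < c + ω := hδ₂ e2
    have e4 := n5 _ (?_ : ‖(x : E d) +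
      roundTo (Ns n) ((gridTime T (Nt n) l - gridTime T (Nt n) k) • z)‖ ≤ R) l
    · linarith [(abs_le.1 e4).2]
    · have e5 := norm_roundTo_sub_le hNs ((gridTime T (Nt n) l - gridTime T (Nt n) k) • z)
      have e6 := norm_le_norm_add_norm_sub'
        (roundTo (Ns n) ((gridTime T (Nt n) l - gridTime T (Nt n) k) • z))
        ((gridTime T (Nt n) l - gridTime T (Nt n) k) • z)
      refine (norm_add_le _ _).trans ?_
      rw [hR]
      linarith [htime l]

/-- The relaxed limit bounds the discrete values eventually near each point. Finitely many
neighbourhoods cover `Q × [0, T]`, and the Lipschitz bound on `u` moves the estimate within each. -/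
theorem IsGameSequence.eventually_value_le (h : IsGameSequence T ℓ f g m₀ Ns Nt ε U M P C)
    {L : ℝ} (hL0 : 0 ≤ L)
    (hL : ∀ x y, ∀ t ∈ Set.Icc 0 T, ∀ s ∈ Set.Icc 0 T, |u x t - u y s| ≤ L * ‖x - y‖ + L * |t - s|)
    (hu : ∀ x, ∀ t ∈ Set.Icc 0 T, realUpperLimit T Ns Nt U x t ≤ u x t)
    {Q : Set (E d)} (hQ : IsCompact Q) {η : ℝ} (hη : 0 < η) :
    ∀ᶠ n in atTop, ∀ x : grid d (Ns n), (x : E d) ∈ Q → ∀ k,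
      U n x k ≤ u x (gridTime T (Nt n) k) + η := by
  have hK : IsCompact (Q ×ˢ Set.Icc 0 T) := hQ.prod isCompact_Icc
  have key : ∀ᶠ n in atTop, ∀ (x : grid d (Ns n)) k,
      ((x : E d), gridTime T (Nt n) k) ∈ Q ×ˢ Set.Icc 0 T →
        U n x k ≤ u x (gridTime T (Nt n) k) + η := by
    refine hK.induction_on (p := fun S => ∀ᶠ n in atTop, ∀ (x : grid d (Ns n)) k,
      ((x : E d), gridTime T (Nt n) k) ∈ S → U n x k ≤ u x (gridTime T (Nt n) k) + η) ?_ ?_ ?_ ?_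
    · simp
    · exact fun S S' hSS h => h.mono fun n hn x k hx => hn x k (hSS hx)
    · intro S S' h1 h2
      filter_upwards [h1, h2] with n n1 n2 x k hx
      exact hx.elim (n1 x k) (n2 x k)
    · rintro ⟨x₀, t₀⟩ ⟨-, ht₀⟩
      obtain ⟨δ, hδ0, hδ⟩ := h.exists_value_lt (x := x₀) (t := t₀) (a := u x₀ t₀ + η / 2)
        (by linarith [hu x₀ t₀ ht₀])
      obtain ⟨δ', hδ'⟩ : ∃ δ', δ' = η / (4 * (L + 1)) := ⟨_, rfl⟩
      have hδ'0 : 0 < δ' := by rw [hδ']; positivity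
      have hδ'L : δ' * (4 * (L + 1)) = η := by rw [hδ']; field_simp
      refine ⟨Metric.ball (x₀, t₀) (min δ δ'),
        mem_nhdsWithin_of_mem_nhds (Metric.ball_mem_nhds _ (by positivity)), ?_⟩
      filter_upwards [hδ] with n hn x k hx
      rw [Metric.mem_ball, Prod.dist_eq, max_lt_iff, dist_eq_norm, Real.dist_eq] at hx
      have e1 := hn x k (hx.1.trans_le (min_le_left _ _)) (hx.2.trans_le (min_le_left _ _))
      have e2 := (abs_le.1 (hL x x₀ _ (gridTime_mem h.pos (h.time_pos n) k) t₀ ht₀)).1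
      have e3 := mul_le_mul_of_nonneg_left (hx.1.le.trans (min_le_right _ _)) hL0
      have e4 := mul_le_mul_of_nonneg_left (hx.2.le.trans (min_le_right _ _)) hL0
      linarith
  filter_upwards [key] with n hn x hx k
  exact hn x k ⟨hx, gridTime_mem h.pos (h.time_pos n) k⟩

end UpperBound

/-! ### Convergence of the discrete values -/

section Convergence

variable {d : ℕ} {T : ℝ} {ℓ : E d → ℝ} {f g : E d → P1 d → ℝ}
  {m₀ : ProbabilityMeasure (E d)} {Ns Nt : ℕ → ℕ} {ε : ℕ → ℝ}
  {U : ∀ n, grid d (Ns n) → Fin (Nt n + 1) → ℝ}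
  {M : ∀ n, Fin (Nt n + 1) → stdSimplex ℝ (grid d (Ns n))}
  {P : ∀ n, grid d (Ns n) → Fin (Nt n) → stdSimplex ℝ (grid d (Ns n))} {C : ℝ} {m : ℝ → P1 d}
  {u : E d → ℝ → ℝ}

theorem tendsto_gridFilter {L : ℝ} (hL0 : 0 ≤ L)
    (hL : ∀ x y, ∀ t ∈ Set.Icc 0 T, ∀ s ∈ Set.Icc 0 T, |u x t - u y s| ≤ L * ‖x - y‖ + L * |t - s|)
    (hT : 0 < T) (hNt : ∀ n, 0 < Nt n)
    (hU : ∀ Q : Set (E d), IsCompact Q → ∀ η : ℝ, 0 < η → ∀ᶠ n in atTop,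
      ∀ x : grid d (Ns n), (x : E d) ∈ Q → ∀ k, |U n x k - u x (gridTime T (Nt n) k)| < η)
    (x : E d) {t : ℝ} (ht : t ∈ Set.Icc 0 T) :
    Tendsto (fun z : Σ n : ℕ, grid d (Ns n) × Fin (Nt n + 1) => U z.1 z.2.1 z.2.2)
      (gridFilter T Ns Nt x t) (𝓝 (u x t)) := by
  rw [Metric.tendsto_nhds]
  intro η hη
  obtain ⟨δ, hδ⟩ : ∃ δ, δ = min 1 (η / (4 * (L + 1))) := ⟨_, rfl⟩
  have hδ0 : 0 < δ := by rw [hδ]; positivity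
  have hδL : δ * (4 * (L + 1)) ≤ η := by
    have h1 : δ ≤ η / (4 * (L + 1)) := by rw [hδ]; exact min_le_right _ _
    rwa [le_div_iff₀ (by positivity)] at h1
  refine eventually_gridFilter.2 ⟨δ, hδ0, ?_⟩
  filter_upwards [hU _ (isCompact_closedBall x 1) (η / 2) (half_pos hη)] with n hn y k hy hk
  have e1 := hn y (by
    rw [Metric.mem_closedBall, dist_eq_norm]
    exact hy.le.trans (by rw [hδ]; exact min_le_left _ _)) k
  have e2 := hL y x _ (gridTime_mem hT (hNt n) k) t ht
  have e3 := mul_le_mul_of_nonneg_left hy.le hL0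
  have e4 := mul_le_mul_of_nonneg_left hk.le hL0
  rw [Real.dist_eq]
  calc |U n y k - u x t| ≤ |U n y k - u y (gridTime T (Nt n) k)| +
        |u y (gridTime T (Nt n) k) - u x t| := abs_sub_le _ _ _
    _ < η := by linarith

/-- Locally uniform convergence of the discrete value functions. -/
theorem IsGameSequence.eventually_abs_value_sub_lt {q : ℝ}
    (h : IsGameSequence T ℓ f g m₀ Ns Nt ε U M P C) (hq : 1 < q) {a b C₁ : ℝ} (ha : 0 < a)
    (hb : 0 ≤ b) (hC₁ : 0 ≤ C₁)
    (hgr : ∀ z, a * ‖z‖ ^ q - C₁ ≤ ℓ z ∧ ℓ z ≤ b * ‖z‖ ^ q + C₁)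
    (hf : Continuous fun z : E d × P1 d => f z.1 z.2)
    (hg : Continuous fun z : E d × P1 d => g z.1 z.2)
    (hflip : ∀ x y μ, |f x μ - f y μ| ≤ C * ‖x - y‖)
    (hglip : ∀ x y μ, |g x μ - g y μ| ≤ C * ‖x - y‖) (hm : Continuous m)
    (hflow : ∀ r > 0, ∀ᶠ n in atTop, ∀ k,
      edist (simplexToP1 (M n k)) (m (gridTime T (Nt n) k)) ≤ ENNReal.ofReal r)
    (hD : IsControlData ℓ (fun x t => f x (m t)) C) {V : Set (ℝ → E d)}
    (hV : IsControlClass T ℓ V) {Q : Set (E d)} (hQ : IsCompact Q) {η : ℝ} (hη : 0 < η) :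
    ∀ᶠ n in atTop, ∀ x : grid d (Ns n), (x : E d) ∈ Q → ∀ k,
      |U n x k - valueFunction V ℓ (fun x t => f x (m t)) (fun x => g x (m T)) T x
        (gridTime T (Nt n) k)| < η := by
  have hT := h.pos
  have hC := h.nonneg
  have hG : ∀ x y, |g x (m T) - g y (m T)| ≤ C * ‖x - y‖ := fun x y => hglip x y _
  have hGB : ∀ x, |g x (m T)| ≤ C := fun x => h.terminal_bound x _
  obtain ⟨L, hL0, hL⟩ := exists_lipschitz_valueFunction hD hV hG hC
  obtain ⟨B, hB0, hB⟩ := exists_bound_valueFunction hD hV hG hC hGB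
  have hVp := isControlClass_piecewiseConstant T ℓ
  have hupper : ∀ x, ∀ t ∈ Set.Icc 0 T, realUpperLimit T Ns Nt U x t ≤
      valueFunction V ℓ (fun x t => f x (m t)) (fun x => g x (m T)) T x t := by
    intro x t ht
    -- Uniqueness identifies the value function over `V` with the one over piecewise constant
    -- velocities, the only velocities along which the line inequality can be integrated; no density
    -- of controls is used.
    rw [eq_valueFunction hq ha hb hC₁ hgr hD hVp hT hG hC hGB
      (continuousOn_valueFunction hD hV hG hC)
      (valueFunction_isViscositySubsolution hD hV hG hC)
      (valueFunction_isViscositySupersolution hD hV hG hC)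
      (fun x => valueFunction_terminal hV x) x ht]
    refine le_valueFunction hVp fun v hv => ?_
    refine ((h.isLineSubsolution_realUpperLimit hD.continuous_cost hf hm hflow).le_runningCost hD
      hv x ht.1 ht.2 le_rfl).trans (add_le_add le_rfl ?_)
    exact h.realUpperLimit_terminal_le hg hglip hm hflow _
  obtain ⟨R, hR⟩ := hQ.isBounded.exists_norm_le
  filter_upwards [h.eventually_value_le hL0 hL hupper hQ (half_pos hη),
    h.eventually_le_value hf hg hflip hm hflow (valueFunction_isLineSubsolution hD hV hG hC) hB
      (fun x => valueFunction_terminal hV x) R (half_pos hη)] with n h1 h2 x hx k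
  have e1 := h1 x hx k
  have e2 := h2 x (hR x hx) k
  rw [abs_lt]
  constructor <;> linarith

end Convergence

end MFG

/-! ### Assembly of the theorem -/

open MFG

theorem mainTheorem4 (d : ℕ) (T q : ℝ) (hT : 0 < T) (hq : 1 < q)
    (ℓ : MFG.E d → ℝ) (f g : MFG.E d → MFG.P1 d → ℝ)
    (hℓ : MFG.IsKineticCost q ℓ) (hf : MFG.IsCoupling f) (hg : MFG.IsCoupling g)
    (m₀ : ProbabilityMeasure (MFG.E d)) (hm₀ : IsCompact (m₀ : Measure (MFG.E d)).support)
    (Ns Nt : ℕ → ℕ) (ε : ℕ → ℝ)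
    (hNs_pos : ∀ n, 0 < Ns n) (hNt_pos : ∀ n, 0 < Nt n) (hε_pos : ∀ n, 0 < ε n)
    (hNs : Tendsto Ns atTop atTop) (hNt : Tendsto Nt atTop atTop)
    (hε : Tendsto ε atTop (𝓝 0))
    (hratio : Tendsto (fun n => (Nt n : ℝ) / (Ns n : ℝ)) atTop (𝓝 0))
    (hε_small : ε =o[atTop] fun n => 1 / ((Nt n : ℝ) * Real.log (Ns n : ℝ)))
    (U : ∀ n, MFG.grid d (Ns n) → Fin (Nt n + 1) → ℝ)
    (M : ∀ n, Fin (Nt n + 1) → stdSimplex ℝ (MFG.grid d (Ns n)))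
    (P : ∀ n, MFG.grid d (Ns n) → Fin (Nt n) → stdSimplex ℝ (MFG.grid d (Ns n)))
    (hsol : ∀ n, MFG.IsFiniteMFGSolution T ℓ f g m₀ (Ns n) (Nt n) (ε n) (U n) (M n) (P n))
    (j : ℕ → ℕ) (hj : StrictMono j) (ξ : ProbabilityMeasure (MFG.Curve d T))
    (hξ : Tendsto (fun n => MFG.pathLaw T (M (j n) 0) (P (j n))) atTop (𝓝 ξ)) :
    ∃ m : ℝ → MFG.P1 d,
      ContinuousOn m (Set.Icc 0 T) ∧
      (∀ t : Set.Icc (0 : ℝ) T, (m t).toMeasure =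
        (ξ : Measure (MFG.Curve d T)).map fun γ : MFG.Curve d T => γ t) ∧
      ∃ u : MFG.E d → ℝ → ℝ,
        (∀ x : MFG.E d, ∀ t ∈ Set.Icc 0 T, IsGLB (MFG.controlCosts T q ℓ f g m x t) (u x t)) ∧
        MFG.IsContinuousViscositySolution T ℓ f g m u ∧
        (∀ w : MFG.E d → ℝ → ℝ, MFG.IsContinuousViscositySolution T ℓ f g m w →
          ∀ x : MFG.E d, ∀ t ∈ Set.Icc 0 T, w x t = u x t) ∧
        (∀ x : MFG.E d, ∀ t ∈ Set.Icc 0 T,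
          MFG.upperLimit T (fun n => Ns (j n)) (fun n => Nt (j n)) (fun n => U (j n)) x t =
              ((u x t : ℝ) : EReal) ∧
          MFG.lowerLimit T (fun n => Ns (j n)) (fun n => Nt (j n)) (fun n => U (j n)) x t =
              ((u x t : ℝ) : EReal)) ∧
        ∀ Q : Set (MFG.E d), IsCompact Q → ∀ η : ℝ, 0 < η → ∀ᶠ n in atTop,
          ∀ x : MFG.grid d (Ns (j n)), (x : MFG.E d) ∈ Q → ∀ k : Fin (Nt (j n) + 1),
            |U (j n) x k - u x (MFG.gridTime T (Nt (j n)) k)| < η := by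
  obtain ⟨a, b, C₁, ha, hb, hC₁, hgr⟩ := hℓ.growth
  obtain ⟨Cf, hCf, hCf'⟩ := hf.exists_lipschitz
  obtain ⟨Cg, hCg, hCg'⟩ := hg.exists_lipschitz
  have hjt := hj.tendsto_atTop
  obtain ⟨C, hC⟩ : ∃ C, C = max Cf Cg := ⟨_, rfl⟩
  have hfC : Cf ≤ C := by rw [hC]; exact le_max_left _ _
  have hgC : Cg ≤ C := by rw [hC]; exact le_max_right _ _
  -- All assumptions pass to the subsequence, so the estimates are applied to it directly.
  have h : IsGameSequence T ℓ f g m₀ (fun n => Ns (j n)) (fun n => Nt (j n)) (fun n => ε (j n))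
      (fun n => U (j n)) (fun n => M (j n)) (fun n => P (j n)) C :=
    { pos := hT
      space_pos := fun n => hNs_pos _
      time_pos := fun n => hNt_pos _
      eps_nonneg := fun n => (hε_pos _).le
      space_tendsto := hNs.comp hjt
      time_tendsto := hNt.comp hjt
      ratio_tendsto := hratio.comp hjt
      entropy_tendsto :=
        (tendsto_entropy (fun n => (hε_pos n).le) hNs hε_small).comp hjt
      solution := fun n => hsol _
      superlinear := hℓ.superlinear hq
      running_bound := fun x μ => (hCf x μ).trans hfC
      terminal_bound := fun x μ => (hCg x μ).trans hgC
      compact_support := hm₀ }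
  have hflip : ∀ x y μ, |f x μ - f y μ| ≤ C * ‖x - y‖ := fun x y μ =>
    (hCf' x y μ).trans (mul_le_mul_of_nonneg_right hfC (norm_nonneg _))
  have hglip : ∀ x y μ, |g x μ - g y μ| ≤ C * ‖x - y‖ := fun x y μ =>
    (hCg' x y μ).trans (mul_le_mul_of_nonneg_right hgC (norm_nonneg _))
  obtain ⟨m, hm, hmξ, hflow⟩ := h.exists_limit_flow hξ
  have hD : IsControlData ℓ (fun x t => f x (m t)) C :=
    { continuous_cost := hℓ.continuous
      superlinear := hℓ.superlinear hq
      continuous_potential := continuous_comp_flow hf.continuous hm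
      bound := fun x t => h.running_bound x _
      lipschitz := fun x y t => hflip x y _ }
  have hV := isControlClass_sobolevVelocities (T := T) hq hℓ.continuous ha.le hb.le hgr
  have hG : ∀ x y, |g x (m T) - g y (m T)| ≤ C * ‖x - y‖ := fun x y => hglip x y _
  have hGB : ∀ x, |g x (m T)| ≤ C := fun x => h.terminal_bound x _
  have hconv := fun (Q : Set (E d)) (hQ : IsCompact Q) (η : ℝ) (hη : 0 < η) =>
    h.eventually_abs_value_sub_lt hq ha hb.le hC₁.le hgr hf.continuous hg.continuous hflip hglip hm
      hflow hD hV hQ hη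
  obtain ⟨L, hL0, hL⟩ := exists_lipschitz_valueFunction hD hV hG h.nonneg
  refine ⟨m, hm.continuousOn, hmξ,
    valueFunction (sobolevVelocities d T q) ℓ (fun x t => f x (m t)) (fun x => g x (m T)) T,
    fun x t ht => ?_, ⟨continuousOn_valueFunction hD hV hG h.nonneg,
      valueFunction_isViscositySubsolution hD hV hG h.nonneg,
      valueFunction_isViscositySupersolution hD hV hG h.nonneg,
      fun x => valueFunction_terminal hV x⟩, fun w hw x t ht => ?_, fun x t ht => ?_, hconv⟩
  · rw [controlCosts_eq x hV ht]
    exact isGLB_valueFunction hD hV hG h.nonneg x ht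
  · exact eq_valueFunction hq ha hb.le hC₁.le hgr hD hV hT hG h.nonneg hGB hw.continuousOn
      hw.subsolution hw.supersolution hw.terminal x ht
  -- Locally uniform convergence and continuity of the limit give a genuine limit along the grid
  -- filter. The filter is nontrivial, so upper and lower limits both equal it.
  · have := h.neBot x ht
    have hlim := (continuous_coe_real_ereal.tendsto _).comp
      (tendsto_gridFilter hL0 hL hT h.time_pos hconv x ht)
    exact ⟨hlim.limsup_eq, hlim.liminf_eq⟩
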